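/- **Setting.** Let $J_1,\dots,J_N:\mathbb R^M\to\mathbb R$ ($N\ge 1$) be convex and twice differentiable, all minimized at a common point $w^o$, and suppose that $J^{\rm glob}=\sum_{k}J_k$ satisfies $\nu_c I\le\nabla^2J^{\rm glob}(w)\le\delta_c I$ for all $w$, where $0<\nu_c\le\delta_c$. The asynchronous centralized solution is $$\boldsymbol w_i=\boldsymbol w_{i-1}-\boldsymbol\mu(i)\sum_{k=1}^N\boldsymbol\pi_k(i)\,\widehat{\nabla J}_{k,i}(\boldsymbol w_{i-1}),\qquad i\ge 0,$$ with a square-integrable initial condition $\boldsymbol w_{-1}$. Write $\tilde{\boldsymbol w}_i=w^o-\boldsymbol w_i$ and let $\mathcal F_{i-1}$ be the $\sigma$-algebra generated by $\boldsymbol w_{-1},\dots,\boldsymbol w_{i-1}$. Assume: * the step-sizes satisfy $\boldsymbol\mu(i)\in[0,\mu_{\rm ub}]$ and have mean $\bar\mu>0$ and variance $\sigma_\mu^2$ for all $i$; put $\mu_x=\bar\mu+\sigma_\mu^2/\bar\mu$; * $\boldsymbol\pi_k(i)\ge0$, $\sum_k\boldsymbol\pi_k(i)=1$, $\mathbb E\,\boldsymbol\pi_k(i)=1/N$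 and $\operatorname{Var}\boldsymbol\pi_k(i)=\sigma_{\pi,k}^2$ for all $i$ (coefficients with the same $i$ may be correlated); * the step-sizes, the vectors $(\boldsymbol\pi_1(i),\dots,\boldsymbol\pi_N(i))$, $i\ge0$, and the remaining data (initial condition and approximate gradient fields) are mutually independent; * the gradient noises $\boldsymbol s_{k,i}(w)=\widehat{\nabla J}_{k,i}(w)-\nabla J_k(w)$, taken at $\boldsymbol w_{i-1}$, are square integrable and satisfy almost surely $\mathbb E[\boldsymbol s_{k,i}|\mathcal F_{i-1}]=0$, $\mathbb E[\|\boldsymbol s_{k,i}\|^2|\mathcal F_{i-1}]\le\beta_k^2\|\tilde{\boldsymbol w}_{i-1}\|^2+\sigma_{s,k}^2$, and $\mathbb E[\boldsymbol s_{k,i}\boldsymbol s_{\ell,i}^{\sf T}|\mathcal F_{i-1}]=0$ for $k\ne\ell$. Let $\beta_c^2=\sum_k[\beta_k^2+N^2\sigma_{\pi,k}^2(\beta_k^2+\delta_c^2)]$ and $\sigma_s^2=\sum_k(1+N^2\sigma_{\pi,k}^2)\sigma_{s,k}^2$. **(a)** If $\mu_x/N<2\nu_c/(\delta_c^2+\beta_c^2)$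 then, for every $i\ge0$, $$\mathbb E\|\tilde{\boldsymbol w}_i\|^2\le\alpha\,\mathbb E\|\tilde{\boldsymbol w}_{i-1}\|^2+\sigma_s^2(\bar\mu^2+\sigma_\mu^2)/N^2<\infty,\qquad \alpha=1-2\nu_c\frac{\bar\mu}{N}+(\delta_c^2+\beta_c^2)\frac{\bar\mu^2+\sigma_\mu^2}{N^2},$$ and $0\le\alpha<1$. **(b)** There are constants $C$ and $\mu_1>0$, depending only on $N$, $M$, the costs and $\{\beta_k^2,\sigma_{s,k}^2,\sigma_{\pi,k}^2\}$, such that $\limsup_{i\to\infty}\mathbb E\|\tilde{\boldsymbol w}_i\|^2\le C\mu_x$ whenever $\mu_x\le\mu_1$. **(c)** Suppose moreover that, for some $\tau_c,\tau_2\ge0$, $1\le\kappa\le2$ and $r>0$: * $\|\nabla^2J^{\rm glob}(w^o+\delta w)-\nabla^2J^{\rm glob}(w^o)\|\le\tau_c\|\delta w\|$ for $\|\delta w\|\le r$; * for all $k$, $i$ and every $\mathcal F_{i-1}$-measurable $\boldsymbol v$ with $\|\boldsymbol v-w^o\|\le r$, $\boldsymbol s_{k,i}(\boldsymbol v)$ is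 square integrable and $\|R_{s,k,i}(\boldsymbol v)-R_{s,k,i}(w^o)\|\le\tau_2\|\boldsymbol v-w^o\|^\kappa$ almost surely, where $R_{s,k,i}(\boldsymbol v)=\mathbb E[\boldsymbol s_{k,i}(\boldsymbol v)\boldsymbol s_{k,i}(\boldsymbol v)^{\sf T}|\mathcal F_{i-1}]$; * $R_{s,k}=\lim_{i\to\infty}R_{s,k,i}(w^o)$ almost surely, with $R_{s,k}$ a constant matrix; * the noises $\boldsymbol s_{k,i}(\boldsymbol w_{i-1})$ have finite fourth moments and $\mathbb E[\|\boldsymbol s_{k,i}(\boldsymbol w_{i-1})\|^4|\mathcal F_{i-1}]\le\beta_{4,k}\|\tilde{\boldsymbol w}_{i-1}\|^4+\sigma_{4,k}$ almost surely, for some constants $\beta_{4,k},\sigma_{4,k}\ge0$; * $\mu_{\rm ub}^2\le c\,\mu_x$ for some constant $c$. Then there are constants $C$ and $\mu_1>0$, depending only on the quantities listed in (b) and on $R_{s,k},\tau_c,\tau_2,\kappa,r,\beta_{4,k},\sigma_{4,k},c$, such that whenever $\mu_x\le\mu_1$, the mean-square deviation ${\rm MSD}=\limsup_{i\to\infty}\mathbb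 E\|\tilde{\boldsymbol w}_i\|^2$ satisfies $$\Big|{\rm MSD}-\frac{\mu_x}{2N}\operatorname{Tr}\Big[\Big(\sum_{k=1}^NH_k\Big)^{-1}\Big(\sum_{k=1}^N(1+N^2\sigma_{\pi,k}^2)R_{s,k}\Big)\Big]\Big|\le C\mu_x^{3/2},\qquad H_k=\nabla^2J_k(w^o),$$ and the same bound holds with $\mathbb E\|\tilde{\boldsymbol w}_i\|^2$ in place of MSD for all sufficiently large $i$. -/

import Mathlib

open MeasureTheory ProbabilityTheory Filter Topology

universe u

noncomputable section

/-! ### Cost functions -/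

/-- Parameter space `ℝ^M` with the Euclidean norm. -/
abbrev Vec (M : ℕ) : Type := EuclideanSpace ℝ (Fin M)

/-- `J` is twice differentiable: `J` and its gradient are differentiable everywhere. -/
def TwiceDifferentiable {M : ℕ} (J : Vec M → ℝ) : Prop :=
  Differentiable ℝ J ∧ Differentiable ℝ (gradient J)

/-- The Hessian matrix `∇²J(w)`: its `(a, b)` entry is `∂_b (∂_a J) (w)`. -/
def hessian {M : ℕ} (J : Vec M → ℝ) (w : Vec M) : Matrix (Fin M) (Fin M) ℝ :=
  Matrix.of fun a b => (fderiv ℝ (gradient J) w (EuclideanSpace.single b 1)) a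

/-- The spectral norm (operator norm for the Euclidean norm) of a square matrix. -/
def specNorm {M : ℕ} (A : Matrix (Fin M) (Fin M) ℝ) : ℝ :=
  ‖Matrix.toEuclideanCLM (n := Fin M) (𝕜 := ℝ) A‖

/-- Conditions on a cost: twice differentiable with `0 < ν I ≤ ∇²J(w) ≤ δ I` for all `w`. -/
structure CostCond {M : ℕ} (J : Vec M → ℝ) (ν δ : ℝ) : Prop where
  twiceDiff : TwiceDifferentiable J
  nu_pos : 0 < ν
  nu_le : ν ≤ δ
  lower : ∀ w, (hessian J w - ν • (1 : Matrix (Fin M) (Fin M) ℝ)).PosSemidef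
  upper : ∀ w, (δ • (1 : Matrix (Fin M) (Fin M) ℝ) - hessian J w).PosSemidef

/-- The aggregate cost `J^glob(w) = ∑_k J_k(w)`. -/
def aggregateCost {M N : ℕ} (J : Fin N → Vec M → ℝ) : Vec M → ℝ := fun w => ∑ k, J k w

/-- The Hessian is `τ`-Lipschitz at `w^o` for perturbations of norm at most `r`. -/
def HessianLipschitzAt {M : ℕ} (J : Vec M → ℝ) (wo : Vec M) (τ r : ℝ) : Prop :=
  ∀ d : Vec M, ‖d‖ ≤ r → specNorm (hessian J (wo + d) - hessian J wo) ≤ τ * ‖d‖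

/-! ### The asynchronous centralized algorithm -/

/-- The random ingredients of the algorithm: the step-sizes `μ(i)`, the fusion coefficients
`π_k(i)`, the approximate gradient of `J_k` used at time `i` (as a random field in `w`), and the
initial condition `w_{-1}`. -/
structure CentralizedAlgorithm (M N : ℕ) (Ω : Type*) where
  step : ℕ → Ω → ℝ
  fusion : ℕ → Fin N → Ω → ℝ
  approxGrad : ℕ → Fin N → Vec M → Ω → Vec M
  init : Ω → Vec M

namespace CentralizedAlgorithm

variable {M N : ℕ} {Ω : Type*}

/-- The iterates, with the index shifted by one: `A.iter n` is `w_{n-1}`, so `A.iter 0 = w_{-1}`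
and `w_i = w_{i-1} - μ(i) ∑_k π_k(i) ĝ_{k,i}(w_{i-1})` for `i ≥ 0`. -/
def iter (A : CentralizedAlgorithm M N Ω) : ℕ → Ω → Vec M
  | 0 => A.init
  | i + 1 => fun ω => A.iter i ω -
      A.step i ω • ∑ k, A.fusion i k ω • A.approxGrad i k (A.iter i ω) ω

/-- `A.past i` is `F_{i-1}`, the σ-algebra generated by `w_{-1}, …, w_{i-1}`. -/
@[reducible] def past (A : CentralizedAlgorithm M N Ω) (i : ℕ) : MeasurableSpace Ω :=
  ⨆ j ∈ Set.Iic i, MeasurableSpace.comap (A.iter j) inferInstance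

/-- The gradient noise `s_{k,i}(v) = ĝ_{k,i}(v) - ∇J_k(v)` at a (possibly random) point `v`. -/
def noise (A : CentralizedAlgorithm M N Ω) (J : Fin N → Vec M → ℝ) (i : ℕ) (k : Fin N)
    (v : Ω → Vec M) : Ω → Vec M :=
  fun ω => A.approxGrad i k (v ω) ω - gradient (J k) (v ω)

/-- The sources of randomness: the σ-algebra `D` carrying the data, each step-size `μ(i)`, and
each vector of fusion coefficients `(π_1(i), …, π_N(i))`. -/
@[reducible] def source (A : CentralizedAlgorithm M N Ω) (D : MeasurableSpace Ω) :
    Option (ℕ ⊕ ℕ) → MeasurableSpace Ω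
  | none => D
  | some (Sum.inl i) => MeasurableSpace.comap (A.step i) inferInstance
  | some (Sum.inr i) => MeasurableSpace.comap (fun ω k => A.fusion i k ω) inferInstance

end CentralizedAlgorithm

/-- The conditional cross moment matrix `E[x yᵀ | m]`, entry by entry. -/
def condCross {M : ℕ} {Ω : Type*} [MeasurableSpace Ω] (P : Measure Ω) (m : MeasurableSpace Ω)
    (x y : Ω → Vec M) (ω : Ω) : Matrix (Fin M) (Fin M) ℝ :=
  Matrix.of fun a b => (P[fun ω' => x ω' a * y ω' b | m]) ω

/-! ### Assumptions on the random quantities -/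

/-- The step-sizes are bounded random variables in `[0, μub]` with mean `μbar > 0` and variance
`σμ2`, the same for all `i`. -/
structure StepSizeCond {M N : ℕ} {Ω : Type*} [MeasurableSpace Ω] (P : Measure Ω)
    (A : CentralizedAlgorithm M N Ω) (μbar σμ2 μub : ℝ) : Prop where
  measurable : ∀ i, Measurable (A.step i)
  bounded : ∀ i, ∀ᵐ ω ∂P, A.step i ω ∈ Set.Icc 0 μub
  mean : ∀ i, ∫ ω, A.step i ω ∂P = μbar
  variance : ∀ i, ∫ ω, (A.step i ω - μbar) ^ 2 ∂P = σμ2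
  mean_pos : 0 < μbar

/-- The fusion coefficients are nonnegative, sum to one, and have mean `1/N` and variances
`σπ2 k`. Coefficients with the same time index may be correlated. -/
structure FusionCond {M N : ℕ} {Ω : Type*} [MeasurableSpace Ω] (P : Measure Ω)
    (A : CentralizedAlgorithm M N Ω) (σπ2 : Fin N → ℝ) : Prop where
  measurable : ∀ i k, Measurable (A.fusion i k)
  nonneg : ∀ i k, ∀ᵐ ω ∂P, 0 ≤ A.fusion i k ω
  sum_eq_one : ∀ i, ∀ᵐ ω ∂P, ∑ k, A.fusion i k ω = 1
  mean : ∀ i k, ∫ ω, A.fusion i k ω ∂P = 1 / N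
  variance : ∀ i k, ∫ ω, (A.fusion i k ω - 1 / N) ^ 2 ∂P = σπ2 k

/-- Each step-size and each vector of fusion coefficients is independent of all the other random
quantities: the step-sizes, the fusion vectors, and a σ-algebra `D` carrying the initial condition
and the approximate gradient fields are mutually independent. -/
def IndependentSources {M N : ℕ} {Ω : Type*} [mΩ : MeasurableSpace Ω] (P : Measure Ω)
    (A : CentralizedAlgorithm M N Ω) : Prop :=
  ∃ D : MeasurableSpace Ω, D ≤ mΩ ∧
    Measurable[D] A.init ∧
    (∀ i k, Measurable[(inferInstance : MeasurableSpace (Vec M)).prod D]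
      (fun p : Vec M × Ω => A.approxGrad i k p.1 p.2)) ∧
    iIndep (A.source D) P

/-- Conditions on the individual gradient noises at the iterates: conditionally zero mean,
conditional variance at most `β_k² ‖w^o - w_{i-1}‖² + σ_{s,k}²`, and conditionally uncorrelated
across the agents. -/
structure NoiseCond {M N : ℕ} {Ω : Type*} [MeasurableSpace Ω] (P : Measure Ω)
    (A : CentralizedAlgorithm M N Ω) (J : Fin N → Vec M → ℝ) (wo : Vec M)
    (β2 σs2 : Fin N → ℝ) : Prop where
  memLp : ∀ i k, MemLp (A.noise J i k (A.iter i)) 2 P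
  mean_zero : ∀ i k, P[A.noise J i k (A.iter i) | A.past i] =ᵐ[P] 0
  var_le : ∀ i k, P[fun ω => ‖A.noise J i k (A.iter i) ω‖ ^ 2 | A.past i] ≤ᵐ[P]
    fun ω => β2 k * ‖wo - A.iter i ω‖ ^ 2 + σs2 k
  uncorrelated : ∀ i k l, k ≠ l → ∀ᵐ ω ∂P,
    condCross P (A.past i) (A.noise J i k (A.iter i)) (A.noise J i l (A.iter i)) ω = 0

/-- All standing conditions on one run of the asynchronous centralized algorithm. -/
structure AsyncCentralizedModel {M N : ℕ} {Ω : Type*} [MeasurableSpace Ω] (P : Measure Ω)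
    (A : CentralizedAlgorithm M N Ω) (J : Fin N → Vec M → ℝ) (wo : Vec M)
    (β2 σs2 σπ2 : Fin N → ℝ) (μbar σμ2 μub : ℝ) : Prop where
  init_memLp : MemLp A.init 2 P
  step : StepSizeCond P A μbar σμ2 μub
  fusion : FusionCond P A σπ2
  indep : IndependentSources P A
  noise : NoiseCond P A J wo β2 σs2

/-- Smoothness of the individual noise covariances `R_{s,k,i}(v) = E[s_{k,i}(v) s_{k,i}(v)ᵀ | F_{i-1}]`
near `w^o`, for `F_{i-1}`-measurable `v`:
`‖R_{s,k,i}(v) - R_{s,k,i}(w^o)‖ ≤ τ₂ ‖v - w^o‖^κ` whenever `‖v - w^o‖ ≤ r`. -/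
def CovarianceSmooth {M N : ℕ} {Ω : Type*} [MeasurableSpace Ω] (P : Measure Ω)
    (A : CentralizedAlgorithm M N Ω) (J : Fin N → Vec M → ℝ) (wo : Vec M) (τ₂ κ r : ℝ) : Prop :=
  ∀ i k, ∀ v : Ω → Vec M, Measurable[A.past i] v → (∀ ω, ‖v ω - wo‖ ≤ r) →
    MemLp (A.noise J i k v) 2 P ∧
    ∀ᵐ ω ∂P,
      specNorm (condCross P (A.past i) (A.noise J i k v) (A.noise J i k v) ω -
        condCross P (A.past i) (A.noise J i k fun _ => wo) (A.noise J i k fun _ => wo) ω)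
      ≤ τ₂ * ‖v ω - wo‖ ^ κ

/-- `R_{s,k} = lim_i E[s_{k,i}(w^o) s_{k,i}(w^o)ᵀ | F_{i-1}]` almost surely, for every agent. -/
def CovarianceLimit {M N : ℕ} {Ω : Type*} [MeasurableSpace Ω] (P : Measure Ω)
    (A : CentralizedAlgorithm M N Ω) (J : Fin N → Vec M → ℝ) (wo : Vec M)
    (Rs : Fin N → Matrix (Fin M) (Fin M) ℝ) : Prop :=
  ∀ k, (∀ i, MemLp (A.noise J i k fun _ => wo) 2 P) ∧
    ∀ᵐ ω ∂P, ∀ a b, Tendsto (fun i =>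
      condCross P (A.past i) (A.noise J i k fun _ => wo) (A.noise J i k fun _ => wo) ω a b)
      atTop (𝓝 (Rs k a b))

/-- Fourth-order moment condition on the individual gradient noises at the iterates. -/
def FourthMomentCond {M N : ℕ} {Ω : Type*} [MeasurableSpace Ω] (P : Measure Ω)
    (A : CentralizedAlgorithm M N Ω) (J : Fin N → Vec M → ℝ) (wo : Vec M)
    (β4 σ4 : Fin N → ℝ) : Prop :=
  ∀ i k, MemLp (A.noise J i k (A.iter i)) 4 P ∧
    P[fun ω => ‖A.noise J i k (A.iter i) ω‖ ^ 4 | A.past i] ≤ᵐ[P]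
      fun ω => β4 k * ‖wo - A.iter i ω‖ ^ 4 + σ4 k

/-! ### The quantities in the statement -/

/-- `μ_x = μbar + σ_μ² / μbar`. -/
def muX (μbar σμ2 : ℝ) : ℝ := μbar + σμ2 / μbar

/-- `β_c² = ∑_k [β_k² + N² σ_{π,k}² (β_k² + δ_c²)]`. -/
def betaC2 {N : ℕ} (δc : ℝ) (β2 σπ2 : Fin N → ℝ) : ℝ :=
  ∑ k, (β2 k + (N : ℝ) ^ 2 * σπ2 k * (β2 k + δc ^ 2))

/-- `σ_s² = ∑_k (1 + N² σ_{π,k}²) σ_{s,k}²`. -/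
def sigmaS2 {N : ℕ} (σs2 σπ2 : Fin N → ℝ) : ℝ :=
  ∑ k, (1 + (N : ℝ) ^ 2 * σπ2 k) * σs2 k

/-- `α = 1 - 2 ν_c μbar / N + (δ_c² + β_c²)(μbar² + σ_μ²) / N²`. -/
def alphaCent {N : ℕ} (νc δc : ℝ) (β2 σπ2 : Fin N → ℝ) (μbar σμ2 : ℝ) : ℝ :=
  1 - 2 * νc * (μbar / N) + (δc ^ 2 + betaC2 δc β2 σπ2) * (μbar ^ 2 + σμ2) / (N : ℝ) ^ 2

/-- The mean-square error with the shifted index: `mse P A wo n = E ‖w^o - w_{n-1}‖²`. -/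
def mse {M N : ℕ} {Ω : Type*} [MeasurableSpace Ω] (P : Measure Ω)
    (A : CentralizedAlgorithm M N Ω) (wo : Vec M) (n : ℕ) : ℝ :=
  ∫ ω, ‖wo - A.iter n ω‖ ^ 2 ∂P

/-- The steady-state mean-square deviation, as the upper limit of the mean-square error (the
limit itself where it exists). -/
def msd {M N : ℕ} {Ω : Type*} [MeasurableSpace Ω] (P : Measure Ω)
    (A : CentralizedAlgorithm M N Ω) (wo : Vec M) : ℝ :=
  limsup (mse P A wo) atTop

/-- `(μ_x / 2N) Tr[(∑_k H_k)⁻¹ (∑_k (1 + N² σ_{π,k}²) R_{s,k})]` with `H_k = ∇²J_k(w^o)`. -/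
def msdFormula {M N : ℕ} (J : Fin N → Vec M → ℝ) (wo : Vec M) (σπ2 : Fin N → ℝ)
    (Rs : Fin N → Matrix (Fin M) (Fin M) ℝ) (μx : ℝ) : ℝ :=
  μx / (2 * N) * Matrix.trace
    ((∑ k, hessian (J k) wo)⁻¹ * ∑ k, (1 + (N : ℝ) ^ 2 * σπ2 k) • Rs k)

end

/-
Along a run of the algorithm the error `x = w - w^o` moves by `-μ ∑ π_k (∇J_k(w) + s_k)`. The
step-size and the fusion weights are independent of everything else, so second moments split into
a gradient part and a noise part with the explicit weights `E π_k π_l` and `1/N² + σ_{π,k}²`; the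
coercivity of the aggregate cost then makes `E ‖x‖²` contract up to a source of size `μ_x`, and in
the same way `E ‖x‖⁴` contracts to size `μ_x²`. The initial condition has only two moments, so the
fourth moments are taken on an event of the initial past on which it is bounded; off that event the
second moment forgets its initial value and is negligible.

For the mean-square deviation, let `u` be a unit eigenvector of `∇²J^glob(w^o)` with eigenvalue `l`.
Up to terms of order `μ_x^{3/2}` per unit of `μbar`, the scalar `p_n = E ⟨u, x_n⟩²` satisfies
`p_{n+1} = (1 - 2 l μbar / N) p_n + μbar μ_x ∑_k (1/N² + σ_{π,k}²) ⟨u, R_{s,k} u⟩`: the error of the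
linearization is cubic in `x`, hence controlled by the second and fourth moments. Summing the fixed
points over an orthonormal eigenbasis gives the trace formula.
-/

open scoped RealInnerProductSpace

section Gradient

theorem hasDerivAt_comp_add_smul {E F : Type*} [NormedAddCommGroup E] [NormedSpace ℝ E]
    [NormedAddCommGroup F] [NormedSpace ℝ F] {g : E → F}
    (hg : Differentiable ℝ g) (x v : E) (t : ℝ) :
    HasDerivAt (fun t : ℝ => g (x + t • v)) (fderiv ℝ g (x + t • v) v) t := by
  have hline : HasDerivAt (fun t : ℝ => x + t • v) v t := by
    simpa using ((hasDerivAt_id t).smul_const v).const_add x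
  exact (hg (x + t • v)).hasFDerivAt.comp_hasDerivAt t hline

variable {E : Type*} [NormedAddCommGroup E] [InnerProductSpace ℝ E] [CompleteSpace E]
  {f : E → ℝ}

theorem hasDerivAt_inner_gradient_add_smul (hf : Differentiable ℝ (gradient f)) (x v : E)
    (t : ℝ) : HasDerivAt (fun t : ℝ => ⟪gradient f (x + t • v), v⟫)
      ⟪fderiv ℝ (gradient f) (x + t • v) v, v⟫ t := by
  simpa using (hasDerivAt_comp_add_smul hf x v t).inner ℝ (hasDerivAt_const t v)

theorem add_inner_gradient_le_of_convexOn (hconv : ConvexOn ℝ Set.univ f)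
    (hf : Differentiable ℝ f) (x v : E) : f x + ⟪gradient f x, v⟫ ≤ f (x + v) := by
  have hline : ConvexOn ℝ Set.univ (fun t : ℝ => f (x + t • v)) := by
    have := hconv.comp_affineMap (AffineMap.lineMap x (x + v) : ℝ →ᵃ[ℝ] E)
    simpa [Function.comp_def, AffineMap.lineMap_apply, add_comm] using this
  have hslope := hline.le_slope_of_hasDerivAt (Set.mem_univ 0) (Set.mem_univ 1) one_pos
    (hasDerivAt_comp_add_smul hf x v 0)
  simp only [slope_def_field, zero_smul, add_zero, one_smul, sub_zero, div_one,
    ← inner_gradient_left] at hslope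
  linarith

theorem mul_norm_sq_le_inner_gradient_sub {ν : ℝ} (hf : Differentiable ℝ (gradient f))
    (hν : ∀ w v, ν * ‖v‖ ^ 2 ≤ ⟪fderiv ℝ (gradient f) w v, v⟫) (x v : E) :
    ν * ‖v‖ ^ 2 ≤ ⟪gradient f (x + v) - gradient f x, v⟫ := by
  have hderiv := hasDerivAt_inner_gradient_add_smul hf x v
  have := mul_sub_le_image_sub_of_le_deriv (fun t => (hderiv t).differentiableAt)
    (fun t => (hν _ v).trans_eq (hderiv t).deriv.symm) (zero_le_one' ℝ)
  simpa [inner_sub_left] using this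

theorem inner_gradient_sub_le_mul_norm_sq {δ : ℝ} (hf : Differentiable ℝ (gradient f))
    (hδ : ∀ w v, ⟪fderiv ℝ (gradient f) w v, v⟫ ≤ δ * ‖v‖ ^ 2) (x v : E) :
    ⟪gradient f (x + v) - gradient f x, v⟫ ≤ δ * ‖v‖ ^ 2 := by
  have hderiv := hasDerivAt_inner_gradient_add_smul hf x v
  have := image_sub_le_mul_sub_of_deriv_le (fun t => (hderiv t).differentiableAt)
    (fun t => (hderiv t).deriv.trans_le (hδ _ v)) (zero_le_one' ℝ)
  simpa [inner_sub_left] using this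

theorem le_add_inner_gradient_add_mul_norm_sq {δ : ℝ} (hf : Differentiable ℝ f)
    (hf' : Differentiable ℝ (gradient f))
    (hδ : ∀ w v, ⟪fderiv ℝ (gradient f) w v, v⟫ ≤ δ * ‖v‖ ^ 2) (x v : E) :
    f (x + v) ≤ f x + ⟪gradient f x, v⟫ + δ / 2 * ‖v‖ ^ 2 := by
  set gap : ℝ → ℝ := fun t =>
    f (x + t • v) - (t * ⟪gradient f x, v⟫ + t ^ 2 * (δ / 2 * ‖v‖ ^ 2))
  have hgap : ∀ t, HasDerivAt gap
      (⟪gradient f (x + t • v), v⟫ - (⟪gradient f x, v⟫ + t * (δ * ‖v‖ ^ 2))) t := fun t => by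
    refine ((hasDerivAt_comp_add_smul hf x v t).sub
      (((hasDerivAt_id t).mul_const ⟪gradient f x, v⟫).add
        (((hasDerivAt_id t).pow 2).mul_const (δ / 2 * ‖v‖ ^ 2)))).congr_deriv ?_
    simp only [id, one_mul, pow_one, Nat.cast_ofNat, Nat.reduceSub, mul_one, inner_gradient_left]
    ring
  have hanti : AntitoneOn gap (Set.Icc 0 1) := by
    refine antitoneOn_of_deriv_nonpos (convex_Icc 0 1)
      (fun t _ => (hgap t).continuousAt.continuousWithinAt)
      (fun t _ => (hgap t).differentiableAt.differentiableWithinAt) fun t ht => ?_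
    have ht0 : 0 < t := by
      rw [interior_Icc] at ht
      exact ht.1
    have hinc := inner_gradient_sub_le_mul_norm_sq hf' hδ x (t • v)
    simp only [inner_smul_right, norm_smul, Real.norm_eq_abs, mul_pow, sq_abs] at hinc
    rw [show δ * (t ^ 2 * ‖v‖ ^ 2) = t * (t * (δ * ‖v‖ ^ 2)) by ring,
      mul_le_mul_iff_right₀ ht0, inner_sub_left] at hinc
    rw [(hgap t).deriv]
    linarith
  have := hanti (Set.left_mem_Icc.2 zero_le_one) (Set.right_mem_Icc.2 zero_le_one) zero_le_one
  simp only [gap, one_smul, one_mul, one_pow, zero_smul, add_zero, zero_mul, ne_eq,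
    OfNat.ofNat_ne_zero, not_false_eq_true, zero_pow, sub_zero] at this
  linarith

theorem gradient_eq_zero_of_isMinOn {wo : E} (hmin : IsMinOn f Set.univ wo) :
    gradient f wo = 0 := by
  rw [← map_eq_zero_iff _ (InnerProductSpace.toDual ℝ E).injective, toDual_gradient]
  exact IsLocalMin.fderiv_eq_zero (hmin.isLocalMin Filter.univ_mem)

/-- Compare the minimum with the value reached by the gradient step `-δ⁻¹ ∇f(w)`. -/
theorem norm_sq_gradient_le_of_isMinOn {wo w : E} {δ : ℝ} (hδ : 0 < δ)
    (hmin : IsMinOn f Set.univ wo)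
    (hub : ∀ v, f (w + v) ≤ f w + ⟪gradient f w, v⟫ + δ / 2 * ‖v‖ ^ 2) :
    ‖gradient f w‖ ^ 2 ≤ 2 * δ * (f w - f wo) := by
  have hstep := (isMinOn_iff.1 hmin _ (Set.mem_univ _)).trans (hub (-δ⁻¹ • gradient f w))
  rw [inner_smul_right, real_inner_self_eq_norm_sq, norm_smul, mul_pow, norm_neg,
    Real.norm_eq_abs, sq_abs] at hstep
  have hdecrease : -δ⁻¹ * ‖gradient f w‖ ^ 2 + δ / 2 * (δ⁻¹ ^ 2 * ‖gradient f w‖ ^ 2) =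
      -(‖gradient f w‖ ^ 2 / (2 * δ)) := by
    field_simp
    ring
  have : ‖gradient f w‖ ^ 2 / (2 * δ) ≤ f w - f wo := by linarith
  rwa [div_le_iff₀' (by positivity)] at this

theorem norm_gradient_sub_fderiv_le {wo w : E} {τ : ℝ} (hf : Differentiable ℝ (gradient f))
    (hmin : IsMinOn f Set.univ wo) (hτ : 0 ≤ τ)
    (hlip : ∀ x ∈ Metric.closedBall wo ‖w - wo‖,
      ‖fderiv ℝ (gradient f) x - fderiv ℝ (gradient f) wo‖ ≤ τ * ‖x - wo‖) :
    ‖gradient f w - fderiv ℝ (gradient f) wo (w - wo)‖ ≤ τ * ‖w - wo‖ ^ 2 := by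
  have hrem : ∀ x, HasFDerivAt (fun w => gradient f w - fderiv ℝ (gradient f) wo w)
      (fderiv ℝ (gradient f) x - fderiv ℝ (gradient f) wo) x :=
    fun x => (hf x).hasFDerivAt.sub (ContinuousLinearMap.hasFDerivAt _)
  have hmean := (convex_closedBall wo ‖w - wo‖).norm_image_sub_le_of_norm_hasFDerivWithin_le
    (C := τ * ‖w - wo‖) (fun x _ => (hrem x).hasFDerivWithinAt)
    (fun x hx => (hlip x hx).trans (by
      rw [Metric.mem_closedBall, dist_eq_norm] at hx
      gcongr))
    (Metric.mem_closedBall_self (norm_nonneg _)) (y := w) (by simp [dist_eq_norm])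
  rw [gradient_eq_zero_of_isMinOn hmin] at hmean
  rwa [zero_sub, sub_neg_eq_add, sub_add, ← map_sub, mul_assoc, ← pow_two] at hmean

end Gradient

section Costs

variable {M N : ℕ}

theorem toEuclideanCLM_hessian (J : Vec M → ℝ) (w : Vec M) :
    Matrix.toEuclideanCLM (n := Fin M) (𝕜 := ℝ) (hessian J w) = fderiv ℝ (gradient J) w := by
  refine ContinuousLinearMap.coe_injective ?_
  refine (EuclideanSpace.basisFun (Fin M) ℝ).toBasis.ext fun b => ?_
  ext a
  simp [hessian, Matrix.mulVec_single]

theorem gradient_aggregateCost {J : Fin N → Vec M → ℝ} (hJ : ∀ k, Differentiable ℝ (J k))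
    (w : Vec M) : gradient (aggregateCost J) w = ∑ k, gradient (J k) w := by
  refine HasGradientAt.gradient ?_
  rw [hasGradientAt_iff_hasFDerivAt, map_sum]
  exact HasFDerivAt.fun_sum fun k _ => by simpa [toDual_gradient] using (hJ k w).hasFDerivAt

theorem hessian_aggregateCost {J : Fin N → Vec M → ℝ} (hJ : ∀ k, TwiceDifferentiable (J k))
    (w : Vec M) : hessian (aggregateCost J) w = ∑ k, hessian (J k) w := by
  have hgrad : gradient (aggregateCost J) = fun w => ∑ k, gradient (J k) w :=
    funext (gradient_aggregateCost fun k => (hJ k).1)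
  ext a b
  simp only [hessian, hgrad, Matrix.of_apply, Matrix.sum_apply]
  rw [fderiv_fun_sum fun k _ => (hJ k).2 w]
  simp

theorem isMinOn_aggregateCost {J : Fin N → Vec M → ℝ} {wo : Vec M}
    (hmin : ∀ k, IsMinOn (J k) Set.univ wo) : IsMinOn (aggregateCost J) Set.univ wo :=
  isMinOn_iff.2 fun w hw => Finset.sum_le_sum fun k _ => isMinOn_iff.1 (hmin k) w hw

theorem inner_toEuclideanCLM_sub_smul_one (A : Matrix (Fin M) (Fin M) ℝ) (c : ℝ) (v : Vec M) :
    ⟪Matrix.toEuclideanCLM (n := Fin M) (𝕜 := ℝ) (A - c • 1) v, v⟫ =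
      ⟪Matrix.toEuclideanCLM (n := Fin M) (𝕜 := ℝ) A v, v⟫ - c * ‖v‖ ^ 2 := by
  simp [inner_sub_left, inner_smul_left]

theorem inner_toEuclideanCLM_nonneg {A : Matrix (Fin M) (Fin M) ℝ} (hA : A.PosSemidef)
    (v : Vec M) : 0 ≤ ⟪Matrix.toEuclideanCLM (n := Fin M) (𝕜 := ℝ) A v, v⟫ := by
  rw [real_inner_comm, Matrix.inner_toEuclideanCLM]
  exact hA.dotProduct_mulVec_nonneg v.ofLp

namespace CostCond

variable {J : Vec M → ℝ} {wo : Vec M} {ν δ : ℝ}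

theorem delta_pos (h : CostCond J ν δ) : 0 < δ := h.nu_pos.trans_le h.nu_le

theorem mul_norm_sq_le_inner_hessian (h : CostCond J ν δ) (w v : Vec M) :
    ν * ‖v‖ ^ 2 ≤ ⟪fderiv ℝ (gradient J) w v, v⟫ := by
  have := inner_toEuclideanCLM_nonneg (h.lower w) v
  rw [inner_toEuclideanCLM_sub_smul_one, toEuclideanCLM_hessian] at this
  linarith

theorem inner_hessian_le_mul_norm_sq (h : CostCond J ν δ) (w v : Vec M) :
    ⟪fderiv ℝ (gradient J) w v, v⟫ ≤ δ * ‖v‖ ^ 2 := by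
  have := inner_toEuclideanCLM_nonneg (h.upper w) v
  rw [← neg_sub, map_neg, neg_apply, inner_neg_left, inner_toEuclideanCLM_sub_smul_one,
    toEuclideanCLM_hessian] at this
  linarith

theorem isHermitian_hessian (h : CostCond J ν δ) (w : Vec M) : (hessian J w).IsHermitian := by
  simpa using (h.lower w).isHermitian.add
    (show (ν • (1 : Matrix (Fin M) (Fin M) ℝ)).IsHermitian by simp [Matrix.IsHermitian])

theorem inner_eigenvectorBasis_hessian (h : CostCond J ν δ) (w : Vec M) (a : Fin M) (v : Vec M) :
    ⟪(h.isHermitian_hessian w).eigenvectorBasis a, fderiv ℝ (gradient J) w v⟫ =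
      (h.isHermitian_hessian w).eigenvalues a *
        ⟪(h.isHermitian_hessian w).eigenvectorBasis a, v⟫ := by
  set hH := h.isHermitian_hessian w
  rw [← toEuclideanCLM_hessian, Matrix.inner_toEuclideanCLM, Matrix.dotProduct_mulVec,
    ← Matrix.mulVec_transpose, ← Matrix.conjTranspose_eq_transpose_of_trivial, hH.eq,
    hH.mulVec_eigenvectorBasis, smul_dotProduct, smul_eq_mul, real_inner_comm,
    EuclideanSpace.inner_eq_star_dotProduct, star_trivial]

theorem eigenvalues_hessian_mem_Icc (h : CostCond J ν δ) (w : Vec M) (a : Fin M) :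
    (h.isHermitian_hessian w).eigenvalues a ∈ Set.Icc ν δ := by
  have hlower := h.mul_norm_sq_le_inner_hessian w ((h.isHermitian_hessian w).eigenvectorBasis a)
  have hupper := h.inner_hessian_le_mul_norm_sq w ((h.isHermitian_hessian w).eigenvectorBasis a)
  rw [real_inner_comm, h.inner_eigenvectorBasis_hessian, real_inner_self_eq_norm_sq,
    (h.isHermitian_hessian w).eigenvectorBasis.norm_eq_one, one_pow, mul_one, mul_one]
    at hlower hupper
  exact ⟨hlower, hupper⟩

theorem mul_norm_sq_le_inner_gradient (h : CostCond J ν δ) (hmin : IsMinOn J Set.univ wo)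
    (w : Vec M) : ν * ‖w - wo‖ ^ 2 ≤ ⟪w - wo, gradient J w⟫ := by
  have := mul_norm_sq_le_inner_gradient_sub h.twiceDiff.2 h.mul_norm_sq_le_inner_hessian
    wo (w - wo)
  rwa [gradient_eq_zero_of_isMinOn hmin, sub_zero, add_sub_cancel, real_inner_comm] at this

theorem sub_le_mul_norm_sq (h : CostCond J ν δ) (hmin : IsMinOn J Set.univ wo) (w : Vec M) :
    J w - J wo ≤ δ / 2 * ‖w - wo‖ ^ 2 := by
  have := le_add_inner_gradient_add_mul_norm_sq h.twiceDiff.1 h.twiceDiff.2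
    h.inner_hessian_le_mul_norm_sq wo (w - wo)
  rw [gradient_eq_zero_of_isMinOn hmin, inner_zero_left, add_zero, add_sub_cancel] at this
  linarith

theorem norm_gradient_le (h : CostCond J ν δ) (hmin : IsMinOn J Set.univ wo) (w : Vec M) :
    ‖gradient J w‖ ≤ δ * ‖w - wo‖ := by
  have hδ := h.delta_pos
  refine le_of_sq_le_sq ?_ (by positivity)
  calc ‖gradient J w‖ ^ 2 ≤ 2 * δ * (J w - J wo) :=
        norm_sq_gradient_le_of_isMinOn hδ hmin (le_add_inner_gradient_add_mul_norm_sq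
          h.twiceDiff.1 h.twiceDiff.2 h.inner_hessian_le_mul_norm_sq w)
    _ ≤ 2 * δ * (δ / 2 * ‖w - wo‖ ^ 2) := by
        gcongr
        exact h.sub_le_mul_norm_sq hmin w
    _ = (δ * ‖w - wo‖) ^ 2 := by ring

variable {u : Vec M} {l : ℝ}

theorem abs_inner_gradient_sub_le (h : CostCond J ν δ) (hmin : IsMinOn J Set.univ wo)
    (hu : ‖u‖ = 1) (hl : l ∈ Set.Icc ν δ) (w : Vec M) :
    |⟪u, gradient J w⟫ - l * ⟪u, w - wo⟫| ≤ 2 * δ * ‖w - wo‖ := by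
  have hgrad : |⟪u, gradient J w⟫| ≤ δ * ‖w - wo‖ := by
    simpa [hu] using (abs_real_inner_le_norm u _).trans
      (mul_le_mul_of_nonneg_left (h.norm_gradient_le hmin w) (norm_nonneg u))
  have hlin : |l * ⟪u, w - wo⟫| ≤ δ * ‖w - wo‖ := by
    have hinner : |⟪u, w - wo⟫| ≤ ‖w - wo‖ := by simpa [hu] using abs_real_inner_le_norm u (w - wo)
    rw [abs_mul, abs_of_pos (h.nu_pos.trans_le hl.1)]
    exact mul_le_mul hl.2 hinner (abs_nonneg _) h.delta_pos.le
  linarith [abs_sub ⟪u, gradient J w⟫ (l * ⟪u, w - wo⟫)]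

/-- Inside the ball of radius `r` this is the Lipschitz bound on the Hessian; outside, the
first-order bound is already quadratic at the price of a factor `1 / r`. -/
theorem abs_inner_gradient_sub_le_sq (h : CostCond J ν δ) (hmin : IsMinOn J Set.univ wo)
    {τ r : ℝ} (hτ : 0 ≤ τ) (hr : 0 < r) (hlip : HessianLipschitzAt J wo τ r) (hu : ‖u‖ = 1)
    (hl : l ∈ Set.Icc ν δ) (heig : ∀ d, ⟪u, fderiv ℝ (gradient J) wo d⟫ = l * ⟪u, d⟫)
    (w : Vec M) :
    |⟪u, gradient J w⟫ - l * ⟪u, w - wo⟫| ≤ (τ + 2 * δ / r) * ‖w - wo‖ ^ 2 := by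
  have hδ := h.delta_pos
  rw [add_mul]
  by_cases hw : ‖w - wo‖ ≤ r
  · have hrem := norm_gradient_sub_fderiv_le h.twiceDiff.2 hmin hτ fun x hx => by
      rw [Metric.mem_closedBall, dist_eq_norm] at hx
      simpa [specNorm, toEuclideanCLM_hessian] using hlip (x - wo) (hx.trans hw)
    rw [← heig, ← inner_sub_right]
    calc |⟪u, gradient J w - fderiv ℝ (gradient J) wo (w - wo)⟫|
        ≤ τ * ‖w - wo‖ ^ 2 := by
          simpa [hu] using (abs_real_inner_le_norm u _).trans
            (mul_le_mul_of_nonneg_left hrem (norm_nonneg u))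
      _ ≤ τ * ‖w - wo‖ ^ 2 + 2 * δ / r * ‖w - wo‖ ^ 2 := le_add_of_nonneg_right (by positivity)
  · calc |⟪u, gradient J w⟫ - l * ⟪u, w - wo⟫| ≤ 2 * δ * ‖w - wo‖ :=
          h.abs_inner_gradient_sub_le hmin hu hl w
      _ ≤ 2 * δ / r * ‖w - wo‖ ^ 2 := by
          rw [div_mul_eq_mul_div, le_div_iff₀ hr, mul_assoc, pow_two]
          gcongr
          exact (not_le.1 hw).le
      _ ≤ τ * ‖w - wo‖ ^ 2 + 2 * δ / r * ‖w - wo‖ ^ 2 := le_add_of_nonneg_left (by positivity)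

end CostCond

/-- Convex twice differentiable costs with a common minimizer `wo` whose sum is strongly convex
with a bounded Hessian: the deterministic data of one instance of the algorithm. -/
structure CostSystem (J : Fin N → Vec M → ℝ) (wo : Vec M) (ν δ : ℝ) : Prop where
  diff : ∀ k, TwiceDifferentiable (J k)
  conv : ∀ k, ConvexOn ℝ Set.univ (J k)
  min : ∀ k, IsMinOn (J k) Set.univ wo
  cost : CostCond (aggregateCost J) ν δ

namespace CostSystem

variable {J : Fin N → Vec M → ℝ} {wo : Vec M} {ν δ : ℝ}

theorem isMinOn (h : CostSystem J wo ν δ) : IsMinOn (aggregateCost J) Set.univ wo :=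
  isMinOn_aggregateCost h.min

/-- The other costs lie above their tangents, so each single cost inherits the quadratic upper
bound of the aggregate. -/
theorem le_add_inner_gradient (h : CostSystem J wo ν δ) (k : Fin N) (w v : Vec M) :
    J k (w + v) ≤ J k w + ⟪gradient (J k) w, v⟫ + δ / 2 * ‖v‖ ^ 2 := by
  have hagg := le_add_inner_gradient_add_mul_norm_sq h.cost.twiceDiff.1 h.cost.twiceDiff.2
    h.cost.inner_hessian_le_mul_norm_sq w v
  have htangent : J k (w + v) - (J k w + ⟪gradient (J k) w, v⟫) ≤
      ∑ j, (J j (w + v) - (J j w + ⟪gradient (J j) w, v⟫)) :=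
    Finset.single_le_sum (f := fun j => J j (w + v) - (J j w + ⟪gradient (J j) w, v⟫))
      (fun j _ => sub_nonneg.2 (add_inner_gradient_le_of_convexOn (h.conv j) (h.diff j).1 w v))
      (Finset.mem_univ k)
  simp only [Finset.sum_sub_distrib, Finset.sum_add_distrib] at htangent
  rw [gradient_aggregateCost fun k => (h.diff k).1, sum_inner] at hagg
  simp only [aggregateCost] at hagg
  linarith

theorem sum_norm_sq_gradient_le (h : CostSystem J wo ν δ) (w : Vec M) :
    ∑ k, ‖gradient (J k) w‖ ^ 2 ≤ δ ^ 2 * ‖w - wo‖ ^ 2 := by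
  have hδ := h.cost.delta_pos
  calc ∑ k, ‖gradient (J k) w‖ ^ 2
      ≤ ∑ k, 2 * δ * (J k w - J k wo) := Finset.sum_le_sum fun k _ =>
        norm_sq_gradient_le_of_isMinOn hδ (h.min k) (h.le_add_inner_gradient k w)
    _ = 2 * δ * (aggregateCost J w - aggregateCost J wo) := by
        rw [← Finset.mul_sum, Finset.sum_sub_distrib, aggregateCost, aggregateCost]
    _ ≤ 2 * δ * (δ / 2 * ‖w - wo‖ ^ 2) := by
        gcongr
        exact h.cost.sub_le_mul_norm_sq h.isMinOn w
    _ = δ ^ 2 * ‖w - wo‖ ^ 2 := by ring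

theorem norm_gradient_le (h : CostSystem J wo ν δ) (k : Fin N) (w : Vec M) :
    ‖gradient (J k) w‖ ≤ δ * ‖w - wo‖ := by
  refine le_of_sq_le_sq ?_ (mul_nonneg h.cost.delta_pos.le (norm_nonneg _))
  rw [mul_pow]
  exact (Finset.single_le_sum (f := fun j => ‖gradient (J j) w‖ ^ 2) (fun j _ => by positivity)
    (Finset.mem_univ k)).trans (h.sum_norm_sq_gradient_le w)

end CostSystem

theorem trace_eq_sum_inner_toEuclideanCLM (A : Matrix (Fin M) (Fin M) ℝ)
    (b : OrthonormalBasis (Fin M) ℝ (Vec M)) :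
    A.trace = ∑ a, ⟪b a, Matrix.toEuclideanCLM (n := Fin M) (𝕜 := ℝ) A (b a)⟫ := by
  have htrace : A.trace = LinearMap.trace ℝ (Vec M) (Matrix.toEuclideanLin A) := by
    rw [LinearMap.trace_eq_matrix_trace ℝ (EuclideanSpace.basisFun (Fin M) ℝ).toBasis]
    congr 1
    ext i j
    simp only [LinearMap.toMatrix_apply, OrthonormalBasis.coe_toBasis,
      EuclideanSpace.basisFun_apply, Matrix.toLpLin_apply, PiLp.ofLp_single,
      Matrix.mulVec_single_one, OrthonormalBasis.coe_toBasis_repr_apply,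
      EuclideanSpace.basisFun_repr, Matrix.col_apply]
  rw [htrace, LinearMap.trace_eq_sum_inner _ b]
  rfl

theorem trace_inv_mul_eq_sum_eigenvalues {A : Matrix (Fin M) (Fin M) ℝ} (hA : A.IsHermitian)
    (hne : ∀ a, hA.eigenvalues a ≠ 0) (R : Matrix (Fin M) (Fin M) ℝ) :
    (A⁻¹ * R).trace = ∑ a, (hA.eigenvalues a)⁻¹ *
      ⟪hA.eigenvectorBasis a, Matrix.toEuclideanCLM (n := Fin M) (𝕜 := ℝ) R
        (hA.eigenvectorBasis a)⟫ := by
  have hdet : IsUnit A.det := by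
    rw [hA.det_eq_prod_eigenvalues]
    simpa [isUnit_iff_ne_zero, Finset.prod_ne_zero_iff] using hne
  rw [trace_eq_sum_inner_toEuclideanCLM _ hA.eigenvectorBasis]
  refine Finset.sum_congr rfl fun a _ => ?_
  have hinv : Matrix.mulVec A⁻¹ (hA.eigenvectorBasis a).ofLp =
      (hA.eigenvalues a)⁻¹ • (hA.eigenvectorBasis a).ofLp := by
    have heig := congrArg (Matrix.mulVec A⁻¹) (hA.mulVec_eigenvectorBasis a)
    simp only [Matrix.mulVec_mulVec, Matrix.nonsing_inv_mul A hdet, Matrix.one_mulVec,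
      Matrix.mulVec_smul] at heig
    rw [eq_inv_smul_iff₀ (hne a), ← heig]
  rw [Matrix.inner_toEuclideanCLM, Matrix.inner_toEuclideanCLM, ← Matrix.mulVec_mulVec,
    Matrix.dotProduct_mulVec, ← Matrix.mulVec_transpose,
    ← Matrix.conjTranspose_eq_transpose_of_trivial, hA.inv.eq, hinv, smul_dotProduct, smul_eq_mul]

end Costs

section Sequences

theorem eventually_le_of_contraction {u : ℕ → ℝ} {ρ b ε : ℝ} (hρ : 0 < ρ) (hρ1 : ρ ≤ 1)
    (hε : 0 < ε) (h : ∀ᶠ n in atTop, u (n + 1) ≤ (1 - ρ) * u n + ρ * b) :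
    ∀ᶠ n in atTop, u n ≤ b + ε := by
  obtain ⟨n₀, hn₀⟩ := eventually_atTop.1 h
  have hgeom : ∀ k, u (n₀ + k) - b ≤ (1 - ρ) ^ k * |u n₀ - b| := by
    intro k
    induction k with
    | zero => simpa using le_abs_self (u n₀ - b)
    | succ k ih =>
      have hstep := hn₀ (n₀ + k) (by omega)
      have hcontract := mul_le_mul_of_nonneg_left ih (sub_nonneg.2 hρ1)
      rw [← add_assoc, pow_succ]
      linarith
  have hlim : Tendsto (fun k => (1 - ρ) ^ k * |u n₀ - b|) atTop (𝓝 0) := by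
    simpa using (tendsto_pow_atTop_nhds_zero_of_lt_one (sub_nonneg.2 hρ1)
      (by linarith)).mul_const |u n₀ - b|
  obtain ⟨k₀, hk₀⟩ := eventually_atTop.1 (hlim.eventually (gt_mem_nhds hε))
  refine eventually_atTop.2 ⟨n₀ + k₀, fun n hn => ?_⟩
  have hn := hgeom (n - n₀)
  rw [Nat.add_sub_cancel' (by omega)] at hn
  linarith [hk₀ (n - n₀) (by omega)]

theorem abs_limsup_sub_le_of_eventually {u : ℕ → ℝ} {m e : ℝ}
    (h : ∀ᶠ n in atTop, |u n - m| ≤ e) : |limsup u atTop - m| ≤ e := by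
  have hupper : ∀ᶠ n in atTop, u n ≤ m + e := h.mono fun n hn => by linarith [(abs_le.1 hn).2]
  have hlower : ∀ᶠ n in atTop, m - e ≤ u n := h.mono fun n hn => by linarith [(abs_le.1 hn).1]
  have hle : limsup u atTop ≤ m + e :=
    limsup_le_of_le (IsBoundedUnder.isCoboundedUnder_le (isBoundedUnder_of_eventually_ge hlower))
      hupper
  have hge : m - e ≤ limsup u atTop :=
    le_limsup_of_frequently_le hlower.frequently (isBoundedUnder_of_eventually_le hupper)
  exact abs_le.2 ⟨by linarith, by linarith⟩

end Sequences

section SecondMoments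

variable {Ω : Type*} {mΩ : MeasurableSpace Ω} {P : Measure Ω} {ι : Type*} [Fintype ι]
  {E : Type*} [NormedAddCommGroup E] [InnerProductSpace ℝ E]

theorem integrable_real_inner_of_memLp {Y Z : Ω → E} (hY : MemLp Y 2 P) (hZ : MemLp Z 2 P) :
    Integrable (fun ω => ⟪Y ω, Z ω⟫) P :=
  (hY.norm.integrable_mul hZ.norm).mono' (hY.1.inner hZ.1)
    (ae_of_all _ fun _ => abs_real_inner_le_norm _ _)

theorem norm_sq_sum_smul_le (a : ι → ℝ) (g : ι → E) :
    ‖∑ k, a k • g k‖ ^ 2 ≤ (∑ k, a k ^ 2) * ∑ k, ‖g k‖ ^ 2 := by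
  have htriangle : ‖∑ k, a k • g k‖ ≤ ∑ k, |a k| * ‖g k‖ :=
    (norm_sum_le _ _).trans_eq (Finset.sum_congr rfl fun k _ => norm_smul _ _)
  calc ‖∑ k, a k • g k‖ ^ 2 ≤ (∑ k, |a k| * ‖g k‖) ^ 2 := by gcongr
    _ ≤ (∑ k, |a k| ^ 2) * ∑ k, ‖g k‖ ^ 2 := Finset.sum_mul_sq_le_sq_mul_sq _ _ _
    _ = (∑ k, a k ^ 2) * ∑ k, ‖g k‖ ^ 2 := by simp only [sq_abs]

theorem norm_sq_sum_smul_eq (a : ι → ℝ) (g : ι → E) :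
    ‖∑ k, a k • g k‖ ^ 2 = ∑ k, ∑ l, a k * a l * ⟪g k, g l⟫ := by
  rw [← real_inner_self_eq_norm_sq, sum_inner]
  refine Finset.sum_congr rfl fun k _ => ?_
  rw [inner_sum]
  refine Finset.sum_congr rfl fun l _ => ?_
  rw [real_inner_smul_left, real_inner_smul_right]
  ring

theorem integrable_norm_sq_sum_smul {a : ι → Ω → ℝ}
    (ha : ∀ k l, Integrable (fun ω => a k ω * a l ω) P) (g : ι → E) :
    Integrable (fun ω => ‖∑ k, a k ω • g k‖ ^ 2) P := by
  simp only [norm_sq_sum_smul_eq]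
  exact integrable_finsetSum _ fun k _ => integrable_finsetSum _ fun l _ => (ha k l).mul_const _

theorem sum_integral_mul_inner {a : ι → Ω → ℝ}
    (ha : ∀ k l, Integrable (fun ω => a k ω * a l ω) P) (g : ι → E) :
    ∑ k, ∑ l, (∫ ω, a k ω * a l ω ∂P) * ⟪g k, g l⟫ = ∫ ω, ‖∑ k, a k ω • g k‖ ^ 2 ∂P := by
  simp only [norm_sq_sum_smul_eq]
  rw [integral_finsetSum _ fun k _ => integrable_finsetSum _ fun l _ => (ha k l).mul_const _]
  refine Finset.sum_congr rfl fun k _ => ?_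
  rw [integral_finsetSum _ fun l _ => (ha k l).mul_const _]
  exact Finset.sum_congr rfl fun l _ => (integral_mul_const _ _).symm

theorem sum_mul_integral_inner_add {G S : ι → Ω → E} (c : ι → ι → ℝ)
    (hG : ∀ k, MemLp (G k) 2 P) (hS : ∀ k, MemLp (S k) 2 P)
    (hGS : ∀ k l, ∫ ω, ⟪G k ω, S l ω⟫ ∂P = 0)
    (hSS : ∀ k l, k ≠ l → ∫ ω, ⟪S k ω, S l ω⟫ ∂P = 0) :
    ∑ k, ∑ l, c k l * ∫ ω, ⟪G k ω + S k ω, G l ω + S l ω⟫ ∂P =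
      ∑ k, ∑ l, c k l * ∫ ω, ⟪G k ω, G l ω⟫ ∂P + ∑ k, c k k * ∫ ω, ‖S k ω‖ ^ 2 ∂P := by
  have hsplit : ∀ k l, ∫ ω, ⟪G k ω + S k ω, G l ω + S l ω⟫ ∂P =
      ∫ ω, ⟪G k ω, G l ω⟫ ∂P + ∫ ω, ⟪S k ω, S l ω⟫ ∂P := fun k l => by
    have hSG : ∫ ω, ⟪S k ω, G l ω⟫ ∂P = 0 := by
      simpa only [real_inner_comm] using hGS l k
    have hleft : ∀ F : Ω → E, MemLp F 2 P →
        ∫ ω, ⟪G k ω + S k ω, F ω⟫ ∂P = ∫ ω, ⟪G k ω, F ω⟫ ∂P + ∫ ω, ⟪S k ω, F ω⟫ ∂P := by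
      intro F hF
      simp only [inner_add_left]
      exact integral_add (integrable_real_inner_of_memLp (hG k) hF)
        (integrable_real_inner_of_memLp (hS k) hF)
    have hGkSk := (hG k).add (hS k)
    calc ∫ ω, ⟪G k ω + S k ω, G l ω + S l ω⟫ ∂P
        = ∫ ω, ⟪G k ω + S k ω, G l ω⟫ ∂P + ∫ ω, ⟪G k ω + S k ω, S l ω⟫ ∂P := by
          simp only [inner_add_right]
          exact integral_add (integrable_real_inner_of_memLp hGkSk (hG l))
            (integrable_real_inner_of_memLp hGkSk (hS l))
      _ = ∫ ω, ⟪G k ω, G l ω⟫ ∂P + ∫ ω, ⟪S k ω, S l ω⟫ ∂P := by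
          rw [hleft _ (hG l), hleft _ (hS l), hSG, hGS, add_zero, zero_add]
  simp only [hsplit, mul_add, Finset.sum_add_distrib]
  congr 1
  refine Finset.sum_congr rfl fun k _ => ?_
  rw [Finset.sum_eq_single k (fun l _ hl => by rw [hSS k l hl.symm, mul_zero]) (by simp)]
  simp only [real_inner_self_eq_norm_sq]

end SecondMoments

section Mixing

variable {Ω : Type*} {mG : MeasurableSpace Ω} {mΩ : MeasurableSpace Ω} {P : Measure Ω} {N : ℕ}
  {E : Type*} [NormedAddCommGroup E] [InnerProductSpace ℝ E]

/-- One random combination step: a step-size `μ` and fusion weights `π`, independent of each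
other and of a σ-algebra `mG` which carries everything else that enters the step. -/
structure MixingStep {Ω : Type*} (mG : MeasurableSpace Ω) {mΩ : MeasurableSpace Ω} (P : Measure Ω)
    {N : ℕ} (μ : Ω → ℝ) (π : Fin N → Ω → ℝ) (μbar σμ2 μub : ℝ) (σπ2 : Fin N → ℝ) : Prop where
  le : mG ≤ mΩ
  measurable_step : Measurable μ
  measurable_weight : ∀ k, Measurable (π k)
  indep_step_weight : Indep (MeasurableSpace.comap μ inferInstance)
    (MeasurableSpace.comap (fun ω k => π k ω) inferInstance) P
  indep : Indep (MeasurableSpace.comap μ inferInstance ⊔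
    MeasurableSpace.comap (fun ω k => π k ω) inferInstance) mG P
  bounded : ∀ᵐ ω ∂P, μ ω ∈ Set.Icc 0 μub
  mean : ∫ ω, μ ω ∂P = μbar
  variance : ∫ ω, (μ ω - μbar) ^ 2 ∂P = σμ2
  weight_nonneg : ∀ k, ∀ᵐ ω ∂P, 0 ≤ π k ω
  weight_sum : ∀ᵐ ω ∂P, ∑ k, π k ω = 1
  weight_mean : ∀ k, ∫ ω, π k ω ∂P = 1 / N
  weight_variance : ∀ k, ∫ ω, (π k ω - 1 / N) ^ 2 ∂P = σπ2 k

namespace MixingStep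

variable {μ : Ω → ℝ} {π : Fin N → Ω → ℝ} {μbar σμ2 μub : ℝ} {σπ2 : Fin N → ℝ}

theorem weight_mem_Icc (h : MixingStep mG P μ π μbar σμ2 μub σπ2) :
    ∀ᵐ ω ∂P, ∀ k, π k ω ∈ Set.Icc 0 1 := by
  filter_upwards [ae_all_iff.2 h.weight_nonneg, h.weight_sum] with ω hnonneg hsum k
  exact ⟨hnonneg k, (Finset.single_le_sum (f := fun j => π j ω) (fun j _ => hnonneg j)
    (Finset.mem_univ k)).trans_eq hsum⟩

theorem setIntegral_mul_mul (h : MixingStep mG P μ π μbar σμ2 μub σπ2) {f : ℝ → ℝ}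
    {g : (Fin N → ℝ) → ℝ} (hf : Measurable f) (hg : Measurable g) {φ : Ω → ℝ}
    (hφ : Measurable[mG] φ) {B : Set Ω} (hB : MeasurableSet[mG] B) :
    ∫ ω in B, f (μ ω) * g (fun k => π k ω) * φ ω ∂P =
      (∫ ω, f (μ ω) ∂P) * (∫ ω, g (fun k => π k ω) ∂P) * ∫ ω in B, φ ω ∂P := by
  have hφB : Measurable[mG] (B.indicator φ) := hφ.indicator hB
  have hindep : IndepFun (fun ω => f (μ ω) * g (fun k => π k ω)) (B.indicator φ) P := by
    rw [IndepFun_iff_Indep]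
    refine indep_of_indep_of_le_left (indep_of_indep_of_le_right h.indep hφB.comap_le) ?_
    refine Measurable.comap_le (Measurable.mul ?_ ?_)
    · exact hf.comp ((comap_measurable μ).mono le_sup_left le_rfl)
    · exact hg.comp ((comap_measurable (fun ω k => π k ω)).mono le_sup_right le_rfl)
  have hindep' : IndepFun (fun ω => f (μ ω)) (fun ω => g (fun k => π k ω)) P := by
    rw [IndepFun_iff_Indep]
    refine indep_of_indep_of_le_left (indep_of_indep_of_le_right h.indep_step_weight ?_) ?_
    · exact Measurable.comap_le (hg.comp (comap_measurable (fun ω k => π k ω)))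
    · exact Measurable.comap_le (hf.comp (comap_measurable μ))
  have hfμ : Measurable fun ω => f (μ ω) := hf.comp h.measurable_step
  have hgπ : Measurable fun ω => g fun k => π k ω :=
    hg.comp (measurable_pi_lambda _ h.measurable_weight)
  rw [← integral_indicator (h.le _ hB), ← integral_indicator (h.le _ hB),
    ← hindep'.integral_fun_mul_eq_mul_integral hfμ.aestronglyMeasurable hgπ.aestronglyMeasurable,
    ← hindep.integral_fun_mul_eq_mul_integral (hfμ.mul hgπ).aestronglyMeasurable
      (hφB.mono h.le le_rfl).aestronglyMeasurable]
  exact integral_congr_ae (ae_of_all _ fun ω => Set.indicator_mul_right B _ φ)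

theorem integrableOn_pow_mul (h : MixingStep mG P μ π μbar σμ2 μub σπ2) (p : ℕ) {φ : Ω → ℝ}
    {B : Set Ω} (hφ : IntegrableOn φ B P) : IntegrableOn (fun ω => μ ω ^ p * φ ω) B P := by
  refine hφ.bdd_mul (c := μub ^ p) (h.measurable_step.pow_const p).aestronglyMeasurable ?_
  filter_upwards [ae_restrict_of_ae h.bounded] with ω hω
  rw [norm_pow, Real.norm_eq_abs, abs_of_nonneg hω.1]
  exact pow_le_pow_left₀ hω.1 hω.2 p

theorem integrableOn_weight_mul (h : MixingStep mG P μ π μbar σμ2 μub σπ2) (k : Fin N)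
    {φ : Ω → ℝ} {B : Set Ω} (hφ : IntegrableOn φ B P) :
    IntegrableOn (fun ω => π k ω * φ ω) B P := by
  refine hφ.bdd_mul (c := 1) (h.measurable_weight k).aestronglyMeasurable ?_
  filter_upwards [ae_restrict_of_ae h.weight_mem_Icc] with ω hω
  rw [Real.norm_eq_abs, abs_of_nonneg (hω k).1]
  exact (hω k).2

theorem setIntegral_step_mul_weight_mul (h : MixingStep mG P μ π μbar σμ2 μub σπ2) {φ : Ω → ℝ}
    {B : Set Ω} (hB : MeasurableSet[mG] B) (hφ : Measurable[mG] φ) (k : Fin N) :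
    ∫ ω in B, μ ω ^ 1 * (π k ω * φ ω) ∂P = μbar / N * ∫ ω in B, φ ω ∂P := by
  have hfactor := h.setIntegral_mul_mul (f := fun x => x) (g := fun p => p k) measurable_id
    (measurable_pi_apply k) hφ hB
  rw [h.mean, h.weight_mean, mul_one_div] at hfactor
  rw [← hfactor]
  simp only [pow_one, mul_assoc]

variable [IsProbabilityMeasure P]

theorem memLp_step (h : MixingStep mG P μ π μbar σμ2 μub σπ2) {p : ENNReal} : MemLp μ p P :=
  MemLp.of_bound h.measurable_step.aestronglyMeasurable μub <| h.bounded.mono fun ω hω => by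
    rw [Real.norm_eq_abs, abs_of_nonneg hω.1]
    exact hω.2

theorem memLp_weight (h : MixingStep mG P μ π μbar σμ2 μub σπ2) (k : Fin N) {p : ENNReal} :
    MemLp (π k) p P :=
  MemLp.of_bound (h.measurable_weight k).aestronglyMeasurable 1 <|
    h.weight_mem_Icc.mono fun ω hω => by
      rw [Real.norm_eq_abs, abs_of_nonneg (hω k).1]
      exact (hω k).2

theorem integrable_weight_mul_weight (h : MixingStep mG P μ π μbar σμ2 μub σπ2) (k l : Fin N) :
    Integrable (fun ω => π k ω * π l ω) P :=
  (h.memLp_weight k (p := 2)).integrable_mul (h.memLp_weight l (p := 2))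

theorem setIntegral_step_mul (h : MixingStep mG P μ π μbar σμ2 μub σπ2) {f : ℝ → ℝ}
    (hf : Measurable f) {φ : Ω → ℝ} (hφ : Measurable[mG] φ) {B : Set Ω}
    (hB : MeasurableSet[mG] B) :
    ∫ ω in B, f (μ ω) * φ ω ∂P = (∫ ω, f (μ ω) ∂P) * ∫ ω in B, φ ω ∂P := by
  simpa using h.setIntegral_mul_mul hf (measurable_const (a := (1 : ℝ))) hφ hB

theorem integral_sq (h : MixingStep mG P μ π μbar σμ2 μub σπ2) :
    ∫ ω, μ ω ^ 2 ∂P = μbar ^ 2 + σμ2 := by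
  have hvar : Var[μ; P] = ∫ ω, μ ω ^ 2 ∂P - (∫ ω, μ ω ∂P) ^ 2 := variance_eq_sub h.memLp_step
  rw [variance_eq_integral h.measurable_step.aemeasurable, h.mean, h.variance] at hvar
  linarith

theorem integral_pow_four_le (h : MixingStep mG P μ π μbar σμ2 μub σπ2) :
    ∫ ω, μ ω ^ 4 ∂P ≤ μub ^ 2 * (μbar ^ 2 + σμ2) := by
  have hint : ∀ p, Integrable (fun ω => μ ω ^ p) P := fun p => by
    simpa using h.integrableOn_pow_mul p (integrableOn_univ.2 (integrable_const (1 : ℝ)))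
  rw [← h.integral_sq, ← integral_const_mul]
  refine integral_mono_ae (hint 4) ((hint 2).const_mul _) ?_
  filter_upwards [h.bounded] with ω hω
  calc μ ω ^ 4 = μ ω ^ 2 * μ ω ^ 2 := by ring
    _ ≤ μub ^ 2 * μ ω ^ 2 := by
        gcongr
        exacts [hω.1, hω.2]

theorem integral_weight_mul_weight (h : MixingStep mG P μ π μbar σμ2 μub σπ2) (k l : Fin N) :
    ∫ ω, π k ω * π l ω ∂P =
      1 / (N : ℝ) ^ 2 + ∫ ω, (π k ω - 1 / N) * (π l ω - 1 / N) ∂P := by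
  have hcov : cov[π k, π l; P] = ∫ ω, π k ω * π l ω ∂P - (∫ ω, π k ω ∂P) * ∫ ω, π l ω ∂P :=
    covariance_eq_sub (h.memLp_weight k) (h.memLp_weight l)
  rw [covariance, h.weight_mean, h.weight_mean] at hcov
  rw [hcov]
  ring

theorem integral_weight_mul_self (h : MixingStep mG P μ π μbar σμ2 μub σπ2) (k : Fin N) :
    ∫ ω, π k ω * π k ω ∂P = 1 / (N : ℝ) ^ 2 + σπ2 k := by
  simp only [h.integral_weight_mul_weight, ← h.weight_variance k, pow_two]

theorem sum_weight_moment_mul_inner_nonneg (h : MixingStep mG P μ π μbar σμ2 μub σπ2)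
    (g : Fin N → E) : 0 ≤ ∑ k, ∑ l, (∫ ω, π k ω * π l ω ∂P) * ⟪g k, g l⟫ := by
  rw [sum_integral_mul_inner h.integrable_weight_mul_weight]
  positivity

theorem sum_weight_moment_mul_inner_le_sum (h : MixingStep mG P μ π μbar σμ2 μub σπ2)
    (g : Fin N → E) :
    ∑ k, ∑ l, (∫ ω, π k ω * π l ω ∂P) * ⟪g k, g l⟫ ≤ ∑ k, ‖g k‖ ^ 2 := by
  rw [sum_integral_mul_inner h.integrable_weight_mul_weight]
  calc ∫ ω, ‖∑ k, π k ω • g k‖ ^ 2 ∂P ≤ ∫ _, ∑ k, ‖g k‖ ^ 2 ∂P := by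
        refine integral_mono_ae (integrable_norm_sq_sum_smul h.integrable_weight_mul_weight g)
          (integrable_const _) ?_
        filter_upwards [h.weight_mem_Icc, h.weight_sum] with ω hmem hsum
        refine (norm_sq_sum_smul_le _ _).trans (mul_le_of_le_one_left (by positivity) ?_)
        exact (Finset.sum_le_sum fun k _ => pow_le_of_le_one (hmem k).1 (hmem k).2 two_ne_zero)
          |>.trans_eq hsum
    _ = ∑ k, ‖g k‖ ^ 2 := by simp

theorem sum_weight_moment_mul_inner_le (h : MixingStep mG P μ π μbar σμ2 μub σπ2)
    (g : Fin N → E) :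
    ∑ k, ∑ l, (∫ ω, π k ω * π l ω ∂P) * ⟪g k, g l⟫ ≤
      1 / (N : ℝ) ^ 2 * ‖∑ k, g k‖ ^ 2 + (∑ k, σπ2 k) * ∑ k, ‖g k‖ ^ 2 := by
  have hcentered : ∀ k, MemLp (fun ω => π k ω - 1 / N) 2 P :=
    fun k => (h.memLp_weight k).sub (memLp_const _)
  have hint : ∀ k l, Integrable (fun ω => (π k ω - 1 / N) * (π l ω - 1 / N)) P :=
    fun k l => (hcentered k).integrable_mul (hcentered l)
  have hmean : ∑ k, ∑ l, 1 / (N : ℝ) ^ 2 * ⟪g k, g l⟫ = 1 / (N : ℝ) ^ 2 * ‖∑ k, g k‖ ^ 2 := by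
    rw [← real_inner_self_eq_norm_sq, sum_inner]
    simp only [inner_sum, Finset.mul_sum]
  simp only [h.integral_weight_mul_weight, add_mul, Finset.sum_add_distrib]
  rw [hmean, sum_integral_mul_inner hint g]
  gcongr
  calc ∫ ω, ‖∑ k, (π k ω - 1 / N) • g k‖ ^ 2 ∂P
      ≤ ∫ ω, (∑ k, (π k ω - 1 / N) ^ 2) * ∑ k, ‖g k‖ ^ 2 ∂P :=
        integral_mono (integrable_norm_sq_sum_smul hint g)
          ((integrable_finsetSum _ fun k _ => (hcentered k).integrable_sq).mul_const _)
          fun ω => norm_sq_sum_smul_le _ _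
    _ = (∑ k, σπ2 k) * ∑ k, ‖g k‖ ^ 2 := by
        rw [integral_mul_const, integral_finsetSum _ fun k _ => (hcentered k).integrable_sq]
        simp only [h.weight_variance]

variable [MeasurableSpace E] [BorelSpace E] [SecondCountableTopology E]

theorem setIntegral_step_sq_mul_weight_mul_weight_mul_inner
    (h : MixingStep mG P μ π μbar σμ2 μub σπ2) {X Y : Ω → E} {B : Set Ω}
    (hB : MeasurableSet[mG] B) (hX : Measurable[mG] X) (hY : Measurable[mG] Y) (k l : Fin N) :
    ∫ ω in B, μ ω ^ 2 * (π k ω * (π l ω * ⟪X ω, Y ω⟫)) ∂P =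
      (μbar ^ 2 + σμ2) * ((∫ ω, π k ω * π l ω ∂P) * ∫ ω in B, ⟪X ω, Y ω⟫ ∂P) := by
  have hfactor := h.setIntegral_mul_mul (f := fun x => x ^ 2) (g := fun p => p k * p l)
    (measurable_id.pow_const 2) ((measurable_pi_apply k).mul (measurable_pi_apply l))
    (hX.inner hY) hB
  rw [h.integral_sq] at hfactor
  rw [← mul_assoc, ← hfactor]
  simp only [mul_assoc]

theorem setIntegral_norm_sq_sub_smul_sum (h : MixingStep mG P μ π μbar σμ2 μub σπ2) {X : Ω → E}
    {F : Fin N → Ω → E} {B : Set Ω} (hB : MeasurableSet[mG] B) (hX : Measurable[mG] X)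
    (hF : ∀ k, Measurable[mG] (F k)) (hX2 : MemLp X 2 (P.restrict B))
    (hF2 : ∀ k, MemLp (F k) 2 (P.restrict B)) :
    ∫ ω in B, ‖X ω - μ ω • ∑ k, π k ω • F k ω‖ ^ 2 ∂P =
      ∫ ω in B, ‖X ω‖ ^ 2 ∂P - 2 * (μbar / N) * ∑ k, ∫ ω in B, ⟪X ω, F k ω⟫ ∂P +
        (μbar ^ 2 + σμ2) *
          ∑ k, ∑ l, (∫ ω, π k ω * π l ω ∂P) * ∫ ω in B, ⟪F k ω, F l ω⟫ ∂P := by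
  have hlin : ∀ k, IntegrableOn (fun ω => μ ω ^ 1 * (π k ω * ⟪X ω, F k ω⟫)) B P := fun k =>
    h.integrableOn_pow_mul 1 (h.integrableOn_weight_mul k
      (integrable_real_inner_of_memLp hX2 (hF2 k)))
  have hlin_integral : ∀ k, ∫ ω in B, μ ω ^ 1 * (π k ω * ⟪X ω, F k ω⟫) ∂P =
      μbar / N * ∫ ω in B, ⟪X ω, F k ω⟫ ∂P := fun k =>
    h.setIntegral_step_mul_weight_mul hB (hX.inner (hF k)) k
  have hquad : ∀ k l,
      IntegrableOn (fun ω => μ ω ^ 2 * (π k ω * (π l ω * ⟪F k ω, F l ω⟫))) B P := fun k l =>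
    h.integrableOn_pow_mul 2 (h.integrableOn_weight_mul k (h.integrableOn_weight_mul l
      (integrable_real_inner_of_memLp (hF2 k) (hF2 l))))
  have hquad_integral :
      ∫ ω in B, ∑ k, ∑ l, μ ω ^ 2 * (π k ω * (π l ω * ⟪F k ω, F l ω⟫)) ∂P =
        (μbar ^ 2 + σμ2) *
          ∑ k, ∑ l, (∫ ω, π k ω * π l ω ∂P) * ∫ ω in B, ⟪F k ω, F l ω⟫ ∂P := by
    rw [integral_finsetSum _ fun k _ => integrable_finsetSum _ fun l _ => hquad k l]
    simp_rw [Finset.mul_sum]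
    refine Finset.sum_congr rfl fun k _ => ?_
    rw [integral_finsetSum _ fun l _ => hquad k l]
    exact Finset.sum_congr rfl fun l _ =>
      h.setIntegral_step_sq_mul_weight_mul_weight_mul_inner hB (hF k) (hF l) k l
  have hexpand : ∀ ω, ‖X ω - μ ω • ∑ k, π k ω • F k ω‖ ^ 2 =
      ‖X ω‖ ^ 2 - 2 * (∑ k, μ ω ^ 1 * (π k ω * ⟪X ω, F k ω⟫)) +
        ∑ k, ∑ l, μ ω ^ 2 * (π k ω * (π l ω * ⟪F k ω, F l ω⟫)) := fun ω => by
    rw [norm_sub_sq_real, norm_smul, mul_pow, norm_sq_sum_smul_eq, real_inner_smul_right,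
      inner_sum, Real.norm_eq_abs, sq_abs]
    simp only [Finset.mul_sum, real_inner_smul_right, pow_one, mul_assoc]
  have hX2' : IntegrableOn (fun ω => ‖X ω‖ ^ 2) B P := hX2.norm.integrable_sq
  have hlin' : IntegrableOn (fun ω => 2 * ∑ k, μ ω ^ 1 * (π k ω * ⟪X ω, F k ω⟫)) B P :=
    (integrable_finsetSum _ fun k _ => hlin k).const_mul 2
  have hdiff : IntegrableOn
      (fun ω => ‖X ω‖ ^ 2 - 2 * ∑ k, μ ω ^ 1 * (π k ω * ⟪X ω, F k ω⟫)) B P := hX2'.sub hlin'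
  simp only [hexpand]
  rw [integral_add hdiff (integrable_finsetSum _ fun k _ =>
      integrable_finsetSum _ fun l _ => hquad k l), integral_sub hX2' hlin', integral_const_mul,
    integral_finsetSum _ fun k _ => hlin k, hquad_integral]
  simp only [hlin_integral, ← Finset.mul_sum]
  ring

theorem setIntegral_norm_sq_sub_smul_sum_add (h : MixingStep mG P μ π μbar σμ2 μub σπ2)
    {X : Ω → E} {G S : Fin N → Ω → E} {B : Set Ω} (hB : MeasurableSet[mG] B)
    (hX : Measurable[mG] X) (hG : ∀ k, Measurable[mG] (G k)) (hS : ∀ k, Measurable[mG] (S k))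
    (hX2 : MemLp X 2 (P.restrict B)) (hG2 : ∀ k, MemLp (G k) 2 (P.restrict B))
    (hS2 : ∀ k, MemLp (S k) 2 (P.restrict B))
    (hXS : ∀ k, ∫ ω in B, ⟪X ω, S k ω⟫ ∂P = 0) (hGS : ∀ k l, ∫ ω in B, ⟪G k ω, S l ω⟫ ∂P = 0)
    (hSS : ∀ k l, k ≠ l → ∫ ω in B, ⟪S k ω, S l ω⟫ ∂P = 0) :
    ∫ ω in B, ‖X ω - μ ω • ∑ k, π k ω • (G k ω + S k ω)‖ ^ 2 ∂P =
      ∫ ω in B, ‖X ω‖ ^ 2 ∂P - 2 * (μbar / N) * ∑ k, ∫ ω in B, ⟪X ω, G k ω⟫ ∂P +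
        (μbar ^ 2 + σμ2) * (∑ k, ∑ l, (∫ ω, π k ω * π l ω ∂P) * ∫ ω in B, ⟪G k ω, G l ω⟫ ∂P +
          ∑ k, (1 / (N : ℝ) ^ 2 + σπ2 k) * ∫ ω in B, ‖S k ω‖ ^ 2 ∂P) := by
  have hlin : ∀ k, ∫ ω in B, ⟪X ω, G k ω + S k ω⟫ ∂P = ∫ ω in B, ⟪X ω, G k ω⟫ ∂P := fun k => by
    simp only [inner_add_right]
    rw [integral_add (integrable_real_inner_of_memLp hX2 (hG2 k))
      (integrable_real_inner_of_memLp hX2 (hS2 k)), hXS, add_zero]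
  rw [h.setIntegral_norm_sq_sub_smul_sum (F := fun k ω => G k ω + S k ω) hB hX
    (fun k => (hG k).add (hS k)) hX2 fun k => (hG2 k).add (hS2 k),
    sum_mul_integral_inner_add _ hG2 hS2 hGS hSS]
  simp only [hlin, h.integral_weight_mul_self]

end MixingStep

end Mixing

section CondExp

variable {Ω : Type*} {m : MeasurableSpace Ω} {mΩ : MeasurableSpace Ω} {P : Measure Ω}
  [IsFiniteMeasure P] {B : Set Ω}

theorem setIntegral_inner_eq_zero_of_condExp {F : Type*} [NormedAddCommGroup F]
    [InnerProductSpace ℝ F] [CompleteSpace F] (hm : m ≤ mΩ) {y s : Ω → F}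
    (hB : MeasurableSet[m] B) (hy : StronglyMeasurable[m] y)
    (hys : IntegrableOn (fun ω => ⟪y ω, s ω⟫) B P) (hs : Integrable s P)
    (h0 : P[s | m] =ᵐ[P] 0) : ∫ ω in B, ⟪y ω, s ω⟫ ∂P = 0 := by
  have hind : (B.indicator fun ω => ⟪y ω, s ω⟫) = fun ω => ⟪B.indicator y ω, s ω⟫ := by
    ext ω
    by_cases hω : ω ∈ B <;> simp [hω]
  have hint := hys.integrable_indicator (hm _ hB)
  rw [hind] at hint
  rw [← integral_indicator (hm _ hB), hind, ← integral_condExp hm]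
  refine integral_eq_zero_of_ae ?_
  filter_upwards [condExp_bilin_of_stronglyMeasurable_left (B := innerSL ℝ) (hy.indicator hB)
    hint hs, h0] with ω hpull hzero
  exact hpull.trans (by simp [hzero])

theorem setIntegral_mul_le_of_condExp_le (hm : m ≤ mΩ) {f g h : Ω → ℝ}
    (hB : MeasurableSet[m] B) (hf : StronglyMeasurable[m] f) (hf0 : ∀ ω, 0 ≤ f ω)
    (hfg : IntegrableOn (fun ω => f ω * g ω) B P) (hg : Integrable g P)
    (hfh : IntegrableOn (fun ω => f ω * h ω) B P) (hle : P[g | m] ≤ᵐ[P] h) :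
    ∫ ω in B, f ω * g ω ∂P ≤ ∫ ω in B, f ω * h ω ∂P := by
  have hind : ∀ g : Ω → ℝ, (B.indicator fun ω => f ω * g ω) = fun ω => B.indicator f ω * g ω :=
    fun g => funext fun ω => Set.indicator_mul_left B f g
  have hfg' := hfg.integrable_indicator (hm _ hB)
  have hfh' := hfh.integrable_indicator (hm _ hB)
  rw [hind] at hfg' hfh'
  rw [← integral_indicator (hm _ hB), ← integral_indicator (hm _ hB), hind, hind,
    ← integral_condExp hm]
  refine integral_mono_ae integrable_condExp hfh' ?_
  filter_upwards [condExp_mul_of_stronglyMeasurable_left (μ := P) (hf.indicator hB) hfg' hg, hle]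
    with ω hpull hle
  exact hpull.trans_le
    (mul_le_mul_of_nonneg_left hle (Set.indicator_nonneg (fun ω _ => hf0 ω) ω))

end CondExp

namespace CentralizedAlgorithm

variable {M N : ℕ} {Ω : Type*}

/-- The indices of the data and of the step-sizes and fusion vectors used before time `i`. -/
def sourcesBefore (i : ℕ) : Set (Option (ℕ ⊕ ℕ)) :=
  {s | ∀ t, s = some t → Sum.elim id id t < i}

/-- The information available at time `i` before the step-size and the fusion vector are drawn.
It contains the whole data σ-algebra `D`, hence also the gradient noise of time `i`. -/
@[reducible] def info (A : CentralizedAlgorithm M N Ω) (D : MeasurableSpace Ω) (i : ℕ) :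
    MeasurableSpace Ω :=
  ⨆ s ∈ sourcesBefore i, A.source D s

variable {A : CentralizedAlgorithm M N Ω} {D : MeasurableSpace Ω}

theorem source_le_info {i : ℕ} {s : Option (ℕ ⊕ ℕ)} (hs : s ∈ sourcesBefore i) :
    A.source D s ≤ A.info D i :=
  le_iSup₂_of_le (f := fun s (_ : s ∈ sourcesBefore i) => A.source D s) s hs le_rfl

theorem data_le_info (i : ℕ) : D ≤ A.info D i :=
  source_le_info (s := none) (by simp [sourcesBefore])

theorem info_mono {i j : ℕ} (hij : i ≤ j) : A.info D i ≤ A.info D j :=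
  biSup_mono fun _ hs t ht => (hs t ht).trans_le hij

theorem measurable_step_info (i : ℕ) : Measurable[A.info D (i + 1)] (A.step i) :=
  measurable_iff_comap_le.2 (source_le_info (s := some (Sum.inl i)) (by simp [sourcesBefore]))

theorem measurable_fusion_info (i : ℕ) (k : Fin N) :
    Measurable[A.info D (i + 1)] (A.fusion i k) := by
  have hvec : Measurable[A.info D (i + 1)] (fun ω k => A.fusion i k ω) :=
    measurable_iff_comap_le.2 (source_le_info (s := some (Sum.inr i)) (by simp [sourcesBefore]))
  exact (measurable_pi_apply k).comp hvec

theorem measurable_approxGrad_info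
    (hg : ∀ i k, Measurable[(inferInstance : MeasurableSpace (Vec M)).prod D]
      (fun p : Vec M × Ω => A.approxGrad i k p.1 p.2)) {i : ℕ} (k : Fin N) {v : Ω → Vec M}
    (hv : Measurable[A.info D i] v) :
    Measurable[A.info D i] (fun ω => A.approxGrad i k (v ω) ω) := by
  have hpair : @Measurable _ _ (A.info D i) ((inferInstance : MeasurableSpace (Vec M)).prod D)
      (fun ω => (v ω, ω)) :=
    Measurable.prodMk hv (measurable_id'' (data_le_info i))
  exact (hg i k).comp hpair

theorem measurable_iter_info (hinit : Measurable[D] A.init)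
    (hg : ∀ i k, Measurable[(inferInstance : MeasurableSpace (Vec M)).prod D]
      (fun p : Vec M × Ω => A.approxGrad i k p.1 p.2)) (i : ℕ) :
    Measurable[A.info D i] (A.iter i) := by
  induction i with
  | zero => exact hinit.mono (data_le_info 0) le_rfl
  | succ i ih =>
    have hle : A.info D i ≤ A.info D (i + 1) := info_mono (Nat.le_succ i)
    refine (ih.mono hle le_rfl).sub ((measurable_step_info i).smul ?_)
    refine Finset.measurable_fun_sum _ fun k _ => (measurable_fusion_info i k).smul ?_
    exact (measurable_approxGrad_info hg k ih).mono hle le_rfl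

theorem past_le_info (hinit : Measurable[D] A.init)
    (hg : ∀ i k, Measurable[(inferInstance : MeasurableSpace (Vec M)).prod D]
      (fun p : Vec M × Ω => A.approxGrad i k p.1 p.2)) (i : ℕ) : A.past i ≤ A.info D i :=
  iSup₂_le fun j hj => ((measurable_iter_info hinit hg j).mono (info_mono hj) le_rfl).comap_le

theorem measurable_iter_past (i : ℕ) : Measurable[A.past i] (A.iter i) :=
  measurable_iff_comap_le.2 (le_iSup₂_of_le (f := fun j (_ : j ∈ Set.Iic i) =>
    MeasurableSpace.comap (A.iter j) inferInstance) i Set.self_mem_Iic le_rfl)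

theorem past_mono {i j : ℕ} (hij : i ≤ j) : A.past i ≤ A.past j :=
  biSup_mono fun _ hk => le_trans hk hij

theorem source_le {mΩ : MeasurableSpace Ω} (hD : D ≤ mΩ) (hs : ∀ i, Measurable (A.step i))
    (hf : ∀ i k, Measurable (A.fusion i k)) (s : Option (ℕ ⊕ ℕ)) : A.source D s ≤ mΩ := by
  rcases s with _ | i | i
  · exact hD
  · exact (hs i).comap_le
  · exact (measurable_pi_lambda _ (hf i)).comap_le

theorem indep_step_fusion_info {mΩ : MeasurableSpace Ω} {P : Measure Ω}
    (hle : ∀ s, A.source D s ≤ mΩ) (hind : iIndep (A.source D) P) (i : ℕ) :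
    Indep (MeasurableSpace.comap (A.step i) inferInstance ⊔
      MeasurableSpace.comap (fun ω k => A.fusion i k ω) inferInstance) (A.info D i) P := by
  have hdisj : Disjoint {some (Sum.inl i), some (Sum.inr i)} (sourcesBefore i) := by
    rw [Set.disjoint_left]
    rintro s (rfl | rfl) hs <;> exact absurd (hs _ rfl) (by simp)
  have hsup := indep_iSup_of_disjoint hle hind hdisj
  rwa [iSup_pair] at hsup

end CentralizedAlgorithm

theorem measurable_gradient {F : Type*} [NormedAddCommGroup F] [InnerProductSpace ℝ F]
    [CompleteSpace F] [MeasurableSpace F] [BorelSpace F] (f : F → ℝ) : Measurable (gradient f) :=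
  (InnerProductSpace.toDual ℝ F).symm.continuous.measurable.comp (measurable_fderiv ℝ f)

theorem inner_map_map_eq_sum {M : ℕ} {F : Type*} [NormedAddCommGroup F] [InnerProductSpace ℝ F]
    (T : Vec M →L[ℝ] F) (x y : Vec M) :
    ⟪T x, T y⟫ = ∑ a, ∑ b,
      ⟪T (EuclideanSpace.single a 1), T (EuclideanSpace.single b 1)⟫ * (x a * y b) := by
  have hmap : ∀ z : Vec M, T z = ∑ a, z a • T (EuclideanSpace.single a 1) := fun z => by
    conv_lhs => rw [← (EuclideanSpace.basisFun (Fin M) ℝ).sum_repr z]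
    simp
  rw [hmap x, hmap y, sum_inner]
  simp only [inner_sum, real_inner_smul_left, real_inner_smul_right]
  exact Finset.sum_congr rfl fun a _ => Finset.sum_congr rfl fun b _ => by ring

section Rates

variable {N : ℕ} {ν δ μbar σμ2 : ℝ} {β2 σs2 σπ2 : Fin N → ℝ}

theorem mul_muX (hμ : μbar ≠ 0) : μbar * muX μbar σμ2 = μbar ^ 2 + σμ2 := by
  rw [muX]
  field_simp

theorem le_muX (hμ : 0 ≤ μbar) (hσ : 0 ≤ σμ2) : μbar ≤ muX μbar σμ2 :=
  le_add_of_nonneg_right (div_nonneg hσ hμ)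

theorem betaC2_nonneg (hβ2 : ∀ k, 0 ≤ β2 k) (hσπ2 : ∀ k, 0 ≤ σπ2 k) : 0 ≤ betaC2 δ β2 σπ2 :=
  Finset.sum_nonneg fun k _ => add_nonneg (hβ2 k)
    (mul_nonneg (mul_nonneg (sq_nonneg _) (hσπ2 k)) (add_nonneg (hβ2 k) (sq_nonneg _)))

theorem sigmaS2_nonneg (hσs2 : ∀ k, 0 ≤ σs2 k) (hσπ2 : ∀ k, 0 ≤ σπ2 k) : 0 ≤ sigmaS2 σs2 σπ2 :=
  Finset.sum_nonneg fun k _ =>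
    mul_nonneg (add_nonneg zero_le_one (mul_nonneg (sq_nonneg _) (hσπ2 k))) (hσs2 k)

theorem alphaCent_nonneg (hν : 0 ≤ ν) (hνδ : ν ≤ δ) (hβ2 : ∀ k, 0 ≤ β2 k)
    (hσπ2 : ∀ k, 0 ≤ σπ2 k) (hσ : 0 ≤ σμ2) : 0 ≤ alphaCent ν δ β2 σπ2 μbar σμ2 := by
  have hβ : 0 ≤ betaC2 δ β2 σπ2 := betaC2_nonneg hβ2 hσπ2
  have hcurv : 0 ≤ (δ ^ 2 - ν ^ 2) * (μbar / N) ^ 2 :=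
    mul_nonneg (sub_nonneg.2 (pow_le_pow_left₀ hν hνδ 2)) (sq_nonneg _)
  calc 0 ≤ (1 - ν * (μbar / N)) ^ 2 + (δ ^ 2 - ν ^ 2) * (μbar / N) ^ 2 +
        δ ^ 2 * σμ2 / (N : ℝ) ^ 2 + betaC2 δ β2 σπ2 * (μbar ^ 2 + σμ2) / (N : ℝ) ^ 2 := by
        positivity
    _ = alphaCent ν δ β2 σπ2 μbar σμ2 := by
        rw [alphaCent]
        ring

theorem alphaCent_eq (hμ : μbar ≠ 0) : alphaCent ν δ β2 σπ2 μbar σμ2 =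
    1 - μbar / N * (2 * ν - (δ ^ 2 + betaC2 δ β2 σπ2) * (muX μbar σμ2 / N)) := by
  rw [alphaCent, ← mul_muX hμ]
  ring

theorem alphaCent_lt_one (hN : 0 < N) (hδ : 0 < δ) (hβ2 : ∀ k, 0 ≤ β2 k) (hσπ2 : ∀ k, 0 ≤ σπ2 k)
    (hμ : 0 < μbar) (hx : muX μbar σμ2 / N < 2 * ν / (δ ^ 2 + betaC2 δ β2 σπ2)) :
    alphaCent ν δ β2 σπ2 μbar σμ2 < 1 := by
  have hβ : 0 ≤ betaC2 δ β2 σπ2 := betaC2_nonneg hβ2 hσπ2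
  rw [lt_div_iff₀' (by positivity)] at hx
  rw [alphaCent_eq hμ.ne']
  exact sub_lt_self 1 (mul_pos (by positivity) (sub_pos.2 hx))

theorem alphaCent_le (hN : 0 < N) (hμ : 0 < μbar)
    (hx : (δ ^ 2 + betaC2 δ β2 σπ2) * muX μbar σμ2 ≤ N * ν) :
    alphaCent ν δ β2 σπ2 μbar σμ2 ≤ 1 - ν * μbar / N := by
  have hx' : (δ ^ 2 + betaC2 δ β2 σπ2) * (muX μbar σμ2 / N) ≤ ν := by
    rw [← mul_div_assoc, div_le_iff₀' (by positivity)]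
    exact hx
  rw [alphaCent_eq hμ.ne', mul_comm ν, mul_div_right_comm]
  gcongr
  linarith

theorem mul_div_le_one (hN : 0 < N) (hν : 0 < ν) (hνδ : ν ≤ δ) (hβ2 : ∀ k, 0 ≤ β2 k)
    (hσπ2 : ∀ k, 0 ≤ σπ2 k) (hμ : 0 < μbar) (hσ : 0 ≤ σμ2)
    (hx : (δ ^ 2 + betaC2 δ β2 σπ2) * muX μbar σμ2 ≤ N * ν) : ν * μbar / N ≤ 1 := by
  have hβ : 0 ≤ betaC2 δ β2 σπ2 := betaC2_nonneg hβ2 hσπ2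
  have hle : μbar ≤ muX μbar σμ2 := le_muX hμ.le hσ
  rw [div_le_one (by positivity)]
  refine le_of_mul_le_mul_left ?_ hν
  calc ν * (ν * μbar) = (ν ^ 2 + 0) * μbar := by ring
    _ ≤ (δ ^ 2 + betaC2 δ β2 σπ2) * muX μbar σμ2 := by gcongr
    _ ≤ ν * N := hx.trans_eq (mul_comm _ _)

theorem sum_weight_mul_noise_bound (δ x p : ℝ) :
    ∑ k, (1 / (N : ℝ) ^ 2 + σπ2 k) * (β2 k * x + σs2 k * p) =
      (betaC2 δ β2 σπ2 / (N : ℝ) ^ 2 - (∑ k, σπ2 k) * δ ^ 2) * x +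
        sigmaS2 σs2 σπ2 / (N : ℝ) ^ 2 * p := by
  rw [betaC2, sigmaS2, Finset.sum_div, Finset.sum_div, Finset.sum_mul, Finset.sum_mul,
    ← Finset.sum_sub_distrib, Finset.sum_mul, ← Finset.sum_add_distrib]
  refine Finset.sum_congr rfl fun k _ => ?_
  have hN : (N : ℝ) ≠ 0 := Nat.cast_ne_zero.2 k.pos.ne'
  field_simp
  ring

end Rates

namespace CostSystem

variable {M N : ℕ} {J : Fin N → Vec M → ℝ} {wo : Vec M} {ν δ : ℝ}

theorem mul_norm_sq_le_sum_inner_gradient (h : CostSystem J wo ν δ) (w : Vec M) :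
    ν * ‖w - wo‖ ^ 2 ≤ ∑ k, ⟪w - wo, gradient (J k) w⟫ := by
  rw [← inner_sum, ← gradient_aggregateCost fun k => (h.diff k).1]
  exact h.cost.mul_norm_sq_le_inner_gradient h.isMinOn w

theorem norm_sum_gradient_le (h : CostSystem J wo ν δ) (w : Vec M) :
    ‖∑ k, gradient (J k) w‖ ≤ δ * ‖w - wo‖ := by
  rw [← gradient_aggregateCost fun k => (h.diff k).1]
  exact h.cost.norm_gradient_le h.isMinOn w

end CostSystem

theorem MixingStep.sum_weight_moment_mul_inner_gradient_le {M N : ℕ} {Ω : Type*}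
    {mG mΩ : MeasurableSpace Ω} {P : Measure Ω} [IsProbabilityMeasure P] {μ : Ω → ℝ}
    {π : Fin N → Ω → ℝ} {μbar σμ2 μub : ℝ} {σπ2 : Fin N → ℝ} {J : Fin N → Vec M → ℝ} {wo : Vec M}
    {ν δ : ℝ} (h : MixingStep mG P μ π μbar σμ2 μub σπ2) (hJ : CostSystem J wo ν δ)
    (hσπ2 : ∀ k, 0 ≤ σπ2 k) (w : Vec M) :
    ∑ k, ∑ l, (∫ ω, π k ω * π l ω ∂P) * ⟪gradient (J k) w, gradient (J l) w⟫ ≤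
      (1 / (N : ℝ) ^ 2 + ∑ k, σπ2 k) * δ ^ 2 * ‖w - wo‖ ^ 2 := by
  have hσ : 0 ≤ ∑ k, σπ2 k := Finset.sum_nonneg fun k _ => hσπ2 k
  calc ∑ k, ∑ l, (∫ ω, π k ω * π l ω ∂P) * ⟪gradient (J k) w, gradient (J l) w⟫
      ≤ 1 / (N : ℝ) ^ 2 * ‖∑ k, gradient (J k) w‖ ^ 2 +
          (∑ k, σπ2 k) * ∑ k, ‖gradient (J k) w‖ ^ 2 := h.sum_weight_moment_mul_inner_le _
    _ ≤ 1 / (N : ℝ) ^ 2 * (δ * ‖w - wo‖) ^ 2 + (∑ k, σπ2 k) * (δ ^ 2 * ‖w - wo‖ ^ 2) := by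
        gcongr
        exacts [hJ.norm_sum_gradient_le w, hJ.sum_norm_sq_gradient_le w]
    _ = (1 / (N : ℝ) ^ 2 + ∑ k, σπ2 k) * δ ^ 2 * ‖w - wo‖ ^ 2 := by ring

theorem CentralizedAlgorithm.iter_succ_sub {M N : ℕ} {Ω : Type*} (A : CentralizedAlgorithm M N Ω)
    (J : Fin N → Vec M → ℝ) (wo : Vec M) (i : ℕ) (ω : Ω) :
    A.iter (i + 1) ω - wo = (A.iter i ω - wo) - A.step i ω • ∑ k, A.fusion i k ω •
      (gradient (J k) (A.iter i ω) + A.noise J i k (A.iter i) ω) := by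
  simp only [iter, noise, add_sub_cancel]
  abel

section Mse

variable {M N : ℕ} {Ω : Type*} [MeasurableSpace Ω] {P : Measure Ω}
  {A : CentralizedAlgorithm M N Ω} {wo : Vec M}

theorem mse_eq_integral_norm_sq_sub (n : ℕ) :
    mse P A wo n = ∫ ω, ‖A.iter n ω - wo‖ ^ 2 ∂P := by
  simp only [mse, norm_sub_rev wo]

theorem mse_nonneg (n : ℕ) : 0 ≤ mse P A wo n :=
  integral_nonneg fun _ => sq_nonneg _

end Mse

namespace AsyncCentralizedModel

variable {M N : ℕ} {Ω : Type*} {D mΩ : MeasurableSpace Ω} {P : Measure Ω}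
  {A : CentralizedAlgorithm M N Ω} {J : Fin N → Vec M → ℝ} {wo : Vec M}
  {β2 σs2 σπ2 : Fin N → ℝ} {μbar σμ2 μub : ℝ} {ν δ : ℝ} {i : ℕ} {B : Set Ω}

theorem variance_nonneg (h : AsyncCentralizedModel P A J wo β2 σs2 σπ2 μbar σμ2 μub) :
    0 ≤ σμ2 := h.step.variance 0 ▸ integral_nonneg fun _ => sq_nonneg _

theorem fusion_variance_nonneg (h : AsyncCentralizedModel P A J wo β2 σs2 σπ2 μbar σμ2 μub)
    (k : Fin N) : 0 ≤ σπ2 k := h.fusion.variance 0 k ▸ integral_nonneg fun _ => sq_nonneg _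

theorem muX_pos (h : AsyncCentralizedModel P A J wo β2 σs2 σπ2 μbar σμ2 μub) :
    0 < muX μbar σμ2 := h.step.mean_pos.trans_le (le_muX h.step.mean_pos.le h.variance_nonneg)

theorem mixingStep_info (h : AsyncCentralizedModel P A J wo β2 σs2 σπ2 μbar σμ2 μub)
    (hD : D ≤ mΩ) (hind : iIndep (A.source D) P) (i : ℕ) :
    MixingStep (A.info D i) P (A.step i) (A.fusion i) μbar σμ2 μub σπ2 where
  le := iSup₂_le fun s _ =>
    CentralizedAlgorithm.source_le hD h.step.measurable h.fusion.measurable s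
  measurable_step := h.step.measurable i
  measurable_weight := h.fusion.measurable i
  indep_step_weight := hind.indep (i := some (Sum.inl i)) (j := some (Sum.inr i)) (by simp)
  indep := CentralizedAlgorithm.indep_step_fusion_info
    (CentralizedAlgorithm.source_le hD h.step.measurable h.fusion.measurable) hind i
  bounded := h.step.bounded i
  mean := h.step.mean i
  variance := h.step.variance i
  weight_nonneg := h.fusion.nonneg i
  weight_sum := h.fusion.sum_eq_one i
  weight_mean := h.fusion.mean i
  weight_variance := h.fusion.variance i

theorem exists_mixingStep (h : AsyncCentralizedModel P A J wo β2 σs2 σπ2 μbar σμ2 μub) (i : ℕ) :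
    ∃ mG : MeasurableSpace Ω,
      MixingStep mG P (A.step i) (A.fusion i) μbar σμ2 μub σπ2 ∧ A.past i ≤ mG ∧
      ∀ k v, Measurable[mG] v → Measurable[mG] (A.noise J i k v) := by
  obtain ⟨D, hD, hinit, hg, hind⟩ := h.indep
  exact ⟨A.info D i, h.mixingStep_info hD hind i,
    CentralizedAlgorithm.past_le_info hinit hg i, fun k v hv =>
      (CentralizedAlgorithm.measurable_approxGrad_info hg k hv).sub
        ((measurable_gradient (J k)).comp hv)⟩

theorem past_le (h : AsyncCentralizedModel P A J wo β2 σs2 σπ2 μbar σμ2 μub) (i : ℕ) :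
    A.past i ≤ mΩ := by
  obtain ⟨mG, hmix, hle, -⟩ := h.exists_mixingStep i
  exact hle.trans hmix.le

theorem measurable_iter (h : AsyncCentralizedModel P A J wo β2 σs2 σπ2 μbar σμ2 μub) (i : ℕ) :
    Measurable (A.iter i) :=
  (A.measurable_iter_past i).mono (h.past_le i) le_rfl

theorem memLp_gradient (h : AsyncCentralizedModel P A J wo β2 σs2 σπ2 μbar σμ2 μub)
    (hJ : CostSystem J wo ν δ) {p : ENNReal} {Q : Measure Ω}
    (hX : MemLp (fun ω => A.iter i ω - wo) p Q) (k : Fin N) :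
    MemLp (fun ω => gradient (J k) (A.iter i ω)) p Q :=
  hX.of_le_mul ((measurable_gradient (J k)).comp (h.measurable_iter i)).aestronglyMeasurable
    (ae_of_all _ fun _ => hJ.norm_gradient_le k _)

theorem memLp_iter_succ_sub (h : AsyncCentralizedModel P A J wo β2 σs2 σπ2 μbar σμ2 μub)
    (hJ : CostSystem J wo ν δ) {p : ENNReal} {Q : Measure Ω} (hQ : Q ≪ P)
    (hX : MemLp (fun ω => A.iter i ω - wo) p Q)
    (hS : ∀ k, MemLp (A.noise J i k (A.iter i)) p Q) :
    MemLp (fun ω => A.iter (i + 1) ω - wo) p Q := by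
  have hmeasurable_step := h.step.measurable i
  have hmeasurable_fusion := h.fusion.measurable i
  obtain ⟨mG, hmix, -, -⟩ := h.exists_mixingStep i
  have hterm : ∀ k, MemLp (fun ω => A.fusion i k ω •
      (gradient (J k) (A.iter i ω) + A.noise J i k (A.iter i) ω)) p Q := fun k => by
    have hdir := (h.memLp_gradient hJ hX k).add (hS k)
    refine hdir.of_le_mul (c := 1)
      ((hmeasurable_fusion k).aestronglyMeasurable.smul hdir.1) ?_
    filter_upwards [hQ.ae_le hmix.weight_mem_Icc] with ω hω
    rw [norm_smul, Real.norm_eq_abs, abs_of_nonneg (hω k).1]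
    exact mul_le_mul_of_nonneg_right (hω k).2 (norm_nonneg _)
  have hsum := memLp_finsetSum Finset.univ fun k _ => hterm k
  have hstep : MemLp (fun ω => A.step i ω • ∑ k, A.fusion i k ω •
      (gradient (J k) (A.iter i ω) + A.noise J i k (A.iter i) ω)) p Q := by
    refine hsum.of_le_mul (c := μub)
      (hmeasurable_step.aestronglyMeasurable.smul hsum.1) ?_
    filter_upwards [hQ.ae_le hmix.bounded] with ω hω
    rw [norm_smul, Real.norm_eq_abs, abs_of_nonneg hω.1]
    exact mul_le_mul_of_nonneg_right hω.2 (norm_nonneg _)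
  simp only [A.iter_succ_sub J wo]
  exact hX.sub hstep

variable [IsProbabilityMeasure P]

theorem memLp_iter_sub (h : AsyncCentralizedModel P A J wo β2 σs2 σπ2 μbar σμ2 μub)
    (hJ : CostSystem J wo ν δ) (i : ℕ) : MemLp (fun ω => A.iter i ω - wo) 2 P := by
  induction i with
  | zero => exact h.init_memLp.sub (memLp_const wo)
  | succ i ih => exact h.memLp_iter_succ_sub hJ .rfl ih (h.noise.memLp i)

theorem memLp_iter (h : AsyncCentralizedModel P A J wo β2 σs2 σπ2 μbar σμ2 μub)
    (hJ : CostSystem J wo ν δ) (i : ℕ) : MemLp (A.iter i) 2 P :=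
  ((h.memLp_iter_sub hJ i).add (memLp_const wo)).ae_eq (ae_of_all _ fun _ => sub_add_cancel _ _)

theorem integrable_norm_sq_iter_sub
    (h : AsyncCentralizedModel P A J wo β2 σs2 σπ2 μbar σμ2 μub)
    (hJ : CostSystem J wo ν δ) (i : ℕ) : Integrable (fun ω => ‖A.iter i ω - wo‖ ^ 2) P :=
  (h.memLp_iter_sub hJ i).norm.integrable_sq

theorem setIntegral_norm_sq_noise_le
    (h : AsyncCentralizedModel P A J wo β2 σs2 σπ2 μbar σμ2 μub)
    (hJ : CostSystem J wo ν δ) (hB : MeasurableSet[A.past i] B) (k : Fin N) :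
    ∫ ω in B, ‖A.noise J i k (A.iter i) ω‖ ^ 2 ∂P ≤
      β2 k * ∫ ω in B, ‖A.iter i ω - wo‖ ^ 2 ∂P + σs2 k * P.real B := by
  have hS : Integrable (fun ω => ‖A.noise J i k (A.iter i) ω‖ ^ 2) P :=
    (h.noise.memLp i k).norm.integrable_sq
  have hX : IntegrableOn (fun ω => β2 k * ‖A.iter i ω - wo‖ ^ 2) B P :=
    ((h.integrable_norm_sq_iter_sub hJ i).const_mul _).integrableOn
  rw [← setIntegral_condExp (h.past_le i) hS hB]
  calc ∫ ω in B, (P[fun ω => ‖A.noise J i k (A.iter i) ω‖ ^ 2 | A.past i]) ω ∂P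
      ≤ ∫ ω in B, β2 k * ‖A.iter i ω - wo‖ ^ 2 + σs2 k ∂P := by
        refine setIntegral_mono_ae integrable_condExp.integrableOn
          (hX.add (integrable_const _)) ?_
        simpa only [norm_sub_rev wo] using h.noise.var_le i k
    _ = β2 k * ∫ ω in B, ‖A.iter i ω - wo‖ ^ 2 ∂P + σs2 k * P.real B := by
        rw [integral_add hX (integrable_const _), integral_const_mul, setIntegral_const,
          smul_eq_mul, mul_comm (P.real B)]

section Map

variable {F : Type*} [NormedAddCommGroup F] [InnerProductSpace ℝ F] (T : Vec M →L[ℝ] F)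

theorem setIntegral_inner_map_noise_noise
    (h : AsyncCentralizedModel P A J wo β2 σs2 σπ2 μbar σμ2 μub)
    (hB : MeasurableSet[A.past i] B) {k l : Fin N} (hkl : k ≠ l) :
    ∫ ω in B, ⟪T (A.noise J i k (A.iter i) ω), T (A.noise J i l (A.iter i) ω)⟫ ∂P = 0 := by
  have hint : ∀ a b, Integrable
      (fun ω => A.noise J i k (A.iter i) ω a * A.noise J i l (A.iter i) ω b) P := fun a b =>
    ((h.noise.memLp i k).eval_piLp a).integrable_mul ((h.noise.memLp i l).eval_piLp b)
  have hzero : ∀ a b,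
      ∫ ω in B, A.noise J i k (A.iter i) ω a * A.noise J i l (A.iter i) ω b ∂P = 0 := fun a b => by
    rw [← setIntegral_condExp (h.past_le i) (hint a b) hB]
    refine integral_eq_zero_of_ae (ae_restrict_of_ae ?_)
    filter_upwards [h.noise.uncorrelated i k l hkl] with ω hω
    exact congrFun (congrFun hω a) b
  rw [integral_congr_ae (ae_of_all _ fun ω => inner_map_map_eq_sum T _ _),
    integral_finsetSum _ fun a _ => integrable_finsetSum _ fun b _ =>
      ((hint a b).const_mul _).integrableOn]
  refine Finset.sum_eq_zero fun a _ => ?_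
  rw [integral_finsetSum _ fun b _ => ((hint a b).const_mul _).integrableOn]
  simp only [integral_const_mul, hzero, mul_zero, Finset.sum_const_zero]

variable [CompleteSpace F]

theorem setIntegral_inner_map_noise
    (h : AsyncCentralizedModel P A J wo β2 σs2 σπ2 μbar σμ2 μub)
    (hB : MeasurableSet[A.past i] B) {y : Ω → F} (hy : StronglyMeasurable[A.past i] y)
    (hy2 : MemLp y 2 P) (k : Fin N) :
    ∫ ω in B, ⟪y ω, T (A.noise J i k (A.iter i) ω)⟫ ∂P = 0 := by
  have hS := T.comp_memLp' (h.noise.memLp i k)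
  have hSint := (h.noise.memLp i k).integrable one_le_two
  refine setIntegral_inner_eq_zero_of_condExp (h.past_le i) hB hy
    (integrable_real_inner_of_memLp hy2 hS).integrableOn (hS.integrable one_le_two) ?_
  filter_upwards [T.comp_condExp_comm hSint, h.noise.mean_zero i k] with ω hcomm hzero
  exact hcomm.symm.trans (by simp [hzero])

variable [MeasurableSpace F] [BorelSpace F] [SecondCountableTopology F]

theorem setIntegral_norm_sq_map_iter_succ
    (h : AsyncCentralizedModel P A J wo β2 σs2 σπ2 μbar σμ2 μub)
    (hJ : CostSystem J wo ν δ) (hB : MeasurableSet[A.past i] B) :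
    ∫ ω in B, ‖T (A.iter (i + 1) ω - wo)‖ ^ 2 ∂P =
      ∫ ω in B, ‖T (A.iter i ω - wo)‖ ^ 2 ∂P - 2 * (μbar / N) *
          ∑ k, ∫ ω in B, ⟪T (A.iter i ω - wo), T (gradient (J k) (A.iter i ω))⟫ ∂P +
        (μbar ^ 2 + σμ2) *
          (∑ k, ∑ l, (∫ ω, A.fusion i k ω * A.fusion i l ω ∂P) *
            ∫ ω in B, ⟪T (gradient (J k) (A.iter i ω)), T (gradient (J l) (A.iter i ω))⟫ ∂P +
          ∑ k, (1 / (N : ℝ) ^ 2 + σπ2 k) *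
            ∫ ω in B, ‖T (A.noise J i k (A.iter i) ω)‖ ^ 2 ∂P) := by
  have hS2 := fun k => T.comp_memLp' (h.noise.memLp i k)
  obtain ⟨mG, hmix, hle, hnoise⟩ := h.exists_mixingStep i
  have hiter : Measurable[A.past i] (A.iter i) := A.measurable_iter_past i
  have hX : Measurable[A.past i] (fun ω => T (A.iter i ω - wo)) :=
    T.measurable.comp (hiter.sub_const wo)
  have hG : ∀ k, Measurable[A.past i] (fun ω => T (gradient (J k) (A.iter i ω))) := fun k =>
    T.measurable.comp ((measurable_gradient (J k)).comp hiter)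
  have hX2 := T.comp_memLp' (h.memLp_iter_sub hJ i)
  have hG2 := fun k => T.comp_memLp' (h.memLp_gradient hJ (h.memLp_iter_sub hJ i) k)
  simp only [A.iter_succ_sub J wo i, map_sub T (_ - _), map_smul, map_sum, map_add]
  exact hmix.setIntegral_norm_sq_sub_smul_sum_add (hle _ hB) (hX.mono hle le_rfl)
    (fun k => (hG k).mono hle le_rfl)
    (fun k => T.measurable.comp (hnoise k _ (hiter.mono hle le_rfl))) (hX2.restrict B)
    (fun k => (hG2 k).restrict B) (fun k => (hS2 k).restrict B)
    (fun k => h.setIntegral_inner_map_noise T hB hX.stronglyMeasurable hX2 k)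
    (fun k l => h.setIntegral_inner_map_noise T hB (hG k).stronglyMeasurable (hG2 k) l)
    (fun k l hkl => h.setIntegral_inner_map_noise_noise T hB hkl)

end Map

theorem mul_setIntegral_norm_sq_le_sum_setIntegral_inner
    (h : AsyncCentralizedModel P A J wo β2 σs2 σπ2 μbar σμ2 μub) (hJ : CostSystem J wo ν δ)
    (i : ℕ) (B : Set Ω) :
    ν * ∫ ω in B, ‖A.iter i ω - wo‖ ^ 2 ∂P ≤
      ∑ k, ∫ ω in B, ⟪A.iter i ω - wo, gradient (J k) (A.iter i ω)⟫ ∂P := by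
  have hX := h.memLp_iter_sub hJ i
  have hint : ∀ k, IntegrableOn (fun ω => ⟪A.iter i ω - wo, gradient (J k) (A.iter i ω)⟫) B P :=
    fun k => (integrable_real_inner_of_memLp hX (h.memLp_gradient hJ hX k)).integrableOn
  rw [← integral_finsetSum _ fun k _ => hint k, ← integral_const_mul]
  exact integral_mono ((h.integrable_norm_sq_iter_sub hJ i).const_mul _).integrableOn
    (integrable_finsetSum _ fun k _ => hint k)
    fun ω => hJ.mul_norm_sq_le_sum_inner_gradient _

theorem sum_weight_moment_mul_setIntegral_inner_gradient_le
    (h : AsyncCentralizedModel P A J wo β2 σs2 σπ2 μbar σμ2 μub) (hJ : CostSystem J wo ν δ)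
    (i : ℕ) (B : Set Ω) :
    ∑ k, ∑ l, (∫ ω, A.fusion i k ω * A.fusion i l ω ∂P) *
        ∫ ω in B, ⟪gradient (J k) (A.iter i ω), gradient (J l) (A.iter i ω)⟫ ∂P ≤
      (1 / (N : ℝ) ^ 2 + ∑ k, σπ2 k) * δ ^ 2 * ∫ ω in B, ‖A.iter i ω - wo‖ ^ 2 ∂P := by
  obtain ⟨mG, hmix, -, -⟩ := h.exists_mixingStep i
  have hG := h.memLp_gradient hJ (h.memLp_iter_sub hJ i)
  have hint : ∀ k l, IntegrableOn (fun ω => (∫ ω, A.fusion i k ω * A.fusion i l ω ∂P) *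
      ⟪gradient (J k) (A.iter i ω), gradient (J l) (A.iter i ω)⟫) B P := fun k l =>
    ((integrable_real_inner_of_memLp (hG k) (hG l)).const_mul _).integrableOn
  simp only [← integral_const_mul]
  simp only [← integral_finsetSum _ fun l _ => hint _ l]
  rw [← integral_finsetSum _ fun k _ => integrable_finsetSum _ fun l _ => hint k l]
  exact integral_mono (integrable_finsetSum _ fun k _ => integrable_finsetSum _ fun l _ => hint k l)
    ((h.integrable_norm_sq_iter_sub hJ i).const_mul _).integrableOn
    fun ω => hmix.sum_weight_moment_mul_inner_gradient_le hJ h.fusion_variance_nonneg _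

theorem setIntegral_norm_sq_iter_succ_le
    (h : AsyncCentralizedModel P A J wo β2 σs2 σπ2 μbar σμ2 μub)
    (hJ : CostSystem J wo ν δ) (hB : MeasurableSet[A.past i] B) :
    ∫ ω in B, ‖A.iter (i + 1) ω - wo‖ ^ 2 ∂P ≤
      alphaCent ν δ β2 σπ2 μbar σμ2 * ∫ ω in B, ‖A.iter i ω - wo‖ ^ 2 ∂P +
        sigmaS2 σs2 σπ2 * (μbar ^ 2 + σμ2) / (N : ℝ) ^ 2 * P.real B := by
  have hdrift := h.mul_setIntegral_norm_sq_le_sum_setIntegral_inner hJ i B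
  have hgrad := h.sum_weight_moment_mul_setIntegral_inner_gradient_le hJ i B
  have hnoise : ∀ k, (1 / (N : ℝ) ^ 2 + σπ2 k) *
        ∫ ω in B, ‖A.noise J i k (A.iter i) ω‖ ^ 2 ∂P ≤ (1 / (N : ℝ) ^ 2 + σπ2 k) *
        (β2 k * ∫ ω in B, ‖A.iter i ω - wo‖ ^ 2 ∂P + σs2 k * P.real B) := fun k =>
    mul_le_mul_of_nonneg_left (h.setIntegral_norm_sq_noise_le hJ hB k)
      (add_nonneg (by positivity) (h.fusion_variance_nonneg k))
  have hsucc := h.setIntegral_norm_sq_map_iter_succ (ContinuousLinearMap.id ℝ (Vec M)) hJ hB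
  simp only [ContinuousLinearMap.id_apply] at hsucc
  have hμ := h.step.mean_pos
  have hσ := h.variance_nonneg
  rw [hsucc]
  generalize ∫ ω in B, ‖A.iter i ω - wo‖ ^ 2 ∂P = x at *
  calc _ ≤ x - 2 * (μbar / N) * (ν * x) + (μbar ^ 2 + σμ2) *
        ((1 / (N : ℝ) ^ 2 + ∑ k, σπ2 k) * δ ^ 2 * x +
          ∑ k, (1 / (N : ℝ) ^ 2 + σπ2 k) * (β2 k * x + σs2 k * P.real B)) := by
        gcongr x - 2 * (μbar / N) * ?_ + (μbar ^ 2 + σμ2) * (?_ + ?_)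
        exact Finset.sum_le_sum fun k _ => hnoise k
    _ = _ := by
        rw [sum_weight_mul_noise_bound δ, alphaCent]
        ring

theorem mse_succ_le (h : AsyncCentralizedModel P A J wo β2 σs2 σπ2 μbar σμ2 μub)
    (hJ : CostSystem J wo ν δ) (n : ℕ) :
    mse P A wo (n + 1) ≤ alphaCent ν δ β2 σπ2 μbar σμ2 * mse P A wo n +
      sigmaS2 σs2 σπ2 * (μbar ^ 2 + σμ2) / (N : ℝ) ^ 2 := by
  simpa [mse_eq_integral_norm_sq_sub] using
    h.setIntegral_norm_sq_iter_succ_le hJ (i := n) (B := Set.univ) MeasurableSet.univ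

theorem eventually_setIntegral_norm_sq_le
    (h : AsyncCentralizedModel P A J wo β2 σs2 σπ2 μbar σμ2 μub) (hN : 0 < N)
    (hJ : CostSystem J wo ν δ) (hβ2 : ∀ k, 0 ≤ β2 k)
    (hx : (δ ^ 2 + betaC2 δ β2 σπ2) * muX μbar σμ2 ≤ N * ν)
    (hB : MeasurableSet[A.past 0] B) {ε : ℝ} (hε : 0 < ε) :
    ∀ᶠ n in atTop, ∫ ω in B, ‖A.iter n ω - wo‖ ^ 2 ∂P ≤
      sigmaS2 σs2 σπ2 / (N * ν) * muX μbar σμ2 * P.real B + ε := by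
  have hν := hJ.cost.nu_pos
  have hμ := h.step.mean_pos
  refine eventually_le_of_contraction (ρ := ν * μbar / N) (by positivity)
    (mul_div_le_one hN hν hJ.cost.nu_le hβ2 h.fusion_variance_nonneg hμ h.variance_nonneg hx) hε
    (Eventually.of_forall fun n => ?_)
  have hrate : sigmaS2 σs2 σπ2 * (μbar ^ 2 + σμ2) / (N : ℝ) ^ 2 * P.real B =
      ν * μbar / N * (sigmaS2 σs2 σπ2 / (N * ν) * muX μbar σμ2 * P.real B) := by
    rw [← mul_muX hμ.ne']
    field_simp
  rw [← hrate]
  refine (h.setIntegral_norm_sq_iter_succ_le hJ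
    (CentralizedAlgorithm.past_mono (Nat.zero_le n) _ hB)).trans ?_
  gcongr
  exact alphaCent_le hN hμ hx

theorem eventually_mse_le
    (h : AsyncCentralizedModel P A J wo β2 σs2 σπ2 μbar σμ2 μub) (hN : 0 < N)
    (hJ : CostSystem J wo ν δ) (hβ2 : ∀ k, 0 ≤ β2 k)
    (hx : (δ ^ 2 + betaC2 δ β2 σπ2) * muX μbar σμ2 ≤ N * ν) {ε : ℝ} (hε : 0 < ε) :
    ∀ᶠ n in atTop, mse P A wo n ≤ sigmaS2 σs2 σπ2 / (N * ν) * muX μbar σμ2 + ε := by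
  simpa [mse_eq_integral_norm_sq_sub] using
    h.eventually_setIntegral_norm_sq_le hN hJ hβ2 hx MeasurableSet.univ hε

theorem bddAbove_mse
    (h : AsyncCentralizedModel P A J wo β2 σs2 σπ2 μbar σμ2 μub) (hN : 0 < N)
    (hJ : CostSystem J wo ν δ) (hβ2 : ∀ k, 0 ≤ β2 k)
    (hx : (δ ^ 2 + betaC2 δ β2 σπ2) * muX μbar σμ2 ≤ N * ν) :
    BddAbove (Set.range (mse P A wo)) :=
  (isBoundedUnder_of_eventually_le (h.eventually_mse_le hN hJ hβ2 hx one_pos)).bddAbove_range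

theorem limsup_mse_le
    (h : AsyncCentralizedModel P A J wo β2 σs2 σπ2 μbar σμ2 μub) (hN : 0 < N)
    (hJ : CostSystem J wo ν δ) (hβ2 : ∀ k, 0 ≤ β2 k)
    (hx : (δ ^ 2 + betaC2 δ β2 σπ2) * muX μbar σμ2 ≤ N * ν) :
    limsup (mse P A wo) atTop ≤ sigmaS2 σs2 σπ2 / (N * ν) * muX μbar σμ2 :=
  le_of_forall_pos_le_add fun _ hε =>
    limsup_le_of_le (isCoboundedUnder_le_of_le atTop (x := 0) fun n => mse_nonneg n)
      (h.eventually_mse_le hN hJ hβ2 hx hε)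

end AsyncCentralizedModel

section FourthPowers

variable {E : Type*} [NormedAddCommGroup E]

theorem norm_add_pow_le (x y : E) (n : ℕ) :
    ‖x + y‖ ^ n ≤ 2 ^ (n - 1) * (‖x‖ ^ n + ‖y‖ ^ n) := by
  calc ‖x + y‖ ^ n ≤ (‖x‖ + ‖y‖) ^ n := by gcongr; exact norm_add_le x y
    _ ≤ 2 ^ (n - 1) * (‖x‖ ^ n + ‖y‖ ^ n) := add_pow_le (norm_nonneg x) (norm_nonneg y) n

theorem norm_pow_sum_smul_le [NormedSpace ℝ E] {ι : Type*} {s : Finset ι} {w : ι → ℝ}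
    (hw : ∀ k ∈ s, 0 ≤ w k) (hsum : ∑ k ∈ s, w k = 1) (v : ι → E) (n : ℕ) :
    ‖∑ k ∈ s, w k • v k‖ ^ n ≤ ∑ k ∈ s, ‖v k‖ ^ n := by
  have hnorm : ‖∑ k ∈ s, w k • v k‖ ≤ ∑ k ∈ s, w k * ‖v k‖ :=
    (norm_sum_le _ _).trans_eq <| Finset.sum_congr rfl fun k hk => by
      rw [norm_smul, Real.norm_eq_abs, abs_of_nonneg (hw k hk)]
  calc ‖∑ k ∈ s, w k • v k‖ ^ n ≤ (∑ k ∈ s, w k * ‖v k‖) ^ n := by gcongr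
    _ ≤ ∑ k ∈ s, w k * ‖v k‖ ^ n :=
        Real.pow_arith_mean_le_arith_mean_pow s w _ hw hsum (fun k _ => norm_nonneg _) n
    _ ≤ ∑ k ∈ s, ‖v k‖ ^ n := Finset.sum_le_sum fun k hk =>
        mul_le_of_le_one_left (by positivity) (hsum ▸ Finset.single_le_sum hw hk)

variable {Ω : Type*} {mΩ : MeasurableSpace Ω} {Q : Measure Ω} {X Y : Ω → E}

theorem integrable_norm_pow_four_of_memLp (hX : MemLp X 4 Q) :
    Integrable (fun ω => ‖X ω‖ ^ 4) Q :=
  hX.integrable_norm_pow (p := 4) (by norm_num)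

theorem integrable_norm_sq_mul_norm_sq_of_memLp (hX : MemLp X 4 Q) (hY : MemLp Y 4 Q) :
    Integrable (fun ω => ‖X ω‖ ^ 2 * ‖Y ω‖ ^ 2) Q := by
  refine ((integrable_norm_pow_four_of_memLp hX).add
    (integrable_norm_pow_four_of_memLp hY)).mono'
    ((hX.1.norm.pow 2).mul (hY.1.norm.pow 2)) (ae_of_all _ fun ω => ?_)
  rw [Real.norm_eq_abs, abs_of_nonneg (by positivity), Pi.add_apply]
  nlinarith [sq_nonneg (‖X ω‖ ^ 2 - ‖Y ω‖ ^ 2), sq_nonneg (‖X ω‖ ^ 2), sq_nonneg (‖Y ω‖ ^ 2)]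

variable [InnerProductSpace ℝ E]

theorem integrable_norm_sq_mul_inner_of_memLp (hX : MemLp X 4 Q) (hY : MemLp Y 4 Q) :
    Integrable (fun ω => ‖X ω‖ ^ 2 * ⟪X ω, Y ω⟫) Q := by
  refine ((integrable_norm_sq_mul_norm_sq_of_memLp hX hX).add
    (integrable_norm_sq_mul_norm_sq_of_memLp hX hY)).mono'
    ((hX.1.norm.pow 2).mul (hX.1.inner hY.1)) (ae_of_all _ fun ω => ?_)
  rw [norm_mul, norm_pow, norm_norm, Pi.add_apply, ← mul_add]
  gcongr
  refine (norm_inner_le_norm _ _).trans ?_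
  nlinarith [sq_nonneg (‖X ω‖ - ‖Y ω‖), sq_nonneg ‖X ω‖, sq_nonneg ‖Y ω‖]

theorem norm_sub_smul_pow_four_le (x d : E) (t : ℝ) :
    ‖x - t • d‖ ^ 4 ≤ ‖x‖ ^ 4 - 4 * (t * (‖x‖ ^ 2 * ⟪x, d⟫)) +
      8 * (t ^ 2 * (‖x‖ ^ 2 * ‖d‖ ^ 2)) + 3 * (t ^ 4 * ‖d‖ ^ 4) := by
  have hsq : ‖x - t • d‖ ^ 2 = ‖x‖ ^ 2 - 2 * (t * ⟪x, d⟫) + t ^ 2 * ‖d‖ ^ 2 := by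
    rw [norm_sub_sq_real, norm_smul, mul_pow, real_inner_smul_right, Real.norm_eq_abs, sq_abs]
  have hcs : ⟪x, d⟫ ^ 2 ≤ ‖x‖ ^ 2 * ‖d‖ ^ 2 := by
    rw [← mul_pow, ← sq_abs]
    exact pow_le_pow_left₀ (abs_nonneg _) (abs_real_inner_le_norm x d) 2
  calc ‖x - t • d‖ ^ 4 = (‖x‖ ^ 2 - 2 * (t * ⟪x, d⟫) + t ^ 2 * ‖d‖ ^ 2) ^ 2 := by
        rw [← hsq, ← pow_mul]
    _ ≤ _ := by nlinarith [mul_le_mul_of_nonneg_left hcs (sq_nonneg t),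
        sq_nonneg (t * ⟪x, d⟫ + t ^ 2 * ‖d‖ ^ 2)]

end FourthPowers

namespace MixingStep

variable {N : ℕ} {Ω E : Type*} {mG mΩ : MeasurableSpace Ω} {P : Measure Ω}
  {μ : Ω → ℝ} {π : Fin N → Ω → ℝ} {μbar σμ2 μub : ℝ} {σπ2 : Fin N → ℝ}
  [NormedAddCommGroup E] [InnerProductSpace ℝ E] {X : Ω → E} {F : Fin N → Ω → E} {B : Set Ω}

theorem ae_norm_sub_smul_sum_pow_four_le (h : MixingStep mG P μ π μbar σμ2 μub σπ2)
    (X : Ω → E) (F : Fin N → Ω → E) :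
    ∀ᵐ ω ∂P, ‖X ω - μ ω • ∑ k, π k ω • F k ω‖ ^ 4 ≤
      ‖X ω‖ ^ 4 - 4 * ∑ k, μ ω ^ 1 * (π k ω * (‖X ω‖ ^ 2 * ⟪X ω, F k ω⟫)) +
        8 * ∑ k, μ ω ^ 2 * (‖X ω‖ ^ 2 * ‖F k ω‖ ^ 2) + 3 * ∑ k, μ ω ^ 4 * ‖F k ω‖ ^ 4 := by
  filter_upwards [ae_all_iff.2 h.weight_nonneg, h.weight_sum] with ω hnonneg hsum
  have hpow := norm_pow_sum_smul_le (fun k _ => hnonneg k) hsum fun k => F k ω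
  have hlin : ∑ k, μ ω ^ 1 * (π k ω * (‖X ω‖ ^ 2 * ⟪X ω, F k ω⟫)) =
      μ ω * (‖X ω‖ ^ 2 * ⟪X ω, ∑ k, π k ω • F k ω⟫) := by
    simp only [inner_sum, real_inner_smul_right, Finset.mul_sum]
    exact Finset.sum_congr rfl fun k _ => by ring
  rw [hlin, ← Finset.mul_sum, ← Finset.mul_sum, ← Finset.mul_sum]
  refine (norm_sub_smul_pow_four_le _ _ _).trans ?_
  gcongr
  exacts [hpow 2, hpow 4]

variable [IsProbabilityMeasure P]

theorem setIntegral_step_sq_mul (h : MixingStep mG P μ π μbar σμ2 μub σπ2) {φ : Ω → ℝ}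
    (hB : MeasurableSet[mG] B) (hφ : Measurable[mG] φ) :
    ∫ ω in B, μ ω ^ 2 * φ ω ∂P = (μbar ^ 2 + σμ2) * ∫ ω in B, φ ω ∂P := by
  rw [h.setIntegral_step_mul (f := fun x => x ^ 2) (measurable_id.pow_const 2) hφ hB, h.integral_sq]

theorem setIntegral_step_pow_four_mul_le (h : MixingStep mG P μ π μbar σμ2 μub σπ2) {φ : Ω → ℝ}
    (hB : MeasurableSet[mG] B) (hφ : Measurable[mG] φ) (hφ0 : ∀ ω, 0 ≤ φ ω) :
    ∫ ω in B, μ ω ^ 4 * φ ω ∂P ≤ μub ^ 2 * (μbar ^ 2 + σμ2) * ∫ ω in B, φ ω ∂P := by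
  rw [h.setIntegral_step_mul (f := fun x => x ^ 4) (measurable_id.pow_const 4) hφ hB]
  exact mul_le_mul_of_nonneg_right h.integral_pow_four_le (integral_nonneg hφ0)

variable [MeasurableSpace E] [BorelSpace E] [SecondCountableTopology E]

theorem setIntegral_norm_pow_four_sub_smul_sum_le (h : MixingStep mG P μ π μbar σμ2 μub σπ2)
    (hB : MeasurableSet[mG] B) (hX : Measurable[mG] X) (hF : ∀ k, Measurable[mG] (F k))
    (hX4 : MemLp X 4 (P.restrict B)) (hF4 : ∀ k, MemLp (F k) 4 (P.restrict B))
    (hnext : MemLp (fun ω => X ω - μ ω • ∑ k, π k ω • F k ω) 4 (P.restrict B)) :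
    ∫ ω in B, ‖X ω - μ ω • ∑ k, π k ω • F k ω‖ ^ 4 ∂P ≤
      ∫ ω in B, ‖X ω‖ ^ 4 ∂P -
          4 * (μbar / N * ∑ k, ∫ ω in B, ‖X ω‖ ^ 2 * ⟪X ω, F k ω⟫ ∂P) +
        (μbar ^ 2 + σμ2) * (8 * ∑ k, ∫ ω in B, ‖X ω‖ ^ 2 * ‖F k ω‖ ^ 2 ∂P +
          3 * μub ^ 2 * ∑ k, ∫ ω in B, ‖F k ω‖ ^ 4 ∂P) := by
  have hX_int := integrable_norm_pow_four_of_memLp hX4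
  have hlin : ∀ k, IntegrableOn (fun ω => μ ω ^ 1 * (π k ω * (‖X ω‖ ^ 2 * ⟪X ω, F k ω⟫))) B P :=
    fun k => h.integrableOn_pow_mul 1
      (h.integrableOn_weight_mul k (integrable_norm_sq_mul_inner_of_memLp hX4 (hF4 k)))
  have hquad : ∀ k, IntegrableOn (fun ω => μ ω ^ 2 * (‖X ω‖ ^ 2 * ‖F k ω‖ ^ 2)) B P := fun k =>
    h.integrableOn_pow_mul 2 (integrable_norm_sq_mul_norm_sq_of_memLp hX4 (hF4 k))
  have hquart : ∀ k, IntegrableOn (fun ω => μ ω ^ 4 * ‖F k ω‖ ^ 4) B P := fun k =>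
    h.integrableOn_pow_mul 4 (integrable_norm_pow_four_of_memLp (hF4 k))
  have hlin_sum := (integrable_finsetSum Finset.univ fun k _ => hlin k).const_mul 4
  have hquad_sum := (integrable_finsetSum Finset.univ fun k _ => hquad k).const_mul 8
  have hquart_sum := (integrable_finsetSum Finset.univ fun k _ => hquart k).const_mul 3
  have hlin_meas : ∀ k, Measurable[mG] (fun ω => ‖X ω‖ ^ 2 * ⟪X ω, F k ω⟫) := fun k =>
    Measurable.comp (g := fun p : E × E => ‖p.1‖ ^ 2 * ⟪p.1, p.2⟫) (by fun_prop)
      (hX.prodMk (hF k))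
  have hquad_meas : ∀ k, Measurable[mG] (fun ω => ‖X ω‖ ^ 2 * ‖F k ω‖ ^ 2) := fun k =>
    Measurable.comp (g := fun p : E × E => ‖p.1‖ ^ 2 * ‖p.2‖ ^ 2) (by fun_prop)
      (hX.prodMk (hF k))
  have hquart_meas : ∀ k, Measurable[mG] (fun ω => ‖F k ω‖ ^ 4) := fun k =>
    (measurable_norm.pow_const 4).comp (hF k)
  refine (integral_mono_ae (integrable_norm_pow_four_of_memLp hnext)
    (((hX_int.sub hlin_sum).add hquad_sum).add hquart_sum)
    (ae_restrict_of_ae (h.ae_norm_sub_smul_sum_pow_four_le X F))).trans ?_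
  rw [integral_add' ((hX_int.sub hlin_sum).add hquad_sum) hquart_sum,
    integral_add' (hX_int.sub hlin_sum) hquad_sum, integral_sub' hX_int hlin_sum]
  rw [integral_const_mul, integral_const_mul, integral_const_mul,
    integral_finsetSum _ fun k _ => hlin k, integral_finsetSum _ fun k _ => hquad k,
    integral_finsetSum _ fun k _ => hquart k]
  simp only [h.setIntegral_step_mul_weight_mul hB (hlin_meas _),
    h.setIntegral_step_sq_mul hB (hquad_meas _)]
  have hquart_le := Finset.sum_le_sum fun k (_ : k ∈ Finset.univ) =>
    h.setIntegral_step_pow_four_mul_le hB (hquart_meas k) fun ω => by positivity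
  rw [← Finset.mul_sum] at hquart_le
  rw [← Finset.mul_sum, ← Finset.mul_sum]
  linarith

end MixingStep

theorem CostSystem.sum_norm_pow_four_gradient_le {M N : ℕ} {J : Fin N → Vec M → ℝ} {wo : Vec M}
    {ν δ : ℝ} (hJ : CostSystem J wo ν δ) (w : Vec M) :
    ∑ k, ‖gradient (J k) w‖ ^ 4 ≤ δ ^ 4 * ‖w - wo‖ ^ 4 := by
  calc ∑ k, ‖gradient (J k) w‖ ^ 4 = ∑ k, (‖gradient (J k) w‖ ^ 2) ^ 2 := by
        simp only [← pow_mul]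
    _ ≤ (∑ k, ‖gradient (J k) w‖ ^ 2) ^ 2 :=
        Finset.sum_sq_le_sq_sum_of_nonneg fun k _ => sq_nonneg _
    _ ≤ (δ ^ 2 * ‖w - wo‖ ^ 2) ^ 2 := by
        gcongr
        exact hJ.sum_norm_sq_gradient_le w
    _ = δ ^ 4 * ‖w - wo‖ ^ 4 := by ring

namespace AsyncCentralizedModel

variable {M N : ℕ} {Ω : Type*} {mΩ : MeasurableSpace Ω} {P : Measure Ω}
  {A : CentralizedAlgorithm M N Ω} {J : Fin N → Vec M → ℝ} {wo : Vec M}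
  {β2 σs2 σπ2 β4 σ4 : Fin N → ℝ} {μbar σμ2 μub : ℝ} {ν δ : ℝ} {i : ℕ} {B : Set Ω}

theorem memLp_four_iter_sub (h : AsyncCentralizedModel P A J wo β2 σs2 σπ2 μbar σμ2 μub)
    (hJ : CostSystem J wo ν δ) (h4 : FourthMomentCond P A J wo β4 σ4)
    (hX : MemLp (fun ω => A.iter 0 ω - wo) 4 (P.restrict B)) (i : ℕ) :
    MemLp (fun ω => A.iter i ω - wo) 4 (P.restrict B) := by
  induction i with
  | zero => exact hX
  | succ i ih =>
    exact h.memLp_iter_succ_sub hJ Measure.restrict_le_self.absolutelyContinuous ih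
      fun k => (h4 i k).1.restrict B

variable [IsProbabilityMeasure P]

theorem setIntegral_norm_pow_four_noise_le
    (h : AsyncCentralizedModel P A J wo β2 σs2 σπ2 μbar σμ2 μub)
    (h4 : FourthMomentCond P A J wo β4 σ4) (hB : MeasurableSet[A.past i] B)
    (hX : MemLp (fun ω => A.iter i ω - wo) 4 (P.restrict B)) (k : Fin N) :
    ∫ ω in B, ‖A.noise J i k (A.iter i) ω‖ ^ 4 ∂P ≤
      β4 k * ∫ ω in B, ‖A.iter i ω - wo‖ ^ 4 ∂P + σ4 k * P.real B := by
  have hX4 : IntegrableOn (fun ω => β4 k * ‖A.iter i ω - wo‖ ^ 4) B P :=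
    (integrable_norm_pow_four_of_memLp hX).const_mul _
  rw [← setIntegral_condExp (h.past_le i) (integrable_norm_pow_four_of_memLp (h4 i k).1) hB]
  calc ∫ ω in B, (P[fun ω => ‖A.noise J i k (A.iter i) ω‖ ^ 4 | A.past i]) ω ∂P
      ≤ ∫ ω in B, β4 k * ‖A.iter i ω - wo‖ ^ 4 + σ4 k ∂P := by
        refine setIntegral_mono_ae integrable_condExp.integrableOn
          (hX4.add (integrable_const _)) ?_
        simpa only [norm_sub_rev wo] using (h4 i k).2
    _ = β4 k * ∫ ω in B, ‖A.iter i ω - wo‖ ^ 4 ∂P + σ4 k * P.real B := by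
        rw [integral_add hX4 (integrable_const _), integral_const_mul, setIntegral_const,
          smul_eq_mul, mul_comm (P.real B)]

theorem setIntegral_norm_sq_mul_norm_sq_noise_le
    (h : AsyncCentralizedModel P A J wo β2 σs2 σπ2 μbar σμ2 μub) (hJ : CostSystem J wo ν δ)
    (h4 : FourthMomentCond P A J wo β4 σ4) (hB : MeasurableSet[A.past i] B)
    (hX : MemLp (fun ω => A.iter i ω - wo) 4 (P.restrict B)) (k : Fin N) :
    ∫ ω in B, ‖A.iter i ω - wo‖ ^ 2 * ‖A.noise J i k (A.iter i) ω‖ ^ 2 ∂P ≤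
      β2 k * ∫ ω in B, ‖A.iter i ω - wo‖ ^ 4 ∂P + σs2 k * ∫ ω in B, ‖A.iter i ω - wo‖ ^ 2 ∂P := by
  have hmeas : Measurable[A.past i] (fun ω => ‖A.iter i ω - wo‖ ^ 2) :=
    (measurable_norm.pow_const 2).comp ((A.measurable_iter_past i).sub_const wo)
  have hX4 : IntegrableOn (fun ω => β2 k * ‖A.iter i ω - wo‖ ^ 4) B P :=
    (integrable_norm_pow_four_of_memLp hX).const_mul _
  have hX2 : IntegrableOn (fun ω => σs2 k * ‖A.iter i ω - wo‖ ^ 2) B P :=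
    ((h.integrable_norm_sq_iter_sub hJ i).const_mul _).integrableOn
  have hexp : ∀ ω, ‖A.iter i ω - wo‖ ^ 2 * (β2 k * ‖A.iter i ω - wo‖ ^ 2 + σs2 k) =
      β2 k * ‖A.iter i ω - wo‖ ^ 4 + σs2 k * ‖A.iter i ω - wo‖ ^ 2 := fun ω => by ring
  rw [← integral_const_mul, ← integral_const_mul, ← integral_add hX4 hX2]
  simp only [← hexp]
  refine setIntegral_mul_le_of_condExp_le (h.past_le i) hB hmeas.stronglyMeasurable
    (fun ω => sq_nonneg _) (integrable_norm_sq_mul_norm_sq_of_memLp hX ((h4 i k).1.restrict B))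
    (h.noise.memLp i k).norm.integrable_sq ?_ ?_
  · simp only [hexp]
    exact hX4.add hX2
  · simpa only [norm_sub_rev wo] using h.noise.var_le i k

theorem setIntegral_norm_sq_mul_inner_noise
    (h : AsyncCentralizedModel P A J wo β2 σs2 σπ2 μbar σμ2 μub)
    (h4 : FourthMomentCond P A J wo β4 σ4) (hB : MeasurableSet[A.past i] B)
    (hX : MemLp (fun ω => A.iter i ω - wo) 4 (P.restrict B)) (k : Fin N) :
    ∫ ω in B, ‖A.iter i ω - wo‖ ^ 2 * ⟪A.iter i ω - wo, A.noise J i k (A.iter i) ω⟫ ∂P = 0 := by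
  have hy : Measurable[A.past i] (fun ω => ‖A.iter i ω - wo‖ ^ 2 • (A.iter i ω - wo)) :=
    Measurable.comp (g := fun x : Vec M => ‖x‖ ^ 2 • x) (by fun_prop)
      ((A.measurable_iter_past i).sub_const wo)
  have hint := integrable_norm_sq_mul_inner_of_memLp hX ((h4 i k).1.restrict B)
  simp only [← real_inner_smul_left] at hint ⊢
  exact setIntegral_inner_eq_zero_of_condExp (h.past_le i) hB hy.stronglyMeasurable hint
    ((h.noise.memLp i k).integrable one_le_two) (h.noise.mean_zero i k)

theorem mul_setIntegral_norm_pow_four_le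
    (h : AsyncCentralizedModel P A J wo β2 σs2 σπ2 μbar σμ2 μub) (hJ : CostSystem J wo ν δ)
    (h4 : FourthMomentCond P A J wo β4 σ4) (hB : MeasurableSet[A.past i] B)
    (hX : MemLp (fun ω => A.iter i ω - wo) 4 (P.restrict B)) :
    ν * ∫ ω in B, ‖A.iter i ω - wo‖ ^ 4 ∂P ≤
      ∑ k, ∫ ω in B, ‖A.iter i ω - wo‖ ^ 2 * ⟪A.iter i ω - wo,
        gradient (J k) (A.iter i ω) + A.noise J i k (A.iter i) ω⟫ ∂P := by
  have hgrad := fun k => integrable_norm_sq_mul_inner_of_memLp hX (h.memLp_gradient hJ hX k)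
  have hsplit : ∀ k, ∫ ω in B, ‖A.iter i ω - wo‖ ^ 2 * ⟪A.iter i ω - wo,
        gradient (J k) (A.iter i ω) + A.noise J i k (A.iter i) ω⟫ ∂P =
      ∫ ω in B, ‖A.iter i ω - wo‖ ^ 2 *
        ⟪A.iter i ω - wo, gradient (J k) (A.iter i ω)⟫ ∂P := fun k => by
    simp only [inner_add_right, mul_add]
    rw [integral_add (hgrad k)
      (integrable_norm_sq_mul_inner_of_memLp hX ((h4 i k).1.restrict B)),
      h.setIntegral_norm_sq_mul_inner_noise h4 hB hX k, add_zero]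
  simp only [hsplit]
  rw [← integral_finsetSum _ fun k _ => hgrad k, ← integral_const_mul]
  refine integral_mono ((integrable_norm_pow_four_of_memLp hX).const_mul _)
    (integrable_finsetSum _ fun k _ => hgrad k) fun ω => ?_
  calc ν * ‖A.iter i ω - wo‖ ^ 4 = ‖A.iter i ω - wo‖ ^ 2 * (ν * ‖A.iter i ω - wo‖ ^ 2) := by ring
    _ ≤ ‖A.iter i ω - wo‖ ^ 2 * ∑ k, ⟪A.iter i ω - wo, gradient (J k) (A.iter i ω)⟫ := by
        gcongr
        exact hJ.mul_norm_sq_le_sum_inner_gradient _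
    _ = _ := Finset.mul_sum _ _ _

theorem sum_setIntegral_norm_sq_mul_norm_sq_le
    (h : AsyncCentralizedModel P A J wo β2 σs2 σπ2 μbar σμ2 μub) (hJ : CostSystem J wo ν δ)
    (h4 : FourthMomentCond P A J wo β4 σ4) (hB : MeasurableSet[A.past i] B)
    (hX : MemLp (fun ω => A.iter i ω - wo) 4 (P.restrict B)) :
    ∑ k, ∫ ω in B, ‖A.iter i ω - wo‖ ^ 2 *
        ‖gradient (J k) (A.iter i ω) + A.noise J i k (A.iter i) ω‖ ^ 2 ∂P ≤
      2 * ((δ ^ 2 + ∑ k, β2 k) * ∫ ω in B, ‖A.iter i ω - wo‖ ^ 4 ∂P +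
        (∑ k, σs2 k) * ∫ ω in B, ‖A.iter i ω - wo‖ ^ 2 ∂P) := by
  have hG := fun k => h.memLp_gradient hJ hX k
  have hS := fun k => (h4 i k).1.restrict B
  have hGi := fun k => integrable_norm_sq_mul_norm_sq_of_memLp hX (hG k)
  have hSi := fun k => integrable_norm_sq_mul_norm_sq_of_memLp hX (hS k)
  have hgrad : ∑ k, ∫ ω in B, ‖A.iter i ω - wo‖ ^ 2 * ‖gradient (J k) (A.iter i ω)‖ ^ 2 ∂P ≤
      δ ^ 2 * ∫ ω in B, ‖A.iter i ω - wo‖ ^ 4 ∂P := by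
    rw [← integral_finsetSum _ fun k _ => hGi k, ← integral_const_mul]
    refine integral_mono (integrable_finsetSum _ fun k _ => hGi k)
      ((integrable_norm_pow_four_of_memLp hX).const_mul _) fun ω => ?_
    calc ∑ k, ‖A.iter i ω - wo‖ ^ 2 * ‖gradient (J k) (A.iter i ω)‖ ^ 2
        = ‖A.iter i ω - wo‖ ^ 2 * ∑ k, ‖gradient (J k) (A.iter i ω)‖ ^ 2 :=
          (Finset.mul_sum _ _ _).symm
      _ ≤ ‖A.iter i ω - wo‖ ^ 2 * (δ ^ 2 * ‖A.iter i ω - wo‖ ^ 2) := by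
          gcongr
          exact hJ.sum_norm_sq_gradient_le _
      _ = δ ^ 2 * ‖A.iter i ω - wo‖ ^ 4 := by ring
  have hsplit : ∀ k, ∫ ω in B, ‖A.iter i ω - wo‖ ^ 2 *
        ‖gradient (J k) (A.iter i ω) + A.noise J i k (A.iter i) ω‖ ^ 2 ∂P ≤
      2 * (∫ ω in B, ‖A.iter i ω - wo‖ ^ 2 * ‖gradient (J k) (A.iter i ω)‖ ^ 2 ∂P +
        (β2 k * ∫ ω in B, ‖A.iter i ω - wo‖ ^ 4 ∂P +
          σs2 k * ∫ ω in B, ‖A.iter i ω - wo‖ ^ 2 ∂P)) := fun k => by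
    refine le_trans ?_ (mul_le_mul_of_nonneg_left (add_le_add_right
      (h.setIntegral_norm_sq_mul_norm_sq_noise_le hJ h4 hB hX k) _) zero_le_two)
    rw [← integral_add (hGi k) (hSi k), ← integral_const_mul]
    refine integral_mono (integrable_norm_sq_mul_norm_sq_of_memLp hX ((hG k).add (hS k)))
      (((hGi k).add (hSi k)).const_mul 2) fun ω => ?_
    refine le_of_le_of_eq ?_ (congrArg (2 * ·) (mul_add _ _ _))
    rw [mul_left_comm]
    gcongr
    exact (norm_add_pow_le _ _ 2).trans_eq (by norm_num)
  refine (Finset.sum_le_sum fun k _ => hsplit k).trans ?_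
  rw [← Finset.mul_sum, Finset.sum_add_distrib, Finset.sum_add_distrib, ← Finset.sum_mul,
    ← Finset.sum_mul]
  linarith

theorem sum_setIntegral_norm_pow_four_le
    (h : AsyncCentralizedModel P A J wo β2 σs2 σπ2 μbar σμ2 μub) (hJ : CostSystem J wo ν δ)
    (h4 : FourthMomentCond P A J wo β4 σ4) (hB : MeasurableSet[A.past i] B)
    (hX : MemLp (fun ω => A.iter i ω - wo) 4 (P.restrict B)) :
    ∑ k, ∫ ω in B, ‖gradient (J k) (A.iter i ω) + A.noise J i k (A.iter i) ω‖ ^ 4 ∂P ≤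
      8 * ((δ ^ 4 + ∑ k, β4 k) * ∫ ω in B, ‖A.iter i ω - wo‖ ^ 4 ∂P +
        (∑ k, σ4 k) * P.real B) := by
  have hG := fun k => h.memLp_gradient hJ hX k
  have hS := fun k => (h4 i k).1.restrict B
  have hGi := fun k => integrable_norm_pow_four_of_memLp (hG k)
  have hSi := fun k => integrable_norm_pow_four_of_memLp (hS k)
  have hgrad : ∑ k, ∫ ω in B, ‖gradient (J k) (A.iter i ω)‖ ^ 4 ∂P ≤
      δ ^ 4 * ∫ ω in B, ‖A.iter i ω - wo‖ ^ 4 ∂P := by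
    rw [← integral_finsetSum _ fun k _ => hGi k, ← integral_const_mul]
    exact integral_mono (integrable_finsetSum _ fun k _ => hGi k)
      ((integrable_norm_pow_four_of_memLp hX).const_mul _)
      fun ω => hJ.sum_norm_pow_four_gradient_le _
  have hsplit : ∀ k, ∫ ω in B,
        ‖gradient (J k) (A.iter i ω) + A.noise J i k (A.iter i) ω‖ ^ 4 ∂P ≤
      8 * (∫ ω in B, ‖gradient (J k) (A.iter i ω)‖ ^ 4 ∂P +
        (β4 k * ∫ ω in B, ‖A.iter i ω - wo‖ ^ 4 ∂P + σ4 k * P.real B)) := fun k => by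
    refine le_trans ?_ (mul_le_mul_of_nonneg_left (add_le_add_right
      (h.setIntegral_norm_pow_four_noise_le h4 hB hX k) _) (by norm_num))
    rw [← integral_add (hGi k) (hSi k), ← integral_const_mul]
    exact integral_mono (integrable_norm_pow_four_of_memLp ((hG k).add (hS k)))
      (((hGi k).add (hSi k)).const_mul 8) fun ω =>
        (norm_add_pow_le _ _ 4).trans_eq (by norm_num)
  refine (Finset.sum_le_sum fun k _ => hsplit k).trans ?_
  rw [← Finset.mul_sum, Finset.sum_add_distrib, Finset.sum_add_distrib, ← Finset.sum_mul,
    ← Finset.sum_mul]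
  linarith

theorem setIntegral_norm_pow_four_iter_succ_le
    (h : AsyncCentralizedModel P A J wo β2 σs2 σπ2 μbar σμ2 μub) (hJ : CostSystem J wo ν δ)
    (h4 : FourthMomentCond P A J wo β4 σ4) (hB : MeasurableSet[A.past i] B)
    (hX : MemLp (fun ω => A.iter i ω - wo) 4 (P.restrict B)) :
    ∫ ω in B, ‖A.iter (i + 1) ω - wo‖ ^ 4 ∂P ≤
      (1 - 4 * ν * (μbar / N)) * ∫ ω in B, ‖A.iter i ω - wo‖ ^ 4 ∂P + (μbar ^ 2 + σμ2) *
        (16 * ((δ ^ 2 + ∑ k, β2 k) * ∫ ω in B, ‖A.iter i ω - wo‖ ^ 4 ∂P +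
            (∑ k, σs2 k) * ∫ ω in B, ‖A.iter i ω - wo‖ ^ 2 ∂P) +
          24 * μub ^ 2 * ((δ ^ 4 + ∑ k, β4 k) * ∫ ω in B, ‖A.iter i ω - wo‖ ^ 4 ∂P +
            (∑ k, σ4 k) * P.real B)) := by
  have hdrift := h.mul_setIntegral_norm_pow_four_le hJ h4 hB hX
  have hquad := h.sum_setIntegral_norm_sq_mul_norm_sq_le hJ h4 hB hX
  have hquart := h.sum_setIntegral_norm_pow_four_le hJ h4 hB hX
  have hnext := h.memLp_iter_succ_sub hJ Measure.restrict_le_self.absolutelyContinuous hX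
    fun k => (h4 i k).1.restrict B
  have hS := fun k => (h4 i k).1.restrict B
  have hμ := h.step.mean_pos
  have hσ := h.variance_nonneg
  obtain ⟨mG, hmix, hle, hnoise⟩ := h.exists_mixingStep i
  have hiter : Measurable[mG] (A.iter i) := (A.measurable_iter_past i).mono hle le_rfl
  simp only [A.iter_succ_sub J wo i] at hnext ⊢
  refine (hmix.setIntegral_norm_pow_four_sub_smul_sum_le
    (F := fun k ω => gradient (J k) (A.iter i ω) + A.noise J i k (A.iter i) ω)
    (hle _ hB) (hiter.sub_const wo)
    (fun k => ((measurable_gradient (J k)).comp hiter).add (hnoise k _ hiter)) hX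
    (fun k => (h.memLp_gradient hJ hX k).add (hS k)) hnext).trans ?_
  refine (add_le_add (sub_le_sub_left (mul_le_mul_of_nonneg_left
    (mul_le_mul_of_nonneg_left hdrift (by positivity)) zero_le_four) _)
    (mul_le_mul_of_nonneg_left (add_le_add (mul_le_mul_of_nonneg_left hquad (by norm_num))
      (mul_le_mul_of_nonneg_left hquart (by positivity))) (by positivity))).trans_eq ?_
  ring

end AsyncCentralizedModel

theorem eventually_nhdsGT_zero_mul_le (a : ℝ) {b : ℝ} (hb : 0 < b) :
    ∀ᶠ x in 𝓝[>] (0 : ℝ), a * x ≤ b := by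
  have hlim : Tendsto (fun x : ℝ => a * x) (𝓝 0) (𝓝 0) := by
    simpa using (continuous_const_mul a).tendsto 0
  exact ((hlim.eventually_lt_const hb).filter_mono nhdsWithin_le_nhds).mono fun _ => le_of_lt

theorem exists_pos_forall_le_of_eventually_nhdsGT {p : ℝ → Prop} (h : ∀ᶠ x in 𝓝[>] (0 : ℝ), p x) :
    ∃ b > 0, ∀ x, 0 < x → x ≤ b → p x := by
  obtain ⟨b, hb, hsub⟩ := mem_nhdsGT_iff_exists_Ioc_subset.1 h
  exact ⟨b, hb, fun x hx hxb => hsub ⟨hx, hxb⟩⟩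

theorem pow_three_le_add {s t : ℝ} (hs : 0 < s) (ht : 0 ≤ t) :
    t ^ 3 ≤ s * t ^ 2 + s⁻¹ * t ^ 4 := by
  have hsquare : s * t ^ 2 + s⁻¹ * t ^ 4 - t ^ 3 = s⁻¹ * (t * (s - t)) ^ 2 + t ^ 3 := by
    field_simp
    ring
  have : 0 ≤ s⁻¹ * (t * (s - t)) ^ 2 + t ^ 3 := by positivity
  linarith

section Truncation

variable {Ω E : Type*} {m mΩ : MeasurableSpace Ω} {Q : Measure Ω} [NormedAddCommGroup E]
  {X : Ω → E}

theorem exists_measurableSet_memLp_restrict [MeasurableSpace E] [BorelSpace E]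
    [SecondCountableTopology E] [IsFiniteMeasure Q] (hm : m ≤ mΩ) (hX : Measurable[m] X)
    (p : ENNReal) {ε : ℝ} (hε : 0 < ε) :
    ∃ B, MeasurableSet[m] B ∧ MemLp X p (Q.restrict B) ∧ Q.real Bᶜ ≤ ε := by
  have hmeas (n : ℕ) : MeasurableSet[m] {ω | (n : ℝ) < ‖X ω‖} :=
    (measurable_norm.comp hX) measurableSet_Ioi
  have hempty : ⋂ n : ℕ, {ω | (n : ℝ) < ‖X ω‖} = ∅ :=
    Set.eq_empty_of_forall_notMem fun ω hω =>
      let ⟨n, hn⟩ := exists_nat_ge ‖X ω‖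
      hn.not_gt (Set.mem_iInter.1 hω n)
  have hanti : Antitone fun n : ℕ => {ω | (n : ℝ) < ‖X ω‖} :=
    fun i j hij ω (hω : (j : ℝ) < ‖X ω‖) => (Nat.cast_le.2 hij).trans_lt hω
  have hlim : Tendsto (fun n : ℕ => Q.real {ω | (n : ℝ) < ‖X ω‖}) atTop (𝓝 0) := by
    have := tendsto_measure_iInter_atTop (μ := Q)
      (fun n => (hm _ (hmeas n)).nullMeasurableSet) hanti ⟨0, measure_ne_top _ _⟩
    rw [hempty, measure_empty] at this
    exact (ENNReal.tendsto_toReal ENNReal.zero_ne_top).comp this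
  obtain ⟨n, hn⟩ := (hlim.eventually_le_const hε).exists
  refine ⟨_, (hmeas n).compl, MemLp.of_bound (hX.mono hm le_rfl).aestronglyMeasurable n ?_, ?_⟩
  · filter_upwards [ae_restrict_mem (hm _ (hmeas n).compl)] with ω hω using not_lt.1 hω
  · rwa [compl_compl]

theorem abs_integral_le_of_abs_le_norm_pow_three {g : Ω → ℝ} {b s : ℝ} (hb : 0 ≤ b) (hs : 0 < s)
    (h2 : Integrable (fun ω => ‖X ω‖ ^ 2) Q) (h4 : Integrable (fun ω => ‖X ω‖ ^ 4) Q)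
    (hg : ∀ ω, |g ω| ≤ b * ‖X ω‖ ^ 3) :
    |∫ ω, g ω ∂Q| ≤ b * (s * ∫ ω, ‖X ω‖ ^ 2 ∂Q + s⁻¹ * ∫ ω, ‖X ω‖ ^ 4 ∂Q) := by
  have hbound : Integrable (fun ω => b * (s * ‖X ω‖ ^ 2 + s⁻¹ * ‖X ω‖ ^ 4)) Q :=
    ((h2.const_mul s).add (h4.const_mul s⁻¹)).const_mul b
  rw [← integral_const_mul, ← integral_const_mul, ← integral_add (h2.const_mul s)
    (h4.const_mul s⁻¹), ← integral_const_mul]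
  exact norm_integral_le_of_norm_le (f := g) hbound (ae_of_all _ fun ω => (hg ω).trans
    (mul_le_mul_of_nonneg_left (pow_three_le_add hs (norm_nonneg _)) hb))

end Truncation

/-- The smallness conditions on `x = μ_x` under which both the second and the fourth moments of the
error contract. The constant `c` is the one bounding `μ_ub² / μ_x`. -/
structure SmallStep (N : ℕ) (ν δ : ℝ) (β2 σπ2 β4 : Fin N → ℝ) (c x : ℝ) : Prop where
  le_one : x ≤ 1
  mul_le_one : c * x ≤ 1
  mean_square : (δ ^ 2 + betaC2 δ β2 σπ2) * x ≤ N * ν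
  fourth_moment : (16 * (δ ^ 2 + ∑ k, β2 k) + 24 * (δ ^ 4 + ∑ k, β4 k)) * x ≤ 3 * (ν / N)
  contraction : 2 * δ * x ≤ N

theorem eventually_smallStep {N : ℕ} (hN : 0 < N) {ν : ℝ} (hν : 0 < ν) (δ : ℝ)
    (β2 σπ2 β4 : Fin N → ℝ) (c : ℝ) :
    ∀ᶠ x in 𝓝[>] (0 : ℝ), SmallStep N ν δ β2 σπ2 β4 c x := by
  filter_upwards [eventually_nhdsGT_zero_mul_le 1 one_pos, eventually_nhdsGT_zero_mul_le c one_pos,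
    eventually_nhdsGT_zero_mul_le _ (by positivity : 0 < N * ν),
    eventually_nhdsGT_zero_mul_le _ (by positivity : 0 < 3 * (ν / N)),
    eventually_nhdsGT_zero_mul_le (2 * δ) (Nat.cast_pos.2 hN)] with x h1 h2 h3 h4 h5
  exact ⟨(one_mul x).symm.le.trans h1, h2, h3, h4, h5⟩

/-- A run of the asynchronous centralized algorithm with fourth-order moment bounds and a step-size
small enough for the steady-state analysis. -/
structure SmallStepRegime {M N : ℕ} {Ω : Type*} [MeasurableSpace Ω] (P : Measure Ω)
    (A : CentralizedAlgorithm M N Ω) (J : Fin N → Vec M → ℝ) (wo : Vec M) (ν δ : ℝ)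
    (β2 σs2 σπ2 β4 σ4 : Fin N → ℝ) (c μbar σμ2 μub : ℝ) : Prop extends
    AsyncCentralizedModel P A J wo β2 σs2 σπ2 μbar σμ2 μub where
  num_pos : 0 < N
  system : CostSystem J wo ν δ
  β2_nonneg : ∀ k, 0 ≤ β2 k
  σs2_nonneg : ∀ k, 0 ≤ σs2 k
  β4_nonneg : ∀ k, 0 ≤ β4 k
  σ4_nonneg : ∀ k, 0 ≤ σ4 k
  fourth_moment : FourthMomentCond P A J wo β4 σ4
  step_sq_le : μub ^ 2 ≤ c * muX μbar σμ2
  small : SmallStep N ν δ β2 σπ2 β4 c (muX μbar σμ2)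

/-- The constant `K` in the steady-state bound `E ‖w̃‖² ≤ K μ_x`. -/
noncomputable def msCoeff {N : ℕ} (ν : ℝ) (σs2 σπ2 : Fin N → ℝ) : ℝ :=
  sigmaS2 σs2 σπ2 / (N * ν) + 1

/-- The constant `K` in the steady-state bound `E ‖w̃‖⁴ ≤ K μ_x²`. -/
noncomputable def fourthCoeff {N : ℕ} (ν : ℝ) (σs2 σπ2 σ4 : Fin N → ℝ) (c : ℝ) : ℝ :=
  N / ν * (16 * (∑ k, σs2 k) * msCoeff ν σs2 σπ2 + 24 * c * ∑ k, σ4 k) + 1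

theorem fourth_moment_increment_le {a b s q p c u x X Y K η : ℝ} (hb : 0 ≤ b) (hs : 0 ≤ s)
    (hq : 0 ≤ q) (hp : 0 ≤ p) (hp1 : p ≤ 1) (hu : 0 ≤ u) (huc : u ≤ c * x) (hcx : c * x ≤ 1)
    (hx : 0 ≤ x) (hX : X ≤ K * x) (hY : 0 ≤ Y) (hη : (16 * a + 24 * b) * x ≤ 3 * η) :
    x * (16 * (a * Y + s * X) + 24 * u * (b * Y + q * p)) ≤
      3 * η * Y + (16 * s * K + 24 * c * q) * x ^ 2 := by
  have hconst : u * (q * p) ≤ c * x * (q * 1) := by gcongr; exact hu.trans huc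
  calc x * (16 * (a * Y + s * X) + 24 * u * (b * Y + q * p))
      = x * (16 * (a * Y + s * X) + 24 * (u * (b * Y) + u * (q * p))) := by ring
    _ ≤ x * (16 * (a * Y + s * (K * x)) + 24 * (1 * (b * Y) + c * x * (q * 1))) := by
        gcongr
        exact huc.trans hcx
    _ = (16 * a + 24 * b) * x * Y + (16 * s * K + 24 * c * q) * x ^ 2 := by ring
    _ ≤ _ := by gcongr

namespace SmallStepRegime

variable {M N : ℕ} {Ω : Type*} {mΩ : MeasurableSpace Ω} {P : Measure Ω}
  {A : CentralizedAlgorithm M N Ω} {J : Fin N → Vec M → ℝ} {wo : Vec M} {ν δ : ℝ}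
  {β2 σs2 σπ2 β4 σ4 : Fin N → ℝ} {c μbar σμ2 μub : ℝ} {B : Set Ω}

theorem msCoeff_pos (h : SmallStepRegime P A J wo ν δ β2 σs2 σπ2 β4 σ4 c μbar σμ2 μub) :
    0 < msCoeff ν σs2 σπ2 := by
  have hν := h.system.cost.nu_pos
  have hσ := sigmaS2_nonneg h.σs2_nonneg h.fusion_variance_nonneg
  unfold msCoeff
  positivity

variable [IsProbabilityMeasure P]

theorem eventually_mse_le_mul
    (h : SmallStepRegime P A J wo ν δ β2 σs2 σπ2 β4 σ4 c μbar σμ2 μub) :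
    ∀ᶠ n in atTop, mse P A wo n ≤ msCoeff ν σs2 σπ2 * muX μbar σμ2 := by
  rw [msCoeff, add_one_mul]
  exact h.eventually_mse_le h.num_pos h.system h.β2_nonneg h.small.mean_square h.muX_pos

theorem setIntegral_norm_sq_le_mse
    (h : SmallStepRegime P A J wo ν δ β2 σs2 σπ2 β4 σ4 c μbar σμ2 μub) (n : ℕ) (B : Set Ω) :
    ∫ ω in B, ‖A.iter n ω - wo‖ ^ 2 ∂P ≤ mse P A wo n := by
  rw [mse_eq_integral_norm_sq_sub]
  exact setIntegral_le_integral (h.integrable_norm_sq_iter_sub h.system n)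
    (ae_of_all _ fun _ => sq_nonneg _)

theorem eventually_setIntegral_norm_pow_four_le
    (h : SmallStepRegime P A J wo ν δ β2 σs2 σπ2 β4 σ4 c μbar σμ2 μub)
    (hB : MeasurableSet[A.past 0] B)
    (hX : MemLp (fun ω => A.iter 0 ω - wo) 4 (P.restrict B)) :
    ∀ᶠ n in atTop, ∫ ω in B, ‖A.iter n ω - wo‖ ^ 4 ∂P ≤
      fourthCoeff ν σs2 σπ2 σ4 c * muX μbar σμ2 ^ 2 := by
  have hν := h.system.cost.nu_pos
  have hμ := h.step.mean_pos
  have hN := h.num_pos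
  have hx := h.muX_pos
  have hβ4 : 0 ≤ δ ^ 4 + ∑ k, β4 k :=
    add_nonneg (by positivity) (Finset.sum_nonneg fun k _ => h.β4_nonneg k)
  have hσs2 : 0 ≤ ∑ k, σs2 k := Finset.sum_nonneg fun k _ => h.σs2_nonneg k
  have hσ4 : 0 ≤ ∑ k, σ4 k := Finset.sum_nonneg fun k _ => h.σ4_nonneg k
  rw [fourthCoeff, add_one_mul]
  refine eventually_le_of_contraction (ρ := ν * μbar / N) (by positivity)
    (mul_div_le_one hN hν h.system.cost.nu_le h.β2_nonneg h.fusion_variance_nonneg hμ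
      h.variance_nonneg h.small.mean_square) (by positivity) ?_
  filter_upwards [h.eventually_mse_le_mul] with n hmse
  have hstep := h.setIntegral_norm_pow_four_iter_succ_le h.system h.fourth_moment
    (CentralizedAlgorithm.past_mono (Nat.zero_le n) _ hB)
    (h.memLp_four_iter_sub h.system h.fourth_moment hX n)
  have hincr := fourth_moment_increment_le hβ4 hσs2 hσ4 measureReal_nonneg measureReal_le_one
    (sq_nonneg μub) h.step_sq_le h.small.mul_le_one hx.le
    ((h.setIntegral_norm_sq_le_mse n B).trans hmse) (integral_nonneg fun ω => by positivity)
    h.small.fourth_moment (p := P.real B) (Y := ∫ ω in B, ‖A.iter n ω - wo‖ ^ 4 ∂P)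
  refine hstep.trans ?_
  rw [← mul_muX hμ.ne', mul_assoc μbar]
  refine (add_le_add_right (mul_le_mul_of_nonneg_left hincr hμ.le) _).trans_eq ?_
  field_simp
  ring

theorem eventually_abs_integral_le_mul_sqrt
    (h : SmallStepRegime P A J wo ν δ β2 σs2 σπ2 β4 σ4 c μbar σμ2 μub) {a b : ℝ} (ha : 0 ≤ a)
    (hb : 0 ≤ b) {f : Vec M → ℝ} (hf : Measurable f) (hquad : ∀ w, |f w| ≤ a * ‖w - wo‖ ^ 2)
    (hcubic : ∀ w, |f w| ≤ b * ‖w - wo‖ ^ 3) :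
    ∀ᶠ n in atTop, |∫ ω, f (A.iter n ω) ∂P| ≤
      (b * (msCoeff ν σs2 σπ2 + fourthCoeff ν σs2 σπ2 σ4 c) + a * msCoeff ν σs2 σπ2) *
        (muX μbar σμ2 * √(muX μbar σμ2)) := by
  have hx := h.muX_pos
  set x := muX μbar σμ2
  have hs : 0 < √x := Real.sqrt_pos.2 hx
  have hν := h.system.cost.nu_pos
  have hσ := sigmaS2_nonneg h.σs2_nonneg h.fusion_variance_nonneg
  obtain ⟨B, hB, hX, hPB⟩ := exists_measurableSet_memLp_restrict (Q := P) (h.past_le 0)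
    ((CentralizedAlgorithm.measurable_iter_past (A := A) 0).sub_const wo) 4 hs
  filter_upwards [h.eventually_mse_le_mul, h.eventually_setIntegral_norm_pow_four_le hB hX,
    h.eventually_setIntegral_norm_sq_le h.num_pos h.system h.β2_nonneg h.small.mean_square
      hB.compl (mul_pos hx hs)] with n hmse h4 hcompl
  have hX2 := h.integrable_norm_sq_iter_sub h.system n
  have hX4 := integrable_norm_pow_four_of_memLp
    (h.memLp_four_iter_sub h.system h.fourth_moment hX n)
  have hfi : Integrable (fun ω => f (A.iter n ω)) P :=
    (hX2.const_mul a).mono' (hf.comp (h.measurable_iter n)).aestronglyMeasurable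
      (ae_of_all _ fun ω => hquad _)
  have hBc : ∫ ω in Bᶜ, ‖A.iter n ω - wo‖ ^ 2 ∂P ≤ msCoeff ν σs2 σπ2 * (x * √x) := by
    calc _ ≤ sigmaS2 σs2 σπ2 / (N * ν) * x * √x + x * √x := hcompl.trans (by gcongr)
      _ = _ := by rw [msCoeff]; ring
  rw [← integral_add_compl (h.past_le 0 _ hB) hfi]
  calc _ ≤ b * (√x * ∫ ω in B, ‖A.iter n ω - wo‖ ^ 2 ∂P +
          (√x)⁻¹ * ∫ ω in B, ‖A.iter n ω - wo‖ ^ 4 ∂P) +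
          a * ∫ ω in Bᶜ, ‖A.iter n ω - wo‖ ^ 2 ∂P := by
        refine (abs_add_le _ _).trans (add_le_add ?_ ?_)
        · exact abs_integral_le_of_abs_le_norm_pow_three hb hs hX2.integrableOn hX4
            fun ω => hcubic _
        · rw [← integral_const_mul]
          exact norm_integral_le_of_norm_le (f := fun ω => f (A.iter n ω))
            (hX2.integrableOn.const_mul a) (ae_of_all _ fun ω => hquad _)
    _ ≤ b * (√x * (msCoeff ν σs2 σπ2 * x) + (√x)⁻¹ * (fourthCoeff ν σs2 σπ2 σ4 c * x ^ 2)) +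
          a * (msCoeff ν σs2 σπ2 * (x * √x)) := by
        gcongr
        exact (h.setIntegral_norm_sq_le_mse n B).trans hmse
    _ = _ := by
        have hinv : (√x)⁻¹ * x ^ 2 = x * √x := by
          field_simp
          rw [Real.sq_sqrt hx.le]
        rw [mul_left_comm (√x)⁻¹, hinv]
        ring

end SmallStepRegime

theorem rpow_le_add_sq {t κ : ℝ} (ht : 0 ≤ t) (h1 : 1 ≤ κ) (h2 : κ ≤ 2) :
    t ^ κ ≤ t + t ^ 2 := by
  rcases le_total t 1 with hle | hge
  · calc t ^ κ ≤ t ^ (1 : ℝ) := Real.rpow_le_rpow_of_exponent_ge' ht hle zero_le_one h1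
      _ ≤ t + t ^ 2 := by rw [Real.rpow_one]; linarith [sq_nonneg t]
  · calc t ^ κ ≤ t ^ (2 : ℝ) := Real.rpow_le_rpow_of_exponent_le hge h2
      _ ≤ t + t ^ 2 := by rw [Real.rpow_two]; linarith

theorem le_add_inv_mul_sq {s t : ℝ} (hs : 0 < s) (ht : 0 ≤ t) : t ≤ s + s⁻¹ * t ^ 2 := by
  have hsquare : s + s⁻¹ * t ^ 2 - t = s⁻¹ * (s - t) ^ 2 + t := by
    field_simp
    ring
  have : 0 ≤ s⁻¹ * (s - t) ^ 2 + t := by positivity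
  linarith

theorem inner_sq_le_norm_sq {E : Type*} [NormedAddCommGroup E] [InnerProductSpace ℝ E] {u : E}
    (hu : ‖u‖ = 1) (x : E) : ⟪u, x⟫ ^ 2 ≤ ‖x‖ ^ 2 :=
  sq_le_sq.2 (by simpa [hu] using abs_real_inner_le_norm u x)

section Matrix

variable {M : ℕ} (B C : Matrix (Fin M) (Fin M) ℝ) (u : Vec M)

theorem inner_toEuclideanCLM_eq_sum :
    ⟪u, Matrix.toEuclideanCLM (n := Fin M) (𝕜 := ℝ) B u⟫ = ∑ a, ∑ b, u a * u b * B a b := by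
  rw [Matrix.inner_toEuclideanCLM]
  simp only [dotProduct, Matrix.mulVec, Finset.mul_sum]
  exact Finset.sum_congr rfl fun a _ => Finset.sum_congr rfl fun b _ => by ring

theorem abs_inner_toEuclideanCLM_sub_le :
    |⟪u, Matrix.toEuclideanCLM (n := Fin M) (𝕜 := ℝ) B u⟫ -
      ⟪u, Matrix.toEuclideanCLM (n := Fin M) (𝕜 := ℝ) C u⟫| ≤ specNorm (B - C) * ‖u‖ ^ 2 := by
  rw [← inner_sub_right, ← sub_apply, ← map_sub]
  calc _ ≤ ‖u‖ * ‖Matrix.toEuclideanCLM (n := Fin M) (𝕜 := ℝ) (B - C) u‖ :=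
        abs_real_inner_le_norm _ _
    _ ≤ ‖u‖ * (specNorm (B - C) * ‖u‖) := by
        gcongr
        exact ContinuousLinearMap.le_opNorm _ _
    _ = _ := by ring

end Matrix

section CondExp

variable {M : ℕ} {Ω : Type*} {m mΩ : MeasurableSpace Ω} {P : Measure Ω}

theorem condExp_inner_sq {x : Ω → Vec M} (hx : MemLp x 2 P) (u : Vec M) :
    P[fun ω => ⟪u, x ω⟫ ^ 2 | m] =ᵐ[P] fun ω =>
      ⟪u, Matrix.toEuclideanCLM (n := Fin M) (𝕜 := ℝ) (condCross P m x x ω) u⟫ := by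
  have hcoord : ∀ a, MemLp (fun ω => x ω a) 2 P := fun a =>
    (EuclideanSpace.proj a : Vec M →L[ℝ] ℝ).comp_memLp' hx
  have hexpand : (fun ω => ⟪u, x ω⟫ ^ 2) =
      ∑ p : Fin M × Fin M, (u p.1 * u p.2) • fun ω => x ω p.1 * x ω p.2 := by
    ext ω
    simp only [PiLp.inner_apply, RCLike.inner_apply, conj_trivial, pow_two, Finset.sum_mul_sum,
      Finset.sum_apply, Pi.smul_apply, smul_eq_mul, Fintype.sum_prod_type]
    exact Finset.sum_congr rfl fun a _ => Finset.sum_congr rfl fun b _ => by ring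
  have hsum := condExp_finsetSum (μ := P) (s := Finset.univ)
    (f := fun p : Fin M × Fin M => (u p.1 * u p.2) • fun ω => x ω p.1 * x ω p.2)
    (fun p _ => ((hcoord p.1).integrable_mul (hcoord p.2)).smul _) m
  have hsmul : ∀ᵐ ω ∂P, ∀ p : Fin M × Fin M,
      (P[(u p.1 * u p.2) • fun ω => x ω p.1 * x ω p.2 | m]) ω =
        (u p.1 * u p.2) * (P[fun ω => x ω p.1 * x ω p.2 | m]) ω :=
    ae_all_iff.2 fun p => condExp_smul (u p.1 * u p.2) (fun ω => x ω p.1 * x ω p.2) m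
  rw [hexpand]
  filter_upwards [hsum, hsmul] with ω hω hωp
  rw [hω, inner_toEuclideanCLM_eq_sum, Finset.sum_apply, Fintype.sum_prod_type]
  exact Finset.sum_congr rfl fun a _ => Finset.sum_congr rfl fun b _ => hωp (a, b)

theorem condExp_ae_eq_restrict_of_eqOn (hm : m ≤ mΩ) {f g : Ω → ℝ} {B : Set Ω}
    (hB : MeasurableSet[m] B) (hf : Integrable f P) (hg : Integrable g P) (hfg : Set.EqOn f g B) :
    P[f | m] =ᵐ[P.restrict B] P[g | m] := by
  have hzero : f - g =ᵐ[P.restrict B] 0 :=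
    (ae_restrict_iff' (hm _ hB)).2 (ae_of_all _ fun ω hω => sub_eq_zero.2 (hfg hω))
  filter_upwards [condExp_ae_eq_restrict_zero hB hzero, ae_restrict_of_ae (condExp_sub hf hg m)]
    with ω hω hsub
  exact sub_eq_zero.1 (hsub.symm.trans hω)

theorem tendsto_setIntegral_zero_of_ae_tendsto_zero [IsFiniteMeasure P] {f : ℕ → Ω → ℝ}
    {B : ℕ → Set Ω} {C : ℝ} (hB : ∀ n, MeasurableSet (B n))
    (hf : ∀ n, AEStronglyMeasurable (f n) P) (hC : ∀ n, ∀ᵐ ω ∂P.restrict (B n), |f n ω| ≤ C)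
    (hlim : ∀ᵐ ω ∂P, Tendsto (fun n => f n ω) atTop (𝓝 0)) :
    Tendsto (fun n => ∫ ω in B n, f n ω ∂P) atTop (𝓝 0) := by
  simp only [← integral_indicator (hB _)]
  rw [← integral_zero Ω ℝ (μ := P)]
  refine tendsto_integral_of_dominated_convergence (fun _ => |C|)
    (fun n => (hf n).indicator (hB n)) (integrable_const _) (fun n => ?_) ?_
  · filter_upwards [(ae_restrict_iff' (hB n)).1 (hC n)] with ω hω
    by_cases hωB : ω ∈ B n
    · rw [Set.indicator_of_mem hωB]
      exact (hω hωB).trans (le_abs_self C)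
    · rw [Set.indicator_of_notMem hωB, norm_zero]
      exact abs_nonneg C
  · filter_upwards [hlim] with ω hω
    exact squeeze_zero_norm (fun n => norm_indicator_le_norm_self _ _) (by simpa using hω.norm)

end CondExp

namespace CentralizedAlgorithm

variable {M N : ℕ} {Ω : Type*}

/-- The event that `w_{n-1}` lies in the closed ball of radius `r` around `wo`, on which the local
conditions on the costs and on the noise covariances apply. -/
def nearEvent (A : CentralizedAlgorithm M N Ω) (wo : Vec M) (r : ℝ) (n : ℕ) : Set Ω :=
  {ω | ‖A.iter n ω - wo‖ ≤ r}

theorem measurableSet_nearEvent (A : CentralizedAlgorithm M N Ω) (wo : Vec M) (r : ℝ) (n : ℕ) :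
    MeasurableSet[A.past n] (A.nearEvent wo r n) :=
  (measurable_norm.comp ((A.measurable_iter_past n).sub_const wo)) measurableSet_Iic

/-- The conditional variance `E[⟨u, s_{k,n}(v)⟩² | F_{n-1}]` of the gradient noise at `v` in the
direction `u`. -/
noncomputable def condNoiseVar [MeasurableSpace Ω] (A : CentralizedAlgorithm M N Ω)
    (P : Measure Ω) (J : Fin N → Vec M → ℝ) (u : Vec M) (n : ℕ) (k : Fin N) (v : Ω → Vec M) :
    Ω → ℝ :=
  P[fun ω => ⟪u, A.noise J n k v ω⟫ ^ 2 | A.past n]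

end CentralizedAlgorithm

theorem CovarianceLimit.tendsto_condNoiseVar {M N : ℕ} {Ω : Type*} [MeasurableSpace Ω]
    {P : Measure Ω} {A : CentralizedAlgorithm M N Ω} {J : Fin N → Vec M → ℝ} {wo : Vec M}
    {Rs : Fin N → Matrix (Fin M) (Fin M) ℝ} (hL : CovarianceLimit P A J wo Rs) (u : Vec M)
    (k : Fin N) :
    ∀ᵐ ω ∂P, Tendsto (fun n => A.condNoiseVar P J u n k (fun _ => wo) ω) atTop
      (𝓝 ⟪u, Matrix.toEuclideanCLM (n := Fin M) (𝕜 := ℝ) (Rs k) u⟫) := by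
  filter_upwards [(hL k).2, ae_all_iff.2 fun n => condExp_inner_sq (m := A.past n) ((hL k).1 n) u]
    with ω hω hquad
  simp only [CentralizedAlgorithm.condNoiseVar, hquad, inner_toEuclideanCLM_eq_sum]
  exact tendsto_finsetSum _ fun a _ => tendsto_finsetSum _ fun b _ => (hω a b).const_mul _

namespace AsyncCentralizedModel

variable {M N : ℕ} {Ω : Type*} {mΩ : MeasurableSpace Ω} {P : Measure Ω}
  {A : CentralizedAlgorithm M N Ω} {J : Fin N → Vec M → ℝ} {wo u : Vec M}
  {β2 σs2 σπ2 : Fin N → ℝ} {μbar σμ2 μub ν δ τ₂ κ r ρ s : ℝ}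

theorem abs_condNoiseVar_sub_le (h : AsyncCentralizedModel P A J wo β2 σs2 σπ2 μbar σμ2 μub)
    (hτ₂ : 0 ≤ τ₂) (h1κ : 1 ≤ κ) (hκ2 : κ ≤ 2) (hr : 0 ≤ r) (hS : CovarianceSmooth P A J wo τ₂ κ r)
    (hu : ‖u‖ = 1) (n : ℕ) (k : Fin N) :
    ∀ᵐ ω ∂P.restrict (A.nearEvent wo r n),
      |A.condNoiseVar P J u n k (A.iter n) ω - A.condNoiseVar P J u n k (fun _ => wo) ω| ≤
        τ₂ * (‖A.iter n ω - wo‖ + ‖A.iter n ω - wo‖ ^ 2) := by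
  classical
  set B := A.nearEvent wo r n
  have hB : MeasurableSet[A.past n] B := A.measurableSet_nearEvent wo r n
  -- `CovarianceSmooth` speaks of points that stay in the ball surely, hence the cut-off at `wo`.
  set v : Ω → Vec M := B.piecewise (A.iter n) fun _ => wo
  have hvB : ∀ ω ∈ B, v ω = A.iter n ω := fun ω hω => Set.piecewise_eq_of_mem _ _ _ hω
  have hvm : Measurable[A.past n] v :=
    Measurable.piecewise hB (A.measurable_iter_past n) measurable_const
  have hvr : ∀ ω, ‖v ω - wo‖ ≤ r := fun ω => by
    by_cases hω : ω ∈ B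
    · rw [hvB ω hω]
      exact hω
    · simpa only [v, Set.piecewise_eq_of_notMem _ _ _ hω, sub_self, norm_zero] using hr
  obtain ⟨hv2, hsmooth⟩ := hS n k v hvm hvr
  have hwo2 := (hS n k (fun _ => wo) measurable_const fun _ => by simpa using hr).1
  have hlocal := condExp_ae_eq_restrict_of_eqOn (P := P) (h.past_le n) hB
    (((h.noise.memLp n k).const_inner u).integrable_sq) (hv2.const_inner u).integrable_sq
    fun ω hω => by simp only [CentralizedAlgorithm.noise, hvB ω hω]
  filter_upwards [hlocal, ae_restrict_mem (h.past_le n _ hB),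
    ae_restrict_of_ae (condExp_inner_sq (m := A.past n) hv2 u),
    ae_restrict_of_ae (condExp_inner_sq (m := A.past n) hwo2 u), ae_restrict_of_ae hsmooth]
    with ω hiter hω hvquad hwoquad hle
  rw [hvB ω hω] at hle
  rw [CentralizedAlgorithm.condNoiseVar, CentralizedAlgorithm.condNoiseVar, hiter, hvquad, hwoquad]
  refine (abs_inner_toEuclideanCLM_sub_le _ _ u).trans ?_
  rw [hu, one_pow, mul_one]
  exact hle.trans (mul_le_mul_of_nonneg_left (rpow_le_add_sq (norm_nonneg _) h1κ hκ2) hτ₂)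

theorem abs_condNoiseVar_minimizer_le
    (h : AsyncCentralizedModel P A J wo β2 σs2 σπ2 μbar σμ2 μub) (hβ2 : ∀ k, 0 ≤ β2 k)
    (hτ₂ : 0 ≤ τ₂) (h1κ : 1 ≤ κ) (hκ2 : κ ≤ 2) (hr : 0 ≤ r) (hS : CovarianceSmooth P A J wo τ₂ κ r)
    (hu : ‖u‖ = 1) (n : ℕ) (k : Fin N) :
    ∀ᵐ ω ∂P.restrict (A.nearEvent wo r n), |A.condNoiseVar P J u n k (fun _ => wo) ω| ≤
      β2 k * r ^ 2 + σs2 k + τ₂ * (r + r ^ 2) := by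
  have hmono : A.condNoiseVar P J u n k (A.iter n) ≤ᵐ[P]
      P[fun ω => ‖A.noise J n k (A.iter n) ω‖ ^ 2 | A.past n] :=
    condExp_mono ((h.noise.memLp n k).const_inner u).integrable_sq
      (h.noise.memLp n k).norm.integrable_sq (ae_of_all _ fun ω => inner_sq_le_norm_sq hu _)
  have hnonneg : 0 ≤ᵐ[P] A.condNoiseVar P J u n k fun _ => wo :=
    condExp_nonneg (ae_of_all _ fun ω => sq_nonneg _)
  filter_upwards [h.abs_condNoiseVar_sub_le hτ₂ h1κ hκ2 hr hS hu n k,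
    ae_restrict_mem (h.past_le n _ (A.measurableSet_nearEvent wo r n)), ae_restrict_of_ae hmono,
    ae_restrict_of_ae (h.noise.var_le n k), ae_restrict_of_ae hnonneg]
    with ω hsub hω hle hvar hpos
  have hω : ‖A.iter n ω - wo‖ ≤ r := hω
  rw [norm_sub_rev wo] at hvar
  rw [abs_of_nonneg hpos]
  calc _ ≤ A.condNoiseVar P J u n k (A.iter n) ω +
          τ₂ * (‖A.iter n ω - wo‖ + ‖A.iter n ω - wo‖ ^ 2) := by linarith [(abs_le.1 hsub).1]
    _ ≤ β2 k * ‖A.iter n ω - wo‖ ^ 2 + σs2 k +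
          τ₂ * (‖A.iter n ω - wo‖ + ‖A.iter n ω - wo‖ ^ 2) := by gcongr; exact hle.trans hvar
    _ ≤ _ := by
        have := hβ2 k
        gcongr

variable [IsProbabilityMeasure P]

theorem tendsto_setIntegral_condNoiseVar_sub
    (h : AsyncCentralizedModel P A J wo β2 σs2 σπ2 μbar σμ2 μub) (hβ2 : ∀ k, 0 ≤ β2 k)
    (hτ₂ : 0 ≤ τ₂) (h1κ : 1 ≤ κ) (hκ2 : κ ≤ 2) (hr : 0 ≤ r) (hS : CovarianceSmooth P A J wo τ₂ κ r)
    (hu : ‖u‖ = 1) {k : Fin N}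
    (hρ : ∀ᵐ ω ∂P, Tendsto (fun n => A.condNoiseVar P J u n k (fun _ => wo) ω) atTop (𝓝 ρ)) :
    Tendsto (fun n => ∫ ω in A.nearEvent wo r n,
      A.condNoiseVar P J u n k (fun _ => wo) ω - ρ ∂P) atTop (𝓝 0) := by
  refine tendsto_setIntegral_zero_of_ae_tendsto_zero
    (C := β2 k * r ^ 2 + σs2 k + τ₂ * (r + r ^ 2) + |ρ|)
    (fun n => h.past_le n _ (A.measurableSet_nearEvent wo r n))
    (fun n => (integrable_condExp.sub (integrable_const ρ)).aestronglyMeasurable) (fun n => ?_) ?_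
  · filter_upwards [h.abs_condNoiseVar_minimizer_le hβ2 hτ₂ h1κ hκ2 hr hS hu n k] with ω hω
    exact (abs_sub _ _).trans (add_le_add_left hω _)
  · filter_upwards [hρ] with ω hω
    simpa using hω.sub_const ρ

theorem measureReal_compl_nearEvent_le
    (h : AsyncCentralizedModel P A J wo β2 σs2 σπ2 μbar σμ2 μub) (hJ : CostSystem J wo ν δ)
    (hr : 0 < r) (n : ℕ) : P.real (A.nearEvent wo r n)ᶜ ≤ mse P A wo n / r ^ 2 := by
  rw [le_div_iff₀' (by positivity), mse_eq_integral_norm_sq_sub]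
  calc _ ≤ r ^ 2 * P.real {ω | r ^ 2 ≤ ‖A.iter n ω - wo‖ ^ 2} := by
        refine mul_le_mul_of_nonneg_left (measureReal_mono fun ω hω => ?_) (sq_nonneg r)
        have hω : ¬‖A.iter n ω - wo‖ ≤ r := hω
        exact pow_le_pow_left₀ hr.le (not_le.1 hω).le 2
    _ ≤ _ := mul_meas_ge_le_integral_of_nonneg (ae_of_all _ fun ω => sq_nonneg _)
        (h.integrable_norm_sq_iter_sub hJ n) _

theorem abs_setIntegral_nearEvent_sub_le
    (h : AsyncCentralizedModel P A J wo β2 σs2 σπ2 μbar σμ2 μub) (hJ : CostSystem J wo ν δ)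
    (hτ₂ : 0 ≤ τ₂) (h1κ : 1 ≤ κ) (hκ2 : κ ≤ 2) (hr : 0 ≤ r) (hS : CovarianceSmooth P A J wo τ₂ κ r)
    (hu : ‖u‖ = 1) (hs : 0 < s) (n : ℕ) (k : Fin N) :
    |∫ ω in A.nearEvent wo r n, ⟪u, A.noise J n k (A.iter n) ω⟫ ^ 2 ∂P -
        ∫ ω in A.nearEvent wo r n, A.condNoiseVar P J u n k (fun _ => wo) ω ∂P| ≤
      τ₂ * (s + (s⁻¹ + 1) * mse P A wo n) := by
  have hB := A.measurableSet_nearEvent wo r n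
  have hX2 := h.integrable_norm_sq_iter_sub hJ n
  have hbound : Integrable (fun ω => s + (s⁻¹ + 1) * ‖A.iter n ω - wo‖ ^ 2) P :=
    (integrable_const s).add (hX2.const_mul _)
  have hV : Integrable (A.condNoiseVar P J u n k fun _ => wo) P := integrable_condExp
  rw [← setIntegral_condExp (h.past_le n) ((h.noise.memLp n k).const_inner u).integrable_sq hB,
    ← integral_sub integrable_condExp.integrableOn hV.integrableOn]
  calc _ ≤ ∫ ω in A.nearEvent wo r n, τ₂ * (s + (s⁻¹ + 1) * ‖A.iter n ω - wo‖ ^ 2) ∂P := by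
        refine norm_integral_le_of_norm_le (f := fun ω => A.condNoiseVar P J u n k (A.iter n) ω -
          A.condNoiseVar P J u n k (fun _ => wo) ω) (hbound.const_mul τ₂).integrableOn ?_
        filter_upwards [h.abs_condNoiseVar_sub_le hτ₂ h1κ hκ2 hr hS hu n k] with ω hω
        refine hω.trans (mul_le_mul_of_nonneg_left ?_ hτ₂)
        linarith [le_add_inv_mul_sq hs (norm_nonneg (A.iter n ω - wo))]
    _ ≤ ∫ ω, τ₂ * (s + (s⁻¹ + 1) * ‖A.iter n ω - wo‖ ^ 2) ∂P :=
        setIntegral_le_integral (hbound.const_mul τ₂) (ae_of_all _ fun ω => by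
          simp only [Pi.zero_apply]; positivity)
    _ = _ := by
        rw [integral_const_mul, integral_add (integrable_const s) (hX2.const_mul _),
          integral_const_mul, ← mse_eq_integral_norm_sq_sub, integral_const]
        simp

theorem abs_setIntegral_compl_nearEvent_le
    (h : AsyncCentralizedModel P A J wo β2 σs2 σπ2 μbar σμ2 μub) (hJ : CostSystem J wo ν δ)
    (hβ2 : ∀ k, 0 ≤ β2 k) (hσs2 : ∀ k, 0 ≤ σs2 k) (hr : 0 < r) (hu : ‖u‖ = 1) (ρ : ℝ) (n : ℕ)
    (k : Fin N) :
    |∫ ω in (A.nearEvent wo r n)ᶜ, ⟪u, A.noise J n k (A.iter n) ω⟫ ^ 2 - ρ ∂P| ≤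
      (β2 k + σs2 k / r ^ 2 + |ρ| / r ^ 2) * mse P A wo n := by
  set B := A.nearEvent wo r n
  have hB : MeasurableSet[A.past n] Bᶜ := (A.measurableSet_nearEvent wo r n).compl
  have hs2 : IntegrableOn (fun ω => ‖A.noise J n k (A.iter n) ω‖ ^ 2) Bᶜ P :=
    (h.noise.memLp n k).norm.integrable_sq.integrableOn
  have hPB : P.real Bᶜ ≤ mse P A wo n / r ^ 2 := h.measureReal_compl_nearEvent_le hJ hr n
  have hmse : ∫ ω in Bᶜ, ‖A.iter n ω - wo‖ ^ 2 ∂P ≤ mse P A wo n := by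
    rw [mse_eq_integral_norm_sq_sub]
    exact setIntegral_le_integral (h.integrable_norm_sq_iter_sub hJ n)
      (ae_of_all _ fun ω => sq_nonneg _)
  have := hβ2 k
  have := hσs2 k
  calc _ ≤ ∫ ω in Bᶜ, ‖A.noise J n k (A.iter n) ω‖ ^ 2 + |ρ| ∂P := by
        refine norm_integral_le_of_norm_le (f := fun ω => ⟪u, A.noise J n k (A.iter n) ω⟫ ^ 2 - ρ)
          (hs2.add (integrable_const _)) (ae_of_all _ fun ω => ?_)
        refine (abs_sub _ _).trans (add_le_add_left ?_ _)
        rw [abs_of_nonneg (sq_nonneg _)]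
        exact inner_sq_le_norm_sq hu _
    _ = ∫ ω in Bᶜ, ‖A.noise J n k (A.iter n) ω‖ ^ 2 ∂P + |ρ| * P.real Bᶜ := by
        rw [integral_add hs2 (integrable_const _), setIntegral_const, smul_eq_mul, mul_comm |ρ|]
    _ ≤ β2 k * mse P A wo n + σs2 k * (mse P A wo n / r ^ 2) +
          |ρ| * (mse P A wo n / r ^ 2) := by
        gcongr
        refine (h.setIntegral_norm_sq_noise_le hJ hB k).trans ?_
        gcongr
    _ = _ := by ring

end AsyncCentralizedModel

/-- The constant `K` in the steady-state bound `|E ⟨u, s_k⟩² - ρ| ≤ K μ_x^{1/2}`, where `ρ` is the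
limiting noise variance in the direction `u` and `m` the coefficient of the bound
`E ‖w̃‖² ≤ m μ_x`. -/
noncomputable def noiseVarCoeff (τ₂ r β σ ρ m : ℝ) : ℝ :=
  τ₂ * (1 + 2 * m) + 1 + (β + σ / r ^ 2 + |ρ| / r ^ 2) * m

theorem noiseVarCoeff_bound {τ₂ r β σ ρ m x e : ℝ} (hτ₂ : 0 ≤ τ₂) (hβ : 0 ≤ β) (hσ : 0 ≤ σ)
    (hm : 0 ≤ m) (hx : 0 < x) (hx1 : x ≤ 1) (he : e ≤ m * x) :
    τ₂ * (√x + ((√x)⁻¹ + 1) * e) + √x + (β + σ / r ^ 2 + |ρ| / r ^ 2) * e ≤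
      noiseVarCoeff τ₂ r β σ ρ m * √x := by
  have hs : 0 < √x := Real.sqrt_pos.2 hx
  have hxs : x ≤ √x := Real.le_sqrt_of_sq_le (by nlinarith)
  have hems : e ≤ m * √x := he.trans (by gcongr)
  have hinv : (√x)⁻¹ * e ≤ m * √x := by
    rw [inv_mul_le_iff₀ hs]
    refine he.trans_eq ?_
    rw [mul_left_comm, Real.mul_self_sqrt hx.le]
  calc _ ≤ τ₂ * (√x + (m * √x + m * √x)) + √x + (β + σ / r ^ 2 + |ρ| / r ^ 2) * (m * √x) := by
        rw [add_mul, one_mul]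
        gcongr
    _ = _ := by rw [noiseVarCoeff]; ring

namespace SmallStepRegime

variable {M N : ℕ} {Ω : Type*} {mΩ : MeasurableSpace Ω} {P : Measure Ω} [IsProbabilityMeasure P]
  {A : CentralizedAlgorithm M N Ω} {J : Fin N → Vec M → ℝ} {wo u : Vec M} {ν δ : ℝ}
  {β2 σs2 σπ2 β4 σ4 : Fin N → ℝ} {c μbar σμ2 μub τ₂ κ r ρ : ℝ}

theorem eventually_abs_integral_inner_noise_sq_sub_le
    (h : SmallStepRegime P A J wo ν δ β2 σs2 σπ2 β4 σ4 c μbar σμ2 μub)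
    (hτ₂ : 0 ≤ τ₂) (h1κ : 1 ≤ κ) (hκ2 : κ ≤ 2) (hr : 0 < r) (hS : CovarianceSmooth P A J wo τ₂ κ r)
    (hu : ‖u‖ = 1) {k : Fin N}
    (hρ : ∀ᵐ ω ∂P, Tendsto (fun n => A.condNoiseVar P J u n k (fun _ => wo) ω) atTop (𝓝 ρ)) :
    ∀ᶠ n in atTop, |∫ ω, ⟪u, A.noise J n k (A.iter n) ω⟫ ^ 2 ∂P - ρ| ≤
      noiseVarCoeff τ₂ r (β2 k) (σs2 k) ρ (msCoeff ν σs2 σπ2) * √(muX μbar σμ2) := by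
  have hs : 0 < √(muX μbar σμ2) := Real.sqrt_pos.2 h.muX_pos
  have hlim := (h.tendsto_setIntegral_condNoiseVar_sub h.β2_nonneg hτ₂ h1κ hκ2 hr.le hS hu hρ).abs
  rw [abs_zero] at hlim
  filter_upwards [h.eventually_mse_le_mul, hlim.eventually_le_const hs] with n hmse hVρ
  set B := A.nearEvent wo r n
  set V := A.condNoiseVar P J u n k fun _ => wo
  have hf : Integrable (fun ω => ⟪u, A.noise J n k (A.iter n) ω⟫ ^ 2) P :=
    ((h.noise.memLp n k).const_inner u).integrable_sq
  have hV : Integrable V P := integrable_condExp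
  have hsplit : ∫ ω, ⟪u, A.noise J n k (A.iter n) ω⟫ ^ 2 ∂P - ρ =
      (∫ ω in B, ⟪u, A.noise J n k (A.iter n) ω⟫ ^ 2 ∂P - ∫ ω in B, V ω ∂P) +
        ∫ ω in B, (V ω - ρ) ∂P + ∫ ω in Bᶜ, (⟪u, A.noise J n k (A.iter n) ω⟫ ^ 2 - ρ) ∂P := by
    have hρi : Integrable (fun _ => ρ) P := integrable_const ρ
    have hcompl := integral_add_compl (h.past_le n _ (A.measurableSet_nearEvent wo r n))
      (hf.sub hρi)
    simp only [Pi.sub_apply] at hcompl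
    rw [integral_sub hV.integrableOn hρi.integrableOn, sub_add_sub_cancel,
      ← integral_sub hf.integrableOn hρi.integrableOn, hcompl, integral_sub hf hρi,
      integral_const, probReal_univ, one_smul]
  rw [hsplit]
  refine (abs_add_three _ _ _).trans <| (add_le_add_three
    (h.abs_setIntegral_nearEvent_sub_le h.system hτ₂ h1κ hκ2 hr.le hS hu hs n k) hVρ
    (h.abs_setIntegral_compl_nearEvent_le h.system h.β2_nonneg h.σs2_nonneg hr hu ρ n k)).trans ?_
  exact noiseVarCoeff_bound hτ₂ (h.β2_nonneg k) (h.σs2_nonneg k) h.msCoeff_pos.le h.muX_pos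
    h.small.le_one hmse

end SmallStepRegime

theorem abs_affine_step_sub_le {g l p e d t ρ : ℝ} (hg : 0 ≤ g) (hρ : ρ ≤ g * l) (hl : g * l ≤ 1) :
    |p - g * (l * p + e) + d - t| ≤ (1 - ρ) * |p - t| + (|d - g * l * t| + g * |e|) := by
  calc |p - g * (l * p + e) + d - t| = |(1 - g * l) * (p - t) + (d - g * l * t) + -(g * e)| := by
        congr 1
        ring
    _ ≤ |(1 - g * l) * (p - t)| + |d - g * l * t| + |-(g * e)| := abs_add_three _ _ _
    _ = (1 - g * l) * |p - t| + |d - g * l * t| + g * |e| := by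
        rw [abs_mul, abs_neg, abs_mul, abs_of_nonneg (sub_nonneg.2 hl), abs_of_nonneg hg]
    _ ≤ (1 - ρ) * |p - t| + |d - g * l * t| + g * |e| := by gcongr
    _ = _ := add_assoc _ _ _

theorem rpow_three_halves {x : ℝ} (hx : 0 < x) : x ^ (3 / 2 : ℝ) = x * √x := by
  rw [Real.sqrt_eq_rpow, ← Real.rpow_one_add' hx.le (by norm_num)]
  norm_num

/-- The deviation `⟨u, w - wo⟩ (⟨u, ∇J w⟩ - l ⟨u, w - wo⟩)` of the drift of `⟨u, w - wo⟩²` from its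
linearization at `wo`, where `u` is an eigenvector of the Hessian with eigenvalue `l`. -/
noncomputable def driftRemainder {M : ℕ} (J : Vec M → ℝ) (wo u : Vec M) (l : ℝ) (w : Vec M) : ℝ :=
  ⟪u, w - wo⟫ * (⟪u, gradient J w⟫ - l * ⟪u, w - wo⟫)

section DriftRemainder

variable {M : ℕ} {J : Vec M → ℝ} {wo u : Vec M} {ν δ τ r l : ℝ}

theorem measurable_driftRemainder : Measurable (driftRemainder J wo u l) := by
  have hgrad := measurable_gradient J
  unfold driftRemainder
  fun_prop

theorem abs_driftRemainder_le (h : CostCond J ν δ) (hmin : IsMinOn J Set.univ wo) (hu : ‖u‖ = 1)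
    (hl : l ∈ Set.Icc ν δ) (w : Vec M) : |driftRemainder J wo u l w| ≤ 2 * δ * ‖w - wo‖ ^ 2 := by
  calc _ ≤ ‖w - wo‖ * (2 * δ * ‖w - wo‖) := by
        rw [driftRemainder, abs_mul]
        gcongr
        · simpa [hu] using abs_real_inner_le_norm u (w - wo)
        · exact h.abs_inner_gradient_sub_le hmin hu hl w
    _ = _ := by ring

theorem abs_driftRemainder_le_pow_three (h : CostCond J ν δ) (hmin : IsMinOn J Set.univ wo)
    (hτ : 0 ≤ τ) (hr : 0 < r) (hlip : HessianLipschitzAt J wo τ r) (hu : ‖u‖ = 1)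
    (hl : l ∈ Set.Icc ν δ) (heig : ∀ d, ⟪u, fderiv ℝ (gradient J) wo d⟫ = l * ⟪u, d⟫)
    (w : Vec M) : |driftRemainder J wo u l w| ≤ (τ + 2 * δ / r) * ‖w - wo‖ ^ 3 := by
  calc _ ≤ ‖w - wo‖ * ((τ + 2 * δ / r) * ‖w - wo‖ ^ 2) := by
        rw [driftRemainder, abs_mul]
        gcongr
        · simpa [hu] using abs_real_inner_le_norm u (w - wo)
        · exact h.abs_inner_gradient_sub_le_sq hmin hτ hr hlip hu hl heig w
    _ = _ := by ring

end DriftRemainder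

namespace AsyncCentralizedModel

variable {M N : ℕ} {Ω : Type*} {mΩ : MeasurableSpace Ω} {P : Measure Ω} [IsProbabilityMeasure P]
  {A : CentralizedAlgorithm M N Ω} {J : Fin N → Vec M → ℝ} {wo u : Vec M}
  {β2 σs2 σπ2 : Fin N → ℝ} {μbar σμ2 μub ν δ : ℝ}

theorem sum_weight_moment_mul_integral_inner_mul_inner_mem_Icc
    (h : AsyncCentralizedModel P A J wo β2 σs2 σπ2 μbar σμ2 μub) (hJ : CostSystem J wo ν δ)
    (hu : ‖u‖ = 1) (i : ℕ) :
    ∑ k, ∑ l, (∫ ω, A.fusion i k ω * A.fusion i l ω ∂P) *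
        ∫ ω, ⟪u, gradient (J k) (A.iter i ω)⟫ * ⟪u, gradient (J l) (A.iter i ω)⟫ ∂P ∈
      Set.Icc 0 (δ ^ 2 * mse P A wo i) := by
  have hG := fun k => (h.memLp_gradient hJ (h.memLp_iter_sub hJ i) k).const_inner (𝕜 := ℝ) u
  have hint : ∀ k l, Integrable (fun ω => (∫ ω, A.fusion i k ω * A.fusion i l ω ∂P) *
      (⟪u, gradient (J k) (A.iter i ω)⟫ * ⟪u, gradient (J l) (A.iter i ω)⟫)) P := fun k l =>
    ((hG k).integrable_mul (hG l)).const_mul _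
  have hinner : ∀ a b : ℝ, ⟪a, b⟫ = a * b := fun a b => mul_comm b a
  have hform : ∀ g : Fin N → ℝ,
      ∑ k, ∑ l, (∫ ω, A.fusion i k ω * A.fusion i l ω ∂P) * (g k * g l) ∈
        Set.Icc 0 (∑ k, g k ^ 2) := fun g => by
    obtain ⟨mG, hmix, -, -⟩ := h.exists_mixingStep i
    simpa only [Set.mem_Icc, hinner, Real.norm_eq_abs, sq_abs] using
      And.intro (hmix.sum_weight_moment_mul_inner_nonneg g)
        (hmix.sum_weight_moment_mul_inner_le_sum g)
  simp only [← integral_const_mul]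
  simp only [← integral_finsetSum _ fun l _ => hint _ l]
  rw [← integral_finsetSum _ fun k _ => integrable_finsetSum _ fun l _ => hint k l]
  refine ⟨integral_nonneg fun ω => (hform _).1, ?_⟩
  rw [mse_eq_integral_norm_sq_sub, ← integral_const_mul]
  refine integral_mono
    (integrable_finsetSum _ fun k _ => integrable_finsetSum _ fun l _ => hint k l)
    ((h.integrable_norm_sq_iter_sub hJ i).const_mul _) fun ω => (hform _).2.trans ?_
  exact (Finset.sum_le_sum fun k _ => inner_sq_le_norm_sq hu _).trans
    (hJ.sum_norm_sq_gradient_le _)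

theorem sum_integral_inner_mul_inner_gradient
    (h : AsyncCentralizedModel P A J wo β2 σs2 σπ2 μbar σμ2 μub) (hJ : CostSystem J wo ν δ)
    (u : Vec M) (l : ℝ) (i : ℕ) :
    ∑ k, ∫ ω, ⟪u, A.iter i ω - wo⟫ * ⟪u, gradient (J k) (A.iter i ω)⟫ ∂P =
      l * ∫ ω, ⟪u, A.iter i ω - wo⟫ ^ 2 ∂P +
        ∫ ω, driftRemainder (aggregateCost J) wo u l (A.iter i ω) ∂P := by
  have hX := (h.memLp_iter_sub hJ i).const_inner (𝕜 := ℝ) u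
  have hG := fun k => (h.memLp_gradient hJ (h.memLp_iter_sub hJ i) k).const_inner (𝕜 := ℝ) u
  have hXG : ∀ k, Integrable
      (fun ω => ⟪u, A.iter i ω - wo⟫ * ⟪u, gradient (J k) (A.iter i ω)⟫) P :=
    fun k => hX.integrable_mul (hG k)
  have hremainder : ∀ ω, driftRemainder (aggregateCost J) wo u l (A.iter i ω) =
      ∑ k, ⟪u, A.iter i ω - wo⟫ * ⟪u, gradient (J k) (A.iter i ω)⟫ -
        l * ⟪u, A.iter i ω - wo⟫ ^ 2 := fun ω => by
    rw [driftRemainder, gradient_aggregateCost (fun k => (hJ.diff k).1), inner_sum,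
      ← Finset.mul_sum]
    ring
  simp only [hremainder]
  rw [integral_sub (integrable_finsetSum _ fun k _ => hXG k) (hX.integrable_sq.const_mul l),
    integral_const_mul, integral_finsetSum _ fun k _ => hXG k]
  ring

theorem integral_inner_sq_iter_succ
    (h : AsyncCentralizedModel P A J wo β2 σs2 σπ2 μbar σμ2 μub) (hJ : CostSystem J wo ν δ)
    (u : Vec M) (l : ℝ) (i : ℕ) :
    ∫ ω, ⟪u, A.iter (i + 1) ω - wo⟫ ^ 2 ∂P =
      ∫ ω, ⟪u, A.iter i ω - wo⟫ ^ 2 ∂P -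
        2 * (μbar / N) * (l * ∫ ω, ⟪u, A.iter i ω - wo⟫ ^ 2 ∂P +
          ∫ ω, driftRemainder (aggregateCost J) wo u l (A.iter i ω) ∂P) +
        μbar * muX μbar σμ2 *
          (∑ k, ∑ j, (∫ ω, A.fusion i k ω * A.fusion i j ω ∂P) *
            ∫ ω, ⟪u, gradient (J k) (A.iter i ω)⟫ * ⟪u, gradient (J j) (A.iter i ω)⟫ ∂P +
          ∑ k, (1 / (N : ℝ) ^ 2 + σπ2 k) *
            ∫ ω, ⟪u, A.noise J i k (A.iter i) ω⟫ ^ 2 ∂P) := by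
  have hsucc := h.setIntegral_norm_sq_map_iter_succ (innerSL ℝ u) hJ (i := i) MeasurableSet.univ
  have hinner : ∀ a b : ℝ, ⟪a, b⟫ = a * b := fun a b => mul_comm b a
  simp only [setIntegral_univ, innerSL_apply_apply, Real.norm_eq_abs, sq_abs, hinner] at hsucc
  rw [hsucc, h.sum_integral_inner_mul_inner_gradient hJ u l, mul_muX h.step.mean_pos.ne']

end AsyncCentralizedModel

/-- The constant `K` in the steady-state bound `|E (drift remainder)| ≤ K μ_x^{3/2}`. -/
noncomputable def driftCoeff {N : ℕ} (ν δ : ℝ) (σs2 σπ2 σ4 : Fin N → ℝ) (c τ r : ℝ) : ℝ :=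
  (τ + 2 * δ / r) * (msCoeff ν σs2 σπ2 + fourthCoeff ν σs2 σπ2 σ4 c) +
    2 * δ * msCoeff ν σs2 σπ2

/-- The constant `K` in the steady-state bound
`|E ⟨u, w̃⟩² - (μ_x / 2N) l⁻¹ ∑_k (1 + N² σ_{π,k}²) ρ_k| ≤ K μ_x^{3/2}`, where `u` is a unit
eigenvector of the Hessian with eigenvalue `l` and `ρ_k` is the limiting noise variance of agent `k`
along `u`. -/
noncomputable def directionCoeff {N : ℕ} (ν δ : ℝ) (β2 σs2 σπ2 σ4 : Fin N → ℝ) (c τ τ₂ r : ℝ)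
    (ρ : Fin N → ℝ) : ℝ :=
  N / ν * (2 / N * driftCoeff ν δ σs2 σπ2 σ4 c τ r + δ ^ 2 * msCoeff ν σs2 σπ2 +
    ∑ k, (1 / (N : ℝ) ^ 2 + σπ2 k) *
      noiseVarCoeff τ₂ r (β2 k) (σs2 k) (ρ k) (msCoeff ν σs2 σπ2)) + 1

namespace SmallStepRegime

variable {M N : ℕ} {Ω : Type*} {mΩ : MeasurableSpace Ω} {P : Measure Ω}
  {A : CentralizedAlgorithm M N Ω} {J : Fin N → Vec M → ℝ} {wo u : Vec M} {ν δ l : ℝ}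
  {β2 σs2 σπ2 β4 σ4 ρ : Fin N → ℝ} {c μbar σμ2 μub τ τ₂ κ r : ℝ}

theorem two_mul_div_mul_le_one
    (h : SmallStepRegime P A J wo ν δ β2 σs2 σπ2 β4 σ4 c μbar σμ2 μub) (hl : l ≤ δ) :
    2 * (μbar / N) * l ≤ 1 := by
  have hμ := h.step.mean_pos
  have hδ := h.system.cost.delta_pos
  have hN : (0 : ℝ) < N := Nat.cast_pos.2 h.num_pos
  calc 2 * (μbar / N) * l ≤ 2 * (μbar / N) * δ := by gcongr
    _ ≤ 2 * (muX μbar σμ2 / N) * δ := by gcongr; exact le_muX hμ.le h.variance_nonneg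
    _ = 2 * δ * muX μbar σμ2 / N := by ring
    _ ≤ 1 := (div_le_one hN).2 h.small.contraction

variable [IsProbabilityMeasure P]

theorem eventually_abs_integral_driftRemainder_le
    (h : SmallStepRegime P A J wo ν δ β2 σs2 σπ2 β4 σ4 c μbar σμ2 μub) (hτ : 0 ≤ τ) (hr : 0 < r)
    (hlip : HessianLipschitzAt (aggregateCost J) wo τ r) (hu : ‖u‖ = 1) (hl : l ∈ Set.Icc ν δ)
    (heig : ∀ d, ⟪u, fderiv ℝ (gradient (aggregateCost J)) wo d⟫ = l * ⟪u, d⟫) :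
    ∀ᶠ n in atTop, |∫ ω, driftRemainder (aggregateCost J) wo u l (A.iter n ω) ∂P| ≤
      driftCoeff ν δ σs2 σπ2 σ4 c τ r * (muX μbar σμ2 * √(muX μbar σμ2)) := by
  have hδ := h.system.cost.delta_pos
  exact h.eventually_abs_integral_le_mul_sqrt (by positivity) (by positivity)
    measurable_driftRemainder
    (abs_driftRemainder_le h.system.cost h.system.isMinOn hu hl)
    (abs_driftRemainder_le_pow_three h.system.cost h.system.isMinOn hτ hr hlip hu hl heig)

theorem eventually_abs_sum_integral_inner_noise_sq_sub_le
    (h : SmallStepRegime P A J wo ν δ β2 σs2 σπ2 β4 σ4 c μbar σμ2 μub)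
    (hτ₂ : 0 ≤ τ₂) (h1κ : 1 ≤ κ) (hκ2 : κ ≤ 2) (hr : 0 < r) (hS : CovarianceSmooth P A J wo τ₂ κ r)
    (hu : ‖u‖ = 1) (hρ : ∀ k, ∀ᵐ ω ∂P,
      Tendsto (fun n => A.condNoiseVar P J u n k (fun _ => wo) ω) atTop (𝓝 (ρ k))) :
    ∀ᶠ n in atTop,
      |∑ k, (1 / (N : ℝ) ^ 2 + σπ2 k) * ∫ ω, ⟪u, A.noise J n k (A.iter n) ω⟫ ^ 2 ∂P -
          ∑ k, (1 / (N : ℝ) ^ 2 + σπ2 k) * ρ k| ≤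
        (∑ k, (1 / (N : ℝ) ^ 2 + σπ2 k) *
          noiseVarCoeff τ₂ r (β2 k) (σs2 k) (ρ k) (msCoeff ν σs2 σπ2)) * √(muX μbar σμ2) := by
  filter_upwards [eventually_all.2 fun k =>
    h.eventually_abs_integral_inner_noise_sq_sub_le hτ₂ h1κ hκ2 hr hS hu (hρ k)] with n hn
  rw [← Finset.sum_sub_distrib, Finset.sum_mul]
  refine (Finset.abs_sum_le_sum_abs _ _).trans (Finset.sum_le_sum fun k _ => ?_)
  have hweight : 0 ≤ 1 / (N : ℝ) ^ 2 + σπ2 k :=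
    add_nonneg (by positivity) (h.fusion_variance_nonneg k)
  rw [← mul_sub, abs_mul, abs_of_nonneg hweight, mul_assoc]
  exact mul_le_mul_of_nonneg_left (hn k) hweight

theorem eventually_mse_le_mul_sqrt
    (h : SmallStepRegime P A J wo ν δ β2 σs2 σπ2 β4 σ4 c μbar σμ2 μub) :
    ∀ᶠ n in atTop, mse P A wo n ≤ msCoeff ν σs2 σπ2 * √(muX μbar σμ2) := by
  have hx := h.muX_pos
  have hle : muX μbar σμ2 ≤ √(muX μbar σμ2) :=
    Real.le_sqrt_of_sq_le (by nlinarith [h.small.le_one])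
  exact h.eventually_mse_le_mul.mono fun n hn =>
    hn.trans (mul_le_mul_of_nonneg_left hle h.msCoeff_pos.le)

theorem eventually_abs_second_moment_input_sub_le
    (h : SmallStepRegime P A J wo ν δ β2 σs2 σπ2 β4 σ4 c μbar σμ2 μub)
    (hτ₂ : 0 ≤ τ₂) (h1κ : 1 ≤ κ) (hκ2 : κ ≤ 2) (hr : 0 < r) (hS : CovarianceSmooth P A J wo τ₂ κ r)
    (hu : ‖u‖ = 1) (hρ : ∀ k, ∀ᵐ ω ∂P,
      Tendsto (fun n => A.condNoiseVar P J u n k (fun _ => wo) ω) atTop (𝓝 (ρ k))) :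
    ∀ᶠ n in atTop,
      |∑ k, ∑ l, (∫ ω, A.fusion n k ω * A.fusion n l ω ∂P) *
            ∫ ω, ⟪u, gradient (J k) (A.iter n ω)⟫ * ⟪u, gradient (J l) (A.iter n ω)⟫ ∂P +
          ∑ k, (1 / (N : ℝ) ^ 2 + σπ2 k) * ∫ ω, ⟪u, A.noise J n k (A.iter n) ω⟫ ^ 2 ∂P -
          ∑ k, (1 / (N : ℝ) ^ 2 + σπ2 k) * ρ k| ≤
        (δ ^ 2 * msCoeff ν σs2 σπ2 + ∑ k, (1 / (N : ℝ) ^ 2 + σπ2 k) *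
          noiseVarCoeff τ₂ r (β2 k) (σs2 k) (ρ k) (msCoeff ν σs2 σπ2)) * √(muX μbar σμ2) := by
  filter_upwards [h.eventually_mse_le_mul_sqrt,
    h.eventually_abs_sum_integral_inner_noise_sq_sub_le hτ₂ h1κ hκ2 hr hS hu hρ] with n hmse hnoise
  have hgrad := h.sum_weight_moment_mul_integral_inner_mul_inner_mem_Icc h.system hu n
  rw [add_sub_assoc, add_mul, mul_assoc]
  refine (abs_add_le _ _).trans (add_le_add ?_ hnoise)
  rw [abs_of_nonneg hgrad.1]
  exact hgrad.2.trans (by gcongr)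

theorem eventually_abs_integral_inner_sq_sub_le
    (h : SmallStepRegime P A J wo ν δ β2 σs2 σπ2 β4 σ4 c μbar σμ2 μub)
    (hτ : 0 ≤ τ) (hτ₂ : 0 ≤ τ₂) (h1κ : 1 ≤ κ) (hκ2 : κ ≤ 2) (hr : 0 < r)
    (hlip : HessianLipschitzAt (aggregateCost J) wo τ r) (hS : CovarianceSmooth P A J wo τ₂ κ r)
    (hu : ‖u‖ = 1) (hl : l ∈ Set.Icc ν δ)
    (heig : ∀ d, ⟪u, fderiv ℝ (gradient (aggregateCost J)) wo d⟫ = l * ⟪u, d⟫)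
    (hρ : ∀ k, ∀ᵐ ω ∂P,
      Tendsto (fun n => A.condNoiseVar P J u n k (fun _ => wo) ω) atTop (𝓝 (ρ k))) :
    ∀ᶠ n in atTop, |∫ ω, ⟪u, A.iter n ω - wo⟫ ^ 2 ∂P -
        muX μbar σμ2 / (2 * N) * (l⁻¹ * ∑ k, (1 + (N : ℝ) ^ 2 * σπ2 k) * ρ k)| ≤
      directionCoeff ν δ β2 σs2 σπ2 σ4 c τ τ₂ r ρ * (muX μbar σμ2 * √(muX μbar σμ2)) := by
  have hν := h.system.cost.nu_pos
  have hl0 : 0 < l := hν.trans_le hl.1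
  have hμ := h.step.mean_pos
  have hx := h.muX_pos
  have hN := h.num_pos
  rw [directionCoeff, add_one_mul]
  refine eventually_le_of_contraction (ρ := ν * μbar / N) (by positivity)
    (mul_div_le_one hN hν h.system.cost.nu_le h.β2_nonneg h.fusion_variance_nonneg hμ
      h.variance_nonneg h.small.mean_square) (by positivity) ?_
  filter_upwards [h.eventually_abs_integral_driftRemainder_le hτ hr hlip hu hl heig,
    h.eventually_abs_second_moment_input_sub_le hτ₂ h1κ hκ2 hr hS hu hρ] with n hdrift hinput
  rw [h.integral_inner_sq_iter_succ h.system u l]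
  set x := muX μbar σμ2
  set p := ∫ ω, ⟪u, A.iter n ω - wo⟫ ^ 2 ∂P
  set q := ∑ k, ∑ l, (∫ ω, A.fusion n k ω * A.fusion n l ω ∂P) * _
  set V := ∑ k, (1 / (N : ℝ) ^ 2 + σπ2 k) * ∫ ω, _ ∂P
  set W := ∑ k, (1 / (N : ℝ) ^ 2 + σπ2 k) * ρ k with hW
  have hsum : ∑ k, (1 + (N : ℝ) ^ 2 * σπ2 k) * ρ k = (N : ℝ) ^ 2 * W := by
    rw [hW, Finset.mul_sum]
    exact Finset.sum_congr rfl fun k _ => by field_simp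
  have hfixed : 2 * (μbar / N) * l * (x / (2 * N) * (l⁻¹ * (N ^ 2 * W))) = μbar * x * W := by
    field_simp
  have hscaled : |μbar * x * (q + V) - μbar * x * W| ≤ μbar * x *
      ((δ ^ 2 * msCoeff ν σs2 σπ2 + ∑ k, (1 / (N : ℝ) ^ 2 + σπ2 k) *
        noiseVarCoeff τ₂ r (β2 k) (σs2 k) (ρ k) (msCoeff ν σs2 σπ2)) * √x) := by
    rw [← mul_sub, abs_mul, abs_of_pos (mul_pos hμ hx)]
    gcongr
  rw [hsum]
  refine (abs_affine_step_sub_le (ρ := ν * μbar / N) (by positivity) ?_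
    (h.two_mul_div_mul_le_one hl.2)).trans ?_
  · calc ν * μbar / N ≤ l * μbar / N := by gcongr; exact hl.1
      _ ≤ 2 * (l * μbar / N) := by linarith [(by positivity : 0 ≤ l * μbar / N)]
      _ = _ := by ring
  · rw [hfixed]
    gcongr (1 - ν * μbar / N) * _ + ?_
    refine (add_le_add hscaled (mul_le_mul_of_nonneg_left hdrift (by positivity))).trans_eq ?_
    field_simp
    ring

end SmallStepRegime

theorem mse_eq_sum_integral_inner_sq {M N : ℕ} {Ω : Type*} [MeasurableSpace Ω] {P : Measure Ω}
    {A : CentralizedAlgorithm M N Ω} {wo : Vec M} (b : OrthonormalBasis (Fin M) ℝ (Vec M)) {n : ℕ}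
    (h : MemLp (fun ω => A.iter n ω - wo) 2 P) :
    mse P A wo n = ∑ a, ∫ ω, ⟪b a, A.iter n ω - wo⟫ ^ 2 ∂P := by
  rw [mse_eq_integral_norm_sq_sub,
    ← integral_finsetSum _ fun a _ => (h.const_inner (b a)).integrable_sq]
  refine integral_congr_ae (ae_of_all _ fun ω => ?_)
  simpa only [Real.norm_eq_abs, sq_abs] using (b.sum_sq_norm_inner_right (A.iter n ω - wo)).symm

theorem CostSystem.msdFormula_eq_sum {M N : ℕ} {J : Fin N → Vec M → ℝ} {wo : Vec M} {ν δ : ℝ}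
    (hJ : CostSystem J wo ν δ) (σπ2 : Fin N → ℝ) (Rs : Fin N → Matrix (Fin M) (Fin M) ℝ) (x : ℝ) :
    msdFormula J wo σπ2 Rs x = ∑ a, x / (2 * N) *
      (((hJ.cost.isHermitian_hessian wo).eigenvalues a)⁻¹ *
        ∑ k, (1 + (N : ℝ) ^ 2 * σπ2 k) *
          ⟪(hJ.cost.isHermitian_hessian wo).eigenvectorBasis a,
            Matrix.toEuclideanCLM (n := Fin M) (𝕜 := ℝ) (Rs k)
              ((hJ.cost.isHermitian_hessian wo).eigenvectorBasis a)⟫) := by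
  rw [msdFormula, ← hessian_aggregateCost hJ.diff,
    trace_inv_mul_eq_sum_eigenvalues (hJ.cost.isHermitian_hessian wo) fun a =>
      (hJ.cost.nu_pos.trans_le (hJ.cost.eigenvalues_hessian_mem_Icc wo a).1).ne', Finset.mul_sum]
  simp only [map_sum, map_smul, sum_apply, smul_apply, inner_sum, real_inner_smul_right]

/-- The constant `C` of the mean-square deviation formula: the sum of the constants along the
eigenvectors of the Hessian of the aggregate cost at the minimizer. -/
noncomputable def msdCoeff {M N : ℕ} {J : Fin N → Vec M → ℝ} {wo : Vec M} {ν δ : ℝ}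
    (hJ : CostSystem J wo ν δ) (β2 σs2 σπ2 σ4 : Fin N → ℝ) (c τ τ₂ r : ℝ)
    (Rs : Fin N → Matrix (Fin M) (Fin M) ℝ) : ℝ :=
  ∑ a, directionCoeff ν δ β2 σs2 σπ2 σ4 c τ τ₂ r fun k =>
    ⟪(hJ.cost.isHermitian_hessian wo).eigenvectorBasis a,
      Matrix.toEuclideanCLM (n := Fin M) (𝕜 := ℝ) (Rs k)
        ((hJ.cost.isHermitian_hessian wo).eigenvectorBasis a)⟫

theorem SmallStepRegime.eventually_abs_mse_sub_msdFormula_le {M N : ℕ} {Ω : Type*}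
    {mΩ : MeasurableSpace Ω} {P : Measure Ω} [IsProbabilityMeasure P]
    {A : CentralizedAlgorithm M N Ω} {J : Fin N → Vec M → ℝ} {wo : Vec M} {ν δ : ℝ}
    {β2 σs2 σπ2 β4 σ4 : Fin N → ℝ} {c μbar σμ2 μub τ τ₂ κ r : ℝ}
    {Rs : Fin N → Matrix (Fin M) (Fin M) ℝ}
    (h : SmallStepRegime P A J wo ν δ β2 σs2 σπ2 β4 σ4 c μbar σμ2 μub)
    (hτ : 0 ≤ τ) (hτ₂ : 0 ≤ τ₂) (h1κ : 1 ≤ κ) (hκ2 : κ ≤ 2) (hr : 0 < r)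
    (hlip : HessianLipschitzAt (aggregateCost J) wo τ r) (hS : CovarianceSmooth P A J wo τ₂ κ r)
    (hR : CovarianceLimit P A J wo Rs) :
    ∀ᶠ n in atTop, |mse P A wo n - msdFormula J wo σπ2 Rs (muX μbar σμ2)| ≤
      msdCoeff h.system β2 σs2 σπ2 σ4 c τ τ₂ r Rs * muX μbar σμ2 ^ (3 / 2 : ℝ) := by
  have hcost := h.system.cost
  set b := (hcost.isHermitian_hessian wo).eigenvectorBasis
  filter_upwards [eventually_all.2 fun a =>
    h.eventually_abs_integral_inner_sq_sub_le hτ hτ₂ h1κ hκ2 hr hlip hS (b.norm_eq_one a)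
      (hcost.eigenvalues_hessian_mem_Icc wo a) (hcost.inner_eigenvectorBasis_hessian wo a)
      fun k => hR.tendsto_condNoiseVar (b a) k] with n hn
  rw [mse_eq_sum_integral_inner_sq b (h.memLp_iter_sub h.system n), h.system.msdFormula_eq_sum,
    ← Finset.sum_sub_distrib, rpow_three_halves h.muX_pos, msdCoeff, Finset.sum_mul]
  exact (Finset.abs_sum_le_sum_abs _ _).trans (Finset.sum_le_sum fun a _ => hn a)

theorem lemma3 {M N : ℕ} (hN : 0 < N) (J : Fin N → Vec M → ℝ) (wo : Vec M)
    (νc δc : ℝ) (β2 σs2 σπ2 : Fin N → ℝ)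
    (hβ2 : ∀ k, 0 ≤ β2 k) (hσs2 : ∀ k, 0 ≤ σs2 k)
    (hdiff : ∀ k, TwiceDifferentiable (J k))
    (hconv : ∀ k, ConvexOn ℝ Set.univ (J k))
    (hmin : ∀ k, IsMinOn (J k) Set.univ wo)
    (hcost : CostCond (aggregateCost J) νc δc) :
    -- error recursion
    (∀ (Ω : Type u) [MeasurableSpace Ω] (P : Measure Ω) [IsProbabilityMeasure P]
      (A : CentralizedAlgorithm M N Ω) (μbar σμ2 μub : ℝ),
      AsyncCentralizedModel P A J wo β2 σs2 σπ2 μbar σμ2 μub →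
      muX μbar σμ2 / N < 2 * νc / (δc ^ 2 + betaC2 δc β2 σπ2) →
      0 ≤ alphaCent νc δc β2 σπ2 μbar σμ2 ∧ alphaCent νc δc β2 σπ2 μbar σμ2 < 1 ∧
      ∀ n, MemLp (A.iter n) 2 P ∧
        mse P A wo (n + 1) ≤ alphaCent νc δc β2 σπ2 μbar σμ2 * mse P A wo n +
          sigmaS2 σs2 σπ2 * (μbar ^ 2 + σμ2) / (N : ℝ) ^ 2) ∧
    -- steady-state error of order `μ_x`
    (∃ C μ₁ : ℝ, 0 < μ₁ ∧
      ∀ (Ω : Type u) [MeasurableSpace Ω] (P : Measure Ω) [IsProbabilityMeasure P]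
        (A : CentralizedAlgorithm M N Ω) (μbar σμ2 μub : ℝ),
        AsyncCentralizedModel P A J wo β2 σs2 σπ2 μbar σμ2 μub →
        muX μbar σμ2 ≤ μ₁ →
        BddAbove (Set.range (mse P A wo)) ∧
        limsup (mse P A wo) atTop ≤ C * muX μbar σμ2) ∧
    -- mean-square deviation
    (∀ (Rs : Fin N → Matrix (Fin M) (Fin M) ℝ) (τc τ₂ κ r : ℝ) (β4 σ4 : Fin N → ℝ) (c : ℝ),
      0 ≤ τc → 0 ≤ τ₂ → 1 ≤ κ → κ ≤ 2 → 0 < r → (∀ k, 0 ≤ β4 k) → (∀ k, 0 ≤ σ4 k) →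
      HessianLipschitzAt (aggregateCost J) wo τc r →
      ∃ C μ₁ : ℝ, 0 < μ₁ ∧
        ∀ (Ω : Type u) [MeasurableSpace Ω] (P : Measure Ω) [IsProbabilityMeasure P]
          (A : CentralizedAlgorithm M N Ω) (μbar σμ2 μub : ℝ),
          AsyncCentralizedModel P A J wo β2 σs2 σπ2 μbar σμ2 μub →
          CovarianceSmooth P A J wo τ₂ κ r →
          CovarianceLimit P A J wo Rs →
          FourthMomentCond P A J wo β4 σ4 →
          μub ^ 2 ≤ c * muX μbar σμ2 →
          muX μbar σμ2 ≤ μ₁ →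
          (∀ᶠ n in atTop, |mse P A wo n - msdFormula J wo σπ2 Rs (muX μbar σμ2)|
            ≤ C * muX μbar σμ2 ^ (3 / 2 : ℝ)) ∧
          |msd P A wo - msdFormula J wo σπ2 Rs (muX μbar σμ2)|
            ≤ C * muX μbar σμ2 ^ (3 / 2 : ℝ)) := by
  have hJ : CostSystem J wo νc δc := ⟨hdiff, hconv, hmin, hcost⟩
  have hν := hcost.nu_pos
  refine ⟨fun Ω _ P _ A μbar σμ2 μub h hx => ?_, ?_,
    fun Rs τc τ₂ κ r β4 σ4 c hτ hτ₂ h1κ hκ2 hr hβ4 hσ4 hlip => ?_⟩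
  · exact ⟨alphaCent_nonneg hν.le hcost.nu_le hβ2 h.fusion_variance_nonneg h.variance_nonneg,
      alphaCent_lt_one hN hcost.delta_pos hβ2 h.fusion_variance_nonneg h.step.mean_pos hx,
      fun n => ⟨h.memLp_iter hJ n, h.mse_succ_le hJ n⟩⟩
  · obtain ⟨μ₁, hμ₁, hsmall⟩ := exists_pos_forall_le_of_eventually_nhdsGT
      (eventually_nhdsGT_zero_mul_le (δc ^ 2 + betaC2 δc β2 σπ2) (by positivity : 0 < N * νc))
    refine ⟨sigmaS2 σs2 σπ2 / (N * νc), μ₁, hμ₁, fun Ω _ P _ A μbar σμ2 μub h hx => ?_⟩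
    have hstep := hsmall _ h.muX_pos hx
    exact ⟨h.bddAbove_mse hN hJ hβ2 hstep, h.limsup_mse_le hN hJ hβ2 hstep⟩
  · obtain ⟨μ₁, hμ₁, hsmall⟩ := exists_pos_forall_le_of_eventually_nhdsGT
      (eventually_smallStep hN hν δc β2 σπ2 β4 c)
    refine ⟨msdCoeff hJ β2 σs2 σπ2 σ4 c τc τ₂ r Rs, μ₁, hμ₁,
      fun Ω _ P _ A μbar σμ2 μub h hS hR h4 hub hx => ?_⟩
    have hregime : SmallStepRegime P A J wo νc δc β2 σs2 σπ2 β4 σ4 c μbar σμ2 μub :=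
      ⟨h, hN, hJ, hβ2, hσs2, hβ4, hσ4, h4, hub, hsmall _ h.muX_pos hx⟩
    have hmsd := hregime.eventually_abs_mse_sub_msdFormula_le hτ hτ₂ h1κ hκ2 hr hlip hS hR
    exact ⟨hmsd, abs_limsup_sub_le_of_eventually hmsd⟩
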